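/- For $N\ge 1$ and $\epsilon>0$, let $$Z_N(\mathbf s;\epsilon)=\frac{(2\pi)^{-N}}{\mathrm{Vol}(N)}\int_{\mathcal H(N)} e^{-\frac1\epsilon \mathrm{tr}\,\left(\frac12M^2-\sum_{j\ge1}s_jM^{2j}\right)}\,dM,\qquad \mathrm{Vol}(N)=\frac{\pi^{N(N-1)/2}}{\prod_{n=1}^{N-1}n!},$$ be the GUE partition function with even couplings $\mathbf s=(s_1,s_2,\dots)$. Here $\mathcal H(N)$ is the space of Hermitian $N\times N$ matrices, $dM=\prod_i dM_{ii}\prod_{i<j}d\mathrm{Re}M_{ij}\,d\mathrm{Im}M_{ij}$, and the integral is understood as a formal power series in $\mathbf s$: the factor $e^{\frac1\epsilon\sum_j s_j\mathrm{tr}M^{2j}}$ is expanded in powers of $\mathbf s$ and integrated term by term against $e^{-\frac1{2\epsilon}\mathrm{tr}M^2}dM$. Let $\mathcal F_0(x,\mathbf s)$, $x>0$, be the genus zero part of the free energy, i.e. the leading coefficient in the genus expansion $$\log Z_N(\mathbf s;\epsilon)-\tfrac1{12}\log\epsilon=\sum_{g\ge0}\epsilon^{2g-2}\mathcal F_g(x,\mathbf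 s),\qquad \epsilon=x/N,\ N\to\infty .$$ Thus, coefficientwise in $\mathbf s$, $\mathcal F_0(x,\mathbf s)$ is the limit of $\epsilon^2\left(\log Z_N(\mathbf s;\epsilon)-\frac1{12}\log\epsilon\right)$ with $\epsilon=x/N$ as $N\to\infty$. Put $\bar s_k=\binom{2k}{k}s_k$. **Proposition 1.1.** This limit exists for every $x>0$ and every monomial in $\mathbf s$, and the coefficients of $\mathcal F_0$ are smooth functions of $x>0$. Put $u=\partial_x^2\mathcal F_0$ and $w=e^{u}$. Then $w=w(x,\mathbf s)$ is the unique series solution of $$w=x+\sum_{k\ge1}k\,\bar s_k\,w^k,\qquad w(x,\mathbf s)=x+\dots$$ That is: for each $x>0$, $w(x,\cdot)$ is the only solution in $\mathbb R[[\mathbf s]]$. Moreover the equation has exactly one solution $W$ in $\mathbb R[[x,s_1,s_2,\dots]]$, it satisfies $W|_{\mathbf s=0}=x$, and for each $x>0$ and each monomial in $\mathbf s$ the coefficient of $W$, a power series in $x$, converges to the corresponding coefficient of $w(x,\cdot)$. Furthermore, for every $x>0$, as formal series in $\mathbf s$, $$\mathcal F_0=\frac{w^2}4-x\,w+\sum_{k\ge1}\bar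 s_k\left(x\,w^k-\frac{k}{k+1}w^{k+1}\right)+\frac12\sum_{k_1,k_2\ge1}\frac{k_1k_2}{k_1+k_2}\,\bar s_{k_1}\bar s_{k_2}\,w^{k_1+k_2}+\frac{x^2}2\log w .$$ -/

import Mathlib

open Filter Topology MeasureTheory
open scoped Nat ContDiff MvPowerSeries.WithPiTopology

noncomputable section

namespace GUE

/-! ### The Gaussian Unitary Ensemble with even couplings -/

/-- The Hermitian `N × N` matrix `M` with real coordinates `y`: `M i i = y i i`, and for `i < j`
`Re (M i j) = y i j`, `Im (M i j) = y j i`. In these coordinates, Lebesgue measure on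
`Fin N → Fin N → ℝ` is `dM = ∏ i, dM i i * ∏ i < j, dRe (M i j) dIm (M i j)`. -/
def hermitianOf {N : ℕ} (y : Fin N → Fin N → ℝ) : Matrix (Fin N) (Fin N) ℂ :=
  Matrix.of fun i j =>
    if i = j then (y i i : ℂ)
    else if i < j then (y i j : ℂ) + (y j i : ℂ) * Complex.I
    else (y j i : ℂ) - (y i j : ℂ) * Complex.I

/-- `tr (M ^ m)` for the Hermitian matrix `M` with coordinates `y`; it is a real number. -/
def tracePow {N : ℕ} (y : Fin N → Fin N → ℝ) (m : ℕ) : ℝ :=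
  ((hermitianOf y ^ m).trace).re

/-- `Vol(N) = Vol (U(N) / U(1)^N) = π ^ (N (N - 1) / 2) / G(N + 1)`, where
`G(N + 1) = ∏_{n = 1}^{N - 1} n !` is the Barnes function. -/
def flagVolume (N : ℕ) : ℝ :=
  Real.pi ^ (N * (N - 1) / 2) / ((∏ n ∈ Finset.Icc 1 (N - 1), n ! : ℕ) : ℝ)

/-- Formal power series in the couplings `s₁, s₂, s₃, …` with real coefficients. -/
abbrev CouplingSeries : Type := MvPowerSeries ℕ+ ℝ

/-- The partition function
`Z_N(s; ε) = (2π)^(-N) / Vol(N) * ∫ exp (-(1/ε) tr (M² / 2 - ∑_{j ≥ 1} s_j M^(2j))) dM`,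
where `exp ((1/ε) ∑_j s_j tr M^(2j)) = ∏_j ∑_m ((tr M^(2j) / ε)^m / m!) s_j^m` is expanded in powers
of `s` and integrated term by term against the Gaussian weight `exp (-tr M² / (2ε)) dM`. -/
def partitionFunction (N : ℕ) (ε : ℝ) : CouplingSeries := fun n =>
  (2 * Real.pi) ^ (-(N : ℤ)) / flagVolume N *
    ∫ y : Fin N → Fin N → ℝ,
      (n.prod fun j m => (tracePow y (2 * (j : ℕ)) / ε) ^ m / (m ! : ℝ)) *
        Real.exp (-(tracePow y 2 / (2 * ε)))

/-! ### Exponential, logarithm and derivative of formal series -/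

/-- `exp f = exp (f₀) * exp (f - f₀)`, with `f₀` the constant term of `f`. -/
def expSeries (f : CouplingSeries) : CouplingSeries :=
  let c := MvPowerSeries.constantCoeff f
  MvPowerSeries.C (Real.exp c) * (PowerSeries.exp ℝ).subst (f - MvPowerSeries.C c)

/-- `log f = log (f₀) + log (1 + (f / f₀ - 1))`, where the constant term `f₀` of `f` is positive
(`PowerSeries.log ℝ` is the series of `log (1 + X)`). -/
def logSeries (f : CouplingSeries) : CouplingSeries :=
  let c := MvPowerSeries.constantCoeff f
  MvPowerSeries.C (Real.log c) +
    (PowerSeries.log ℝ).subst (MvPowerSeries.C c⁻¹ * f - 1)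

/-- The second derivative in `x`, coefficient by coefficient, of a family of formal series in the
couplings that depends on the real parameter `x`. -/
def secondDeriv (F : ℝ → CouplingSeries) (x : ℝ) : CouplingSeries := fun n =>
  iteratedDeriv 2 (fun t => MvPowerSeries.coeff n (F t)) x

/-! ### The genus zero free energy -/

/-- `log Z_N(s; ε) - (1/12) log ε`. At `ε = x / N` its expansion for large `N`, with `x` fixed, is
the genus expansion `∑_{g ≥ 0} ε^(2g - 2) F_g(x, s)`. -/
def freeEnergy (N : ℕ) (ε : ℝ) : CouplingSeries :=
  logSeries (partitionFunction N ε) - MvPowerSeries.C (1 / 12 * Real.log ε)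

/-- For `n` a multi-index and `x` the 't Hooft coupling, the sequence in `N` of the coefficients at
`s ^ n` of `ε² * (log Z_N(s; ε) - (1/12) log ε)`, where `ε = x / N`. -/
def scaledCoeff (x : ℝ) (n : ℕ+ →₀ ℕ) (N : ℕ) : ℝ :=
  (x / N) ^ 2 * MvPowerSeries.coeff n (freeEnergy N (x / N))

/-- The genus zero free energy `F₀(x, s)`: the coefficient of `ε^(-2)` in the genus expansion, that
is, the coefficientwise limit of `ε²` times the free energy at `ε = x / N`, as `N → ∞`. -/
def genusZero (x : ℝ) : CouplingSeries := fun n =>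
  limUnder atTop (scaledCoeff x n)

/-- `w(x, s) = exp u(x, s)` with `u = ∂²F₀ / ∂x²`. -/
def w (x : ℝ) : CouplingSeries := expSeries (secondDeriv genusZero x)

/-! ### The equation for `w` -/

/-- The normalised coupling `(2k choose k) s_k`. -/
def sBar (k : ℕ+) : CouplingSeries :=
  MvPowerSeries.C ((2 * (k : ℕ)).choose k : ℝ) * MvPowerSeries.X k

/-- `V = x + ∑_{k ≥ 1} k (2k choose k) s_k V^k`, for a formal series `V` in variables that include
the `s_k`, and with `x` a given element of the same ring. The sum converges coefficientwise. -/
def SolvesStringEquation {σ : Type} (x : MvPowerSeries σ ℝ) (s : ℕ+ → MvPowerSeries σ ℝ)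
    (V : MvPowerSeries σ ℝ) : Prop :=
  HasSum (fun k : ℕ+ =>
    MvPowerSeries.C ((k : ℝ) * ((2 * (k : ℕ)).choose k : ℝ)) * s k * V ^ (k : ℕ)) (V - x)

/-- Formal power series in `x, s₁, s₂, …`: the variable `none` is `x`, and `some k` is `s_k`. -/
abbrev FullSeries : Type := MvPowerSeries (Option ℕ+) ℝ

/-- The coefficient of `x ^ m * s ^ n`. -/
def fullCoeff (m : ℕ) (n : ℕ+ →₀ ℕ) (V : FullSeries) : ℝ :=
  MvPowerSeries.coeff (n.optionElim m) V

/-- The `k`-th term of the single sum in the formula for `F₀`. -/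
def singleTerm (x : ℝ) (k : ℕ+) : CouplingSeries :=
  sBar k * (MvPowerSeries.C x * w x ^ (k : ℕ)
    - MvPowerSeries.C ((k : ℝ) / ((k : ℝ) + 1)) * w x ^ ((k : ℕ) + 1))

/-- The `(k₁, k₂)`-th term of the double sum in the formula for `F₀`. -/
def doubleTerm (x : ℝ) (p : ℕ+ × ℕ+) : CouplingSeries :=
  MvPowerSeries.C ((p.1 : ℝ) * (p.2 : ℝ) / ((p.1 : ℝ) + (p.2 : ℝ))) * sBar p.1 * sBar p.2
    * w x ^ ((p.1 : ℕ) + (p.2 : ℕ))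

end GUE

end

/-! The coefficients of `Z_N` are Gaussian expectations of products of traces, and everything rests
on computing them through orthogonal polynomials. Let e(k) = ∑ (j - 1) k_j denote the excess of a
multi-index k.

Reduction to eigenvalues. Integration by parts shows that the matrix expectations satisfy the loop
equations. The same equations hold for the expectations of power sums under the density Δ(λ)² ∏
exp(-λ_i²/2), Δ being the Vandermonde product. They determine all moments
(`SatisfiesLoopEquations.unique`), so the two families coincide and the Weyl integration formula is
not needed. Heine's formula, over the ring of series in the couplings, then gives `Z_N` as an
explicit constant times ∏ h_i with the couplings rescaled by s_j ↦ ε^(j-1) s_j, where h_i are the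
squared norms of the monic orthogonal polynomials p_i (`partitionFunction_eq`).

Large N. The ratios R_n = h_(n+1)/h_n obey the discrete string equation `hasSum_jacobiEntry`: R_n -
(n + 1) = ∑ 2j s_j times the coefficient of p_n in X^(2j-1) p_(n+1). That coefficient is a sum over
lattice paths with j down steps, each weighted by some R_m with m close to n, and there are (2j-1
choose j) paths. Since 2j (2j-1 choose j) = j (2j choose j), the limit is the string equation at x =
1: the coefficient of s^k in R_n, divided by n^(1+e(k)), tends to that of `unitSolution`
(`scaledTendsto_recurrenceCoeff`). Taking logarithms and summing twice, from R to h and from h to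
`Z_N`, produces the denominator (e(k)+1)(e(k)+2) in the coefficients of F₀; Stirling's formula
supplies the constant term. Two derivatives in x remove this denominator, so ∂²F₀ = log of the
string solution at x, which is `w_eq_solution`.

Closed formula. By homogeneity x-dependence is encoded by the excess: the derivation D multiplying
the coefficient at s^k by e(k) turns x²∂_x² F₀ = x² log w into (D+1)(D+2) F₀ = x² log w - (3/2) x².
The closed formula satisfies the same identity (`excessDerivation_closedForm`), and (D+1)(D+2) is
diagonal with positive eigenvalues, so the two sides agree. -/

noncomputable section

/-! ### Derivations, logarithm and exponential of formal power series -/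

namespace MvPowerSeries

variable {σ : Type*}

/-- The derivation of a power series ring that multiplies the coefficient at `n` by `w n`. -/
def weightDerivation (w : (σ →₀ ℕ) →+ ℝ) :
    Derivation ℝ (MvPowerSeries σ ℝ) (MvPowerSeries σ ℝ) where
  toFun f := fun n => w n * coeff n f
  map_add' f g := by
    ext n
    exact mul_add (w n) (coeff n f) (coeff n g)
  map_smul' r f := by
    ext n
    exact mul_left_comm (w n) r (coeff n f)
  map_one_eq_zero' := by
    classical
    ext n
    change w n * coeff n (1 : MvPowerSeries σ ℝ) = 0
    rw [coeff_one]
    split_ifs with h <;> simp [h]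
  leibniz' f g := by
    classical
    ext n
    change w n * coeff n (f * g) = coeff n (f * _) + coeff n (g * _)
    rw [mul_comm g, coeff_mul, coeff_mul, coeff_mul, Finset.mul_sum, ← Finset.sum_add_distrib]
    refine Finset.sum_congr rfl fun p hp => ?_
    change _ = coeff p.1 f * (w p.2 * coeff p.2 g) + (w p.1 * coeff p.1 f) * coeff p.2 g
    rw [← Finset.HasAntidiagonal.mem_antidiagonal.mp hp, map_add]
    ring

@[simp]
theorem coeff_weightDerivation (w : (σ →₀ ℕ) →+ ℝ) (f : MvPowerSeries σ ℝ) (n : σ →₀ ℕ) :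
    coeff n (weightDerivation w f) = w n * coeff n f := rfl

@[simp]
theorem weightDerivation_C (w : (σ →₀ ℕ) →+ ℝ) (r : ℝ) : weightDerivation w (C r) = 0 :=
  (weightDerivation w).map_algebraMap r

theorem weightDerivation_X (w : (σ →₀ ℕ) →+ ℝ) (i : σ) :
    weightDerivation w (X i) = C (w (Finsupp.single i 1)) * X i := by
  classical
  ext n
  rw [coeff_weightDerivation, coeff_C_mul, coeff_X]
  split_ifs with h <;> simp [h]

theorem continuous_weightDerivation (w : (σ →₀ ℕ) →+ ℝ) :
    Continuous (weightDerivation (σ := σ) w) :=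
  continuous_pi fun n => continuous_const.mul (WithPiTopology.continuous_coeff ℝ n)

theorem hasSum_weightDerivation (w : (σ →₀ ℕ) →+ ℝ) {ι : Type*} {f : ι → MvPowerSeries σ ℝ}
    {a : MvPowerSeries σ ℝ} (h : HasSum f a) :
    HasSum (fun i => weightDerivation w (f i)) (weightDerivation w a) :=
  h.map (weightDerivation w) (continuous_weightDerivation w)

/-- Since `a` has no constant term, `a ^ d` has order at least d, so powers beyond the degree of `n`
are invisible. Identities about substitution thereby reduce to polynomials. -/
theorem coeff_subst_eq_coeff_sum {a : MvPowerSeries σ ℝ} (ha : constantCoeff a = 0)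
    (p : PowerSeries ℝ) (n : σ →₀ ℕ) {M : ℕ} (hM : n.degree < M) :
    coeff n (p.subst a) =
      coeff n (∑ d ∈ Finset.range M, C (PowerSeries.coeff d p) * a ^ d) := by
  rw [PowerSeries.coeff_subst (PowerSeries.HasSubst.of_constantCoeff_zero ha),
    finsum_eq_sum_of_support_subset (s := Finset.range M), map_sum]
  · simp
  · intro d hd
    simp only [Finset.coe_range, Set.mem_Iio]
    by_contra hlt
    refine hd ?_
    change _ • coeff n (a ^ d) = 0
    rw [coeff_of_lt_order, smul_zero]
    refine lt_of_lt_of_le ?_ (le_order_pow_of_constantCoeff_eq_zero d ha)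
    exact_mod_cast (by lia : n.degree < d)

/-- The chain rule: for a polynomial `p` it is the Leibniz rule, and each coefficient sees only a
truncation of `p`. The truncation on the left is one longer because differentiation lowers the
degree. -/
theorem weightDerivation_subst (w : (σ →₀ ℕ) →+ ℝ) {a : MvPowerSeries σ ℝ}
    (ha : constantCoeff a = 0) (p : PowerSeries ℝ) :
    weightDerivation w (p.subst a) =
      (PowerSeries.derivative ℝ p).subst a * weightDerivation w a := by
  classical
  ext n
  have h1 : weightDerivation w
      (∑ d ∈ Finset.range (n.degree + 1 + 1), C (PowerSeries.coeff d p) * a ^ d) =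
      (∑ d ∈ Finset.range (n.degree + 1),
        C (PowerSeries.coeff d (PowerSeries.derivative ℝ p)) * a ^ d) * weightDerivation w a := by
    rw [map_sum, Finset.sum_range_succ', Finset.sum_mul]
    simp only [Derivation.leibniz, Derivation.leibniz_pow, weightDerivation_C, smul_eq_mul,
      mul_zero, add_zero, pow_zero, Derivation.map_one_eq_zero, PowerSeries.coeff_derivative]
    refine Finset.sum_congr rfl fun d _ => ?_
    simp only [map_mul, map_add, map_natCast, map_one, nsmul_eq_mul, Nat.add_sub_cancel]
    push_cast
    ring
  rw [coeff_weightDerivation, coeff_subst_eq_coeff_sum ha p n (M := n.degree + 1 + 1) (by lia),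
    ← coeff_weightDerivation, h1, coeff_mul, coeff_mul]
  refine Finset.sum_congr rfl fun q hq => ?_
  rw [coeff_subst_eq_coeff_sum ha _ q.1 (M := n.degree + 1)]
  rw [← Finset.HasAntidiagonal.mem_antidiagonal.mp hq, map_add]
  lia

/-- The degree of a multi-index, as a real number. -/
def degreeWeight (σ : Type*) : (σ →₀ ℕ) →+ ℝ := (Nat.castAddMonoidHom ℝ).comp Finsupp.degree

theorem degreeWeight_apply (n : σ →₀ ℕ) : degreeWeight σ n = (n.degree : ℝ) := rfl

theorem degreeWeight_ne_zero {n : σ →₀ ℕ} (hn : n ≠ 0) : degreeWeight σ n ≠ 0 := by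
  rw [degreeWeight_apply]
  exact_mod_cast (Finsupp.degree_eq_zero_iff n).not.mpr hn

/-- The degree derivation kills only constants, so it serves as the single antiderivative test for
identities between logarithms and exponentials. -/
theorem eq_of_degreeDerivation_eq {f g : MvPowerSeries σ ℝ}
    (h : weightDerivation (degreeWeight σ) f = weightDerivation (degreeWeight σ) g)
    (h0 : constantCoeff f = constantCoeff g) : f = g := by
  ext n
  by_cases hn : n = 0
  · rw [hn]
    exact h0
  · have := congrArg (coeff n) h
    rw [coeff_weightDerivation, coeff_weightDerivation] at this
    exact mul_left_cancel₀ (degreeWeight_ne_zero hn) this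

end MvPowerSeries

namespace GUE

open MvPowerSeries

theorem constantCoeff_logSeries {f : CouplingSeries} (hf : constantCoeff f ≠ 0) :
    constantCoeff (logSeries f) = Real.log (constantCoeff f) := by
  have h : constantCoeff (C (constantCoeff f)⁻¹ * f - 1) = 0 := by
    simp [inv_mul_cancel₀ hf]
  simp only [logSeries, map_add, constantCoeff_C]
  rw [PowerSeries.constantCoeff_subst_eq_zero h _ (by simp), add_zero]

/-- The logarithmic derivative in division-free form. Together with the constant term it replaces
every direct use of the series of log. -/
theorem weightDerivation_logSeries_mul (w : (ℕ+ →₀ ℕ) →+ ℝ) {f : CouplingSeries}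
    (hf : constantCoeff f ≠ 0) :
    weightDerivation w (logSeries f) * f = weightDerivation w f := by
  set g : CouplingSeries := C (constantCoeff f)⁻¹ * f - 1 with hg
  have h : constantCoeff g = 0 := by simp [hg, inv_mul_cancel₀ hf]
  have hs := PowerSeries.HasSubst.of_constantCoeff_zero h
  have h1 : logSeries f = C (Real.log (constantCoeff f)) + (PowerSeries.log ℝ).subst g := rfl
  have h2 : PowerSeries.derivative ℝ (PowerSeries.log ℝ) * (1 + PowerSeries.X) = 1 := by
    rw [PowerSeries.deriv_log]
    ext n
    rcases n with _ | n
    · simp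
    · rw [mul_add, mul_one, map_add, PowerSeries.coeff_succ_mul_X]
      simp [pow_succ, PowerSeries.coeff_one]
  have h3 := congrArg (PowerSeries.subst g) h2
  rw [PowerSeries.subst_mul hs, PowerSeries.subst_add hs, PowerSeries.subst_X hs,
    ← PowerSeries.coe_substAlgHom hs, map_one, PowerSeries.coe_substAlgHom hs] at h3
  have h4 : f = C (constantCoeff f) * (1 + g) := by
    rw [hg, add_sub_cancel, ← mul_assoc, ← map_mul, mul_inv_cancel₀ hf, map_one, one_mul]
  have h5 : weightDerivation w g = C (constantCoeff f)⁻¹ * weightDerivation w f := by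
    rw [hg, map_sub, Derivation.leibniz, weightDerivation_C, Derivation.map_one_eq_zero]
    simp
  have h6 : (C (constantCoeff f)⁻¹ * C (constantCoeff f) : CouplingSeries) = 1 := by
    rw [← map_mul, inv_mul_cancel₀ hf, map_one]
  rw [h1, map_add, weightDerivation_C, zero_add, weightDerivation_subst w h, h5]
  set S := PowerSeries.subst g (PowerSeries.derivative ℝ (PowerSeries.log ℝ))
  linear_combination (S * C (constantCoeff f)⁻¹ * weightDerivation w f) * h4
    + (S * (1 + g) * weightDerivation w f) * h6 + weightDerivation w f * h3

theorem constantCoeff_expSeries (f : CouplingSeries) :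
    constantCoeff (expSeries f) = Real.exp (constantCoeff f) := by
  have h : constantCoeff (f - C (constantCoeff f)) = 0 := by simp
  have h1 : constantCoeff ((PowerSeries.exp ℝ).subst (f - C (constantCoeff f))) = 1 := by
    have := coeff_subst_eq_coeff_sum h (PowerSeries.exp ℝ) 0 (M := 1) (by simp)
    simpa using this
  simp only [expSeries, map_mul, constantCoeff_C]
  rw [h1, mul_one]

theorem weightDerivation_expSeries (w : (ℕ+ →₀ ℕ) →+ ℝ) (f : CouplingSeries) :
    weightDerivation w (expSeries f) = expSeries f * weightDerivation w f := by
  have h : constantCoeff (f - C (constantCoeff f)) = 0 := by simp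
  simp only [expSeries]
  rw [Derivation.leibniz, weightDerivation_C, smul_zero, add_zero, weightDerivation_subst w h,
    map_sub, weightDerivation_C, sub_zero, PowerSeries.derivative_exp, smul_eq_mul, mul_assoc]

/-- The quotient exp(log f) / f is annihilated by the degree derivation and has constant term 1. -/
theorem expSeries_logSeries {f : CouplingSeries} (hf : 0 < constantCoeff f) :
    expSeries (logSeries f) = f := by
  set D := weightDerivation (degreeWeight ℕ+)
  set h := expSeries (logSeries f)
  have hinv : f * f⁻¹ = 1 := MvPowerSeries.mul_inv_cancel f hf.ne'
  have hlog : D (logSeries f) * f = D f := weightDerivation_logSeries_mul _ hf.ne'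
  have hexp : D h = h * D (logSeries f) := weightDerivation_expSeries _ _
  have hD : f * D f⁻¹ + f⁻¹ * D f = 0 := by
    have := congrArg D hinv
    rwa [Derivation.leibniz, Derivation.map_one_eq_zero] at this
  have hzero : D (h * f⁻¹) = D 1 := by
    rw [Derivation.leibniz, Derivation.map_one_eq_zero, smul_eq_mul, smul_eq_mul, hexp]
    linear_combination (f⁻¹ * h) * hD + f⁻¹ * h * f⁻¹ * hlog
      - (h * D f⁻¹ + f⁻¹ * (h * D (logSeries f))) * hinv
  have hone : h * f⁻¹ = 1 := by
    refine eq_of_degreeDerivation_eq hzero ?_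
    have h0 := congrArg constantCoeff hinv
    rw [map_mul, map_one] at h0
    rw [map_mul, constantCoeff_expSeries, constantCoeff_logSeries hf.ne', Real.exp_log hf, h0,
      map_one]
  linear_combination f * hone - h * hinv

/-- For power series with nonzero constant term, `log (f * g)` and `log f + log g` differ by a
constant. -/
theorem coeff_logSeries_mul {f g : CouplingSeries} (hf : constantCoeff f ≠ 0)
    (hg : constantCoeff g ≠ 0) {n : ℕ+ →₀ ℕ} (hn : n ≠ 0) :
    coeff n (logSeries (f * g)) = coeff n (logSeries f) + coeff n (logSeries g) := by
  set D := weightDerivation (degreeWeight ℕ+)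
  have hfg : constantCoeff (f * g) ≠ 0 := by
    rw [map_mul]
    exact mul_ne_zero hf hg
  have h1 : D (logSeries f) * f = D f := weightDerivation_logSeries_mul _ hf
  have h2 : D (logSeries g) * g = D g := weightDerivation_logSeries_mul _ hg
  have h3 : D (logSeries (f * g)) * (f * g) = D (f * g) := weightDerivation_logSeries_mul _ hfg
  have h4 : D (logSeries (f * g)) = D (logSeries f + logSeries g) := by
    have hinv : (f * g) * (f * g)⁻¹ = 1 := MvPowerSeries.mul_inv_cancel _ hfg
    have h5 : D (logSeries (f * g)) * (f * g) = D (logSeries f + logSeries g) * (f * g) := by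
      rw [h3, map_add, Derivation.leibniz, smul_eq_mul, smul_eq_mul]
      linear_combination -g * h1 - f * h2
    linear_combination (f * g)⁻¹ * h5
      + (D (logSeries f + logSeries g) - D (logSeries (f * g))) * hinv
  have h5 := congrArg (coeff n) h4
  rw [coeff_weightDerivation, coeff_weightDerivation, map_add] at h5
  exact mul_left_cancel₀ (degreeWeight_ne_zero hn) h5

theorem coeff_logSeries_C {c : ℝ} (hc : c ≠ 0) {n : ℕ+ →₀ ℕ} (hn : n ≠ 0) :
    coeff n (logSeries (C c)) = 0 := by
  have h0 : constantCoeff (C c : CouplingSeries) ≠ 0 := by simpa using hc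
  have h := weightDerivation_logSeries_mul (degreeWeight ℕ+) h0
  rw [weightDerivation_C] at h
  have h1 := congrArg (coeff n) h
  rw [coeff_mul_C, coeff_weightDerivation, map_zero] at h1
  rcases mul_eq_zero.mp h1 with h2 | h2
  · exact (mul_eq_zero.mp h2).resolve_left (degreeWeight_ne_zero hn)
  · exact absurd h2 hc

theorem coeff_logSeries_prod {ι : Type*} (s : Finset ι) (f : ι → CouplingSeries)
    (hf : ∀ i ∈ s, constantCoeff (f i) ≠ 0) {n : ℕ+ →₀ ℕ} (hn : n ≠ 0) :
    coeff n (logSeries (∏ i ∈ s, f i)) = ∑ i ∈ s, coeff n (logSeries (f i)) := by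
  classical
  induction s using Finset.induction_on with
  | empty =>
    simpa using coeff_logSeries_C one_ne_zero hn
  | insert a s ha ih =>
    rw [Finset.prod_insert ha, Finset.sum_insert ha,
      coeff_logSeries_mul (hf a (Finset.mem_insert_self a s)) _ hn,
      ih fun i hi => hf i (Finset.mem_insert_of_mem hi)]
    rw [map_prod]
    exact Finset.prod_ne_zero_iff.mpr fun i hi => hf i (Finset.mem_insert_of_mem hi)

end GUE

/-! ### Fixed points of contractions of power series -/

namespace MvPowerSeries

variable {σ : Type*}

/-- Equality of the coefficients of total degree less than `d`. -/
def AgreeBelow (d : ℕ) (f g : MvPowerSeries σ ℝ) : Prop :=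
  ∀ n : σ →₀ ℕ, n.degree < d → coeff n f = coeff n g

theorem AgreeBelow.mul {d : ℕ} {f g f' g' : MvPowerSeries σ ℝ} (h : AgreeBelow d f g)
    (h' : AgreeBelow d f' g') : AgreeBelow d (f * f') (g * g') := by
  classical
  intro n hn
  rw [coeff_mul, coeff_mul]
  refine Finset.sum_congr rfl fun p hp => ?_
  rw [← Finset.HasAntidiagonal.mem_antidiagonal.mp hp, map_add] at hn
  rw [h p.1 (by lia), h' p.2 (by lia)]

theorem AgreeBelow.pow {d : ℕ} {f g : MvPowerSeries σ ℝ} (h : AgreeBelow d f g) (k : ℕ) :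
    AgreeBelow d (f ^ k) (g ^ k) := by
  induction k with
  | zero =>
    intro n _
    simp
  | succ k ih =>
    rw [pow_succ, pow_succ]
    exact ih.mul h

theorem coeff_X_mul_eq (i : σ) (f : MvPowerSeries σ ℝ) (n : σ →₀ ℕ) :
    coeff n (X i * f) =
      if Finsupp.single i 1 ≤ n then coeff (n - Finsupp.single i 1) f else 0 := by
  classical
  rw [X, coeff_monomial_mul]
  simp

theorem degree_sub_single_lt {n : σ →₀ ℕ} {i : σ} (h : Finsupp.single i 1 ≤ n) :
    (n - Finsupp.single i 1).degree < n.degree := by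
  have := congrArg Finsupp.degree (tsub_add_cancel_of_le h)
  rw [map_add, Finsupp.degree_single] at this
  lia

/-- Multiplication by a variable gains one degree of agreement; this gain is what makes the string
equation a contraction. -/
theorem AgreeBelow.X_mul {d : ℕ} {f g : MvPowerSeries σ ℝ} (h : AgreeBelow d f g) (i : σ) :
    AgreeBelow (d + 1) (X i * f) (X i * g) := by
  intro n hn
  rw [coeff_X_mul_eq, coeff_X_mul_eq]
  split_ifs with hi
  · have := degree_sub_single_lt hi
    exact h _ (by lia)
  · rfl

/-- A map that improves the order of agreement has a unique fixed point. -/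
theorem existsUnique_fixedPoint (Ψ : MvPowerSeries σ ℝ → MvPowerSeries σ ℝ)
    (hΨ : ∀ d f g, AgreeBelow d f g → AgreeBelow (d + 1) (Ψ f) (Ψ g)) : ∃! f, Ψ f = f := by
  have hstep : ∀ d, AgreeBelow d (Ψ^[d] 0) (Ψ^[d + 1] 0) := by
    intro d
    induction d with
    | zero => exact fun n hn => absurd hn (Nat.not_lt_zero _)
    | succ d ih =>
      rw [Function.iterate_succ_apply', Function.iterate_succ_apply']
      exact hΨ d _ _ ih
  have hle : ∀ d e, d ≤ e → AgreeBelow d (Ψ^[d] 0) (Ψ^[e] 0) := by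
    intro d e hde
    induction e, hde using Nat.le_induction with
    | base => exact fun n _ => rfl
    | succ e he ih => exact fun n hn => (ih n hn).trans (hstep e n (by lia))
  -- The coefficient at `n` has settled once the number of iterations exceeds the degree of `n`.
  set F : MvPowerSeries σ ℝ := fun n => coeff n (Ψ^[n.degree + 1] 0) with hF
  have hagree : ∀ d, AgreeBelow d F (Ψ^[d] 0) := fun d n hn =>
    hle (n.degree + 1) d hn n (Nat.lt_succ_self _)
  refine ⟨F, ?_, fun G hG => ?_⟩
  · ext n
    have h1 := hΨ n.degree _ _ (hagree n.degree) n (Nat.lt_succ_self _)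
    rw [h1, ← Function.iterate_succ_apply' Ψ]
    rfl
  · have : ∀ d, AgreeBelow d G F := by
      intro d
      induction d with
      | zero => exact fun n hn => absurd hn (Nat.not_lt_zero _)
      | succ d ih =>
        intro n hn
        have h1 := hΨ d _ _ ih n hn
        have h2 := hΨ d _ _ (hagree d) n hn
        rw [hG, h2, ← Function.iterate_succ_apply' Ψ] at h1
        rw [h1, hagree (d + 1) n hn]
    ext n
    exact this (n.degree + 1) n (Nat.lt_succ_self _)

/-- A sum of multiples of distinct variables converges. -/
theorem summable_X_mul {ι : Type*} {e : ι → σ} (he : Function.Injective e)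
    (a : ι → MvPowerSeries σ ℝ) : Summable fun k => X (e k) * a k := by
  rw [WithPiTopology.summable_iff_summable_coeff]
  intro n
  refine summable_of_hasFiniteSupport (((n.support.finite_toSet).preimage he.injOn).subset ?_)
  intro k hk
  by_contra hn
  refine hk ?_
  change coeff n (X (e k) * a k) = 0
  rw [coeff_X_mul_eq, if_neg]
  intro h
  have := h (e k)
  simp only [Set.mem_preimage, SetLike.mem_coe, Finsupp.mem_support_iff, not_not] at hn
  rw [hn] at this
  simp at this

theorem coeff_tsum {ι : Type*} {f : ι → MvPowerSeries σ ℝ} (hf : Summable f) (n : σ →₀ ℕ) :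
    coeff n (∑' k, f k) = ∑' k, coeff n (f k) :=
  ((WithPiTopology.hasSum_iff_hasSum_coeff.mp hf.hasSum n).tsum_eq).symm

theorem AgreeBelow.tsum {ι : Type*} {d : ℕ} {f g : ι → MvPowerSeries σ ℝ} (hf : Summable f)
    (hg : Summable g) (h : ∀ k, AgreeBelow d (f k) (g k)) :
    AgreeBelow d (∑' k, f k) (∑' k, g k) := by
  intro n hn
  rw [coeff_tsum hf, coeff_tsum hg]
  exact tsum_congr fun k => h k n hn

theorem continuous_rescale (a : σ → ℝ) : Continuous (rescale a) := by
  refine continuous_pi fun n => ?_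
  change Continuous fun f => coeff n (rescale a f)
  simp only [coeff_rescale]
  exact continuous_const.mul (WithPiTopology.continuous_coeff ℝ n)

theorem rescale_X (a : σ → ℝ) (i : σ) : rescale a (X i) = C (a i) * X i := by
  classical
  ext n
  rw [coeff_rescale, coeff_C_mul, coeff_X]
  split_ifs with h
  · subst h
    simp
  · simp

theorem rescale_C (a : σ → ℝ) (r : ℝ) : rescale a (C r : MvPowerSeries σ ℝ) = C r := by
  classical
  ext n
  rw [coeff_rescale, coeff_C]
  split_ifs with h
  · subst h
    simp
  · simp

end MvPowerSeries

/-! ### The string equation -/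

namespace GUE

open MvPowerSeries

/-- Every term of the sum carries a coupling, so the right hand side of the equation is a
contraction for the degree. The injection `e` lets one argument serve both the ring in s and the
ring in x, s. -/
theorem existsUnique_solvesStringEquation {σ : Type} {e : ℕ+ → σ} (he : Function.Injective e)
    (x : MvPowerSeries σ ℝ) : ∃! V, SolvesStringEquation x (fun k => X (e k)) V := by
  set a : MvPowerSeries σ ℝ → ℕ+ → MvPowerSeries σ ℝ := fun V k =>
    C ((k : ℝ) * ((2 * (k : ℕ)).choose k : ℝ)) * V ^ (k : ℕ) with ha
  have hsum : ∀ V, Summable fun k => X (e k) * a V k := fun V => summable_X_mul he (a V)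
  obtain ⟨V, hV, huniq⟩ := existsUnique_fixedPoint (fun V => x + ∑' k, X (e k) * a V k) (by
    intro d f g h n hn
    rw [map_add, map_add]
    congr 1
    refine AgreeBelow.tsum (hsum f) (hsum g) (fun k => AgreeBelow.X_mul ?_ (e k)) n hn
    exact AgreeBelow.mul (fun _ _ => rfl) (h.pow _))
  have hiff : ∀ V, SolvesStringEquation x (fun k => X (e k)) V ↔
      x + ∑' k, X (e k) * a V k = V := by
    intro V
    have hterm : (fun k : ℕ+ => C ((k : ℝ) * ((2 * (k : ℕ)).choose k : ℝ)) * X (e k) *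
        V ^ (k : ℕ)) = fun k => X (e k) * a V k := by
      funext k
      simp only [ha]
      ring
    unfold SolvesStringEquation
    rw [hterm]
    constructor
    · intro h
      rw [h.tsum_eq, add_sub_cancel]
    · intro h
      rw [← h, add_sub_cancel_left, h]
      exact (hsum V).hasSum
  exact ⟨V, (hiff V).mpr hV, fun U hU => huniq U ((hiff U).mp hU)⟩

/-- The solution of the string equation at `x = 1`. -/
def unitSolution : CouplingSeries :=
  (existsUnique_solvesStringEquation (e := id) Function.injective_id (C 1)).choose

theorem unitSolution_solves : SolvesStringEquation (C 1) X unitSolution :=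
  (existsUnique_solvesStringEquation (e := id) Function.injective_id (C 1)).choose_spec.1

/-- The additive weight `∑ (j - 1) n_j` of a multi-index. -/
def excess : (ℕ+ →₀ ℕ) →+ ℕ := Finsupp.weight fun j : ℕ+ => (j : ℕ) - 1

theorem excess_single (j : ℕ+) (m : ℕ) : excess (Finsupp.single j m) = m * ((j : ℕ) - 1) := by
  rw [excess, Finsupp.weight_single, smul_eq_mul]

theorem prod_pow_excess {M : Type*} [CommMonoid M] (x : M) (n : ℕ+ →₀ ℕ) :
    (n.prod fun j m => (x ^ ((j : ℕ) - 1)) ^ m) = x ^ excess n := by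
  rw [excess, Finsupp.weight_apply, Finsupp.sum, Finsupp.prod, ← Finset.prod_pow_eq_pow_sum]
  refine Finset.prod_congr rfl fun j _ => ?_
  rw [← pow_mul, smul_eq_mul, mul_comm]

/-- The rescaling `s_j ↦ x ^ (j - 1) s_j`. -/
def scaleCouplings (x : ℝ) : CouplingSeries →+* CouplingSeries :=
  rescale fun j : ℕ+ => x ^ ((j : ℕ) - 1)

theorem coeff_scaleCouplings (x : ℝ) (f : CouplingSeries) (n : ℕ+ →₀ ℕ) :
    coeff n (scaleCouplings x f) = x ^ excess n * coeff n f := by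
  rw [scaleCouplings, coeff_rescale, prod_pow_excess]

/-- The solution of the string equation at `x`, by scaling. -/
def solution (x : ℝ) : CouplingSeries := C x * scaleCouplings x unitSolution

theorem coeff_solution (x : ℝ) (n : ℕ+ →₀ ℕ) :
    coeff n (solution x) = x ^ (1 + excess n) * coeff n unitSolution := by
  rw [solution, coeff_C_mul, coeff_scaleCouplings]
  ring

/-- Homogeneity: under s_k ↦ x^(k-1) s_k and V ↦ x V the term s_k V^k of the equation at 1 acquires
the factor x · x^(k-1) = x^k. The rescaling is a continuous ring map, so it passes through the
infinite sum. -/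
theorem solution_solves (x : ℝ) : SolvesStringEquation (C x) X (solution x) := by
  have h := ((unitSolution_solves.map (scaleCouplings x) (continuous_rescale _)).mul_left
    (C x : CouplingSeries))
  have h1 : (fun k : ℕ+ => C ((k : ℝ) * ((2 * (k : ℕ)).choose k : ℝ)) * X k *
      solution x ^ (k : ℕ)) = fun k : ℕ+ => C x * scaleCouplings x
        (C ((k : ℝ) * ((2 * (k : ℕ)).choose k : ℝ)) * X k * unitSolution ^ (k : ℕ)) := by
    funext k
    have hk : (C x : CouplingSeries) ^ (k : ℕ) = C x * C (x ^ ((k : ℕ) - 1)) := by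
      rw [map_pow, ← pow_succ', Nat.sub_add_cancel k.pos]
    generalize (k : ℝ) * ((2 * (k : ℕ)).choose k : ℝ) = r
    rw [solution, mul_pow, hk]
    simp only [map_mul, map_pow, scaleCouplings, rescale_X, rescale_C]
    ring
  have h2 : solution x - C x = C x * scaleCouplings x (unitSolution - C 1) := by
    rw [map_sub, mul_sub, solution, scaleCouplings, rescale_C, ← map_mul, mul_one]
  unfold SolvesStringEquation
  rw [h1, h2]
  exact h

theorem solvesStringEquation_iff (x : ℝ) (V : CouplingSeries) :
    SolvesStringEquation (C x) X V ↔ V = solution x := by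
  obtain ⟨U, -, hU⟩ := existsUnique_solvesStringEquation (e := id) Function.injective_id
    (C x : CouplingSeries)
  refine ⟨fun h => (hU V h).trans (hU _ (solution_solves x)).symm, ?_⟩
  rintro rfl
  exact solution_solves x

theorem constantCoeff_unitSolution : constantCoeff unitSolution = 1 := by
  have h := WithPiTopology.hasSum_iff_hasSum_coeff.mp unitSolution_solves 0
  have h0 : ∀ k : ℕ+, coeff 0 (C ((k : ℝ) * ((2 * (k : ℕ)).choose k : ℝ)) * X k *
      unitSolution ^ (k : ℕ)) = 0 := by
    intro k
    rw [mul_right_comm, coeff_zero_mul_X]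
  simp only [h0] at h
  have h1 := h.unique hasSum_zero
  rw [map_sub, coeff_zero_eq_constantCoeff, constantCoeff_C] at h1
  linarith

theorem constantCoeff_solution (x : ℝ) : constantCoeff (solution x) = x := by
  have := coeff_solution x 0
  rw [coeff_zero_eq_constantCoeff, constantCoeff_unitSolution] at this
  simpa using this

/-! ### The solution in all the variables -/

/-- The series `x ^ (j - 1) s_j`. -/
def scaledCoupling (j : ℕ+) : FullSeries := X none ^ ((j : ℕ) - 1) * X (some j)

theorem scaledCoupling_eq (j : ℕ+) : scaledCoupling j =
    monomial ((Finsupp.single j 1).optionElim ((j : ℕ) - 1)) 1 := by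
  rw [scaledCoupling, X_pow_eq, X, monomial_mul_monomial, one_mul]
  congr 2
  ext o
  cases o <;> simp [Finsupp.optionElim_apply_eq_elim, Finsupp.single_apply]

theorem hasSubst_scaledCoupling : HasSubst scaledCoupling where
  const_coeff j := by
    simp [scaledCoupling]
  coeff_zero μ := by
    classical
    -- The monomial x^(j-1) s_j can only equal `μ` when s_j occurs in `μ`, which leaves finitely
    -- many j.
    refine ((μ.some.support.finite_toSet).subset ?_)
    intro j hj
    rw [Set.mem_ofPred_eq, scaledCoupling_eq, coeff_monomial] at hj
    rw [(ite_ne_right_iff.mp hj).1, Finsupp.some_optionElim]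
    simp

theorem prod_scaledCoupling (n : ℕ+ →₀ ℕ) :
    (n.prod fun j m => scaledCoupling j ^ m) = monomial (n.optionElim (excess n)) 1 := by
  induction n using Finsupp.induction_linear with
  | zero =>
    rw [Finsupp.prod_zero_index, map_zero, Finsupp.optionElim_zero, Finsupp.single_zero,
      monomial_zero_one]
  | add f g hf hg =>
    rw [Finsupp.prod_add_index' (fun _ => pow_zero _) (fun _ _ _ => pow_add _ _ _), hf, hg,
      monomial_mul_monomial, one_mul]
    congr 2
    ext o
    cases o <;> simp [Finsupp.optionElim_apply_eq_elim]
  | single j m =>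
    rw [Finsupp.prod_single_index (h := fun j m => scaledCoupling j ^ m) (pow_zero _),
      scaledCoupling_eq, monomial_pow, one_pow]
    congr 2
    ext o
    cases o <;>
      simp [Finsupp.optionElim_apply_eq_elim, excess_single, Finsupp.single_apply]

/-- The substitution `s_j ↦ x ^ (j - 1) s_j` into series in `x, s`. -/
def homogenize : CouplingSeries →ₐ[ℝ] FullSeries := substAlgHom hasSubst_scaledCoupling

theorem coeff_homogenize (f : CouplingSeries) (μ : Option ℕ+ →₀ ℕ) :
    coeff μ (homogenize f) = if μ none = excess μ.some then coeff μ.some f else 0 := by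
  classical
  rw [homogenize, substAlgHom_apply, coeff_subst hasSubst_scaledCoupling,
    finsum_eq_single _ μ.some]
  · rw [prod_scaledCoupling, coeff_monomial]
    have : μ = μ.some.optionElim (excess μ.some) ↔ μ none = excess μ.some := by
      constructor
      · intro h
        conv_lhs => rw [h]
        simp [Finsupp.optionElim_apply_eq_elim]
      · intro h
        rw [← h, Finsupp.optionElim_some]
    simp only [this]
    split_ifs <;> simp
  · intro n hn
    rw [prod_scaledCoupling, coeff_monomial, if_neg, smul_zero]
    intro h
    refine hn ?_
    rw [h, Finsupp.some_optionElim]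

theorem continuous_homogenize : Continuous homogenize := by
  refine continuous_pi fun μ => ?_
  change Continuous fun f => coeff μ (homogenize f)
  simp only [coeff_homogenize]
  split_ifs
  · exact WithPiTopology.continuous_coeff ℝ _
  · exact continuous_const

/-- The solution of the string equation in the ring of series in `x, s`. -/
def fullSolution : FullSeries := X none * homogenize unitSolution

/-- The same homogeneity as for real x, with x now a variable and the rescaling realised as a
substitution. -/
theorem fullSolution_solves :
    SolvesStringEquation (X none) (fun k => X (some k)) fullSolution := by
  have h := ((unitSolution_solves.map homogenize continuous_homogenize).mul_left
    (X none : FullSeries))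
  have hC : ∀ r : ℝ, homogenize (C r) = C r := fun r => homogenize.commutes r
  have hX : ∀ k : ℕ+, homogenize (X k) = scaledCoupling k := fun k => by
    rw [homogenize, substAlgHom_X]
  have h1 : (fun k : ℕ+ => C ((k : ℝ) * ((2 * (k : ℕ)).choose k : ℝ)) * X (some k) *
      fullSolution ^ (k : ℕ)) = fun k : ℕ+ => X none * homogenize
        (C ((k : ℝ) * ((2 * (k : ℕ)).choose k : ℝ)) * X k * unitSolution ^ (k : ℕ)) := by
    funext k
    have hk : (X none : FullSeries) ^ (k : ℕ) = X none * X none ^ ((k : ℕ) - 1) := by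
      rw [← pow_succ', Nat.sub_add_cancel k.pos]
    generalize (k : ℝ) * ((2 * (k : ℕ)).choose k : ℝ) = r
    rw [map_mul, map_mul, map_pow, hC, hX, fullSolution, mul_pow, hk, scaledCoupling]
    ring
  have h2 : fullSolution - X none = X none * homogenize (unitSolution - C 1) := by
    rw [map_sub, mul_sub, fullSolution, hC, map_one, mul_one]
  unfold SolvesStringEquation
  rw [h1, h2]
  exact h

theorem solvesStringEquation_full_iff (V : FullSeries) :
    SolvesStringEquation (X none) (fun k => X (some k)) V ↔ V = fullSolution := by
  obtain ⟨U, -, hU⟩ := existsUnique_solvesStringEquation (Option.some_injective ℕ+)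
    (X none : FullSeries)
  refine ⟨fun h => (hU V h).trans (hU _ fullSolution_solves).symm, ?_⟩
  rintro rfl
  exact fullSolution_solves

/-- For each multi-index in s only a single power of x occurs, so convergence at real x is the
convergence of a one-term series. -/
theorem fullCoeff_fullSolution (m : ℕ) (n : ℕ+ →₀ ℕ) :
    fullCoeff m n fullSolution = if m = 1 + excess n then coeff n unitSolution else 0 := by
  rw [fullCoeff, fullSolution, coeff_X_mul_eq, coeff_homogenize]
  have h1 : Finsupp.single none 1 ≤ n.optionElim m ↔ 1 ≤ m := by
    rw [Finsupp.single_le_iff, Finsupp.optionElim_apply_none]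
  have h2 : (n.optionElim m - Finsupp.single none 1).some = n := by
    ext j
    simp [Finsupp.optionElim_apply_eq_elim]
  rw [h2, Finsupp.tsub_apply, Finsupp.optionElim_apply_none, Finsupp.single_eq_same]
  simp only [h1]
  split_ifs <;> first | rfl | (exfalso; lia)

theorem fullCoeff_fullSolution_zero (m : ℕ) :
    fullCoeff m 0 fullSolution = if m = 1 then 1 else 0 := by
  rw [fullCoeff_fullSolution, map_zero, coeff_zero_eq_constantCoeff,
    constantCoeff_unitSolution, add_zero]

theorem hasSum_fullCoeff_fullSolution (x : ℝ) (n : ℕ+ →₀ ℕ) :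
    HasSum (fun m : ℕ => fullCoeff m n fullSolution * x ^ m) (coeff n (solution x)) := by
  rw [coeff_solution]
  convert hasSum_single (1 + excess n) (f := fun m => fullCoeff m n fullSolution * x ^ m) ?_ using 1
  · rw [fullCoeff_fullSolution, if_pos rfl, mul_comm]
  · intro m hm
    rw [fullCoeff_fullSolution, if_neg hm, zero_mul]

end GUE

/-! ### Convergence of double sums over the couplings -/

namespace MvPowerSeries

theorem summable_X_mul_X_mul {σ ι : Type*} {e : ι → σ} (he : Function.Injective e)
    (a : ι × ι → MvPowerSeries σ ℝ) : Summable fun p : ι × ι => X (e p.1) * X (e p.2) * a p := by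
  rw [WithPiTopology.summable_iff_summable_coeff]
  intro n
  have hfin := (n.support.finite_toSet).preimage (he.injOn (s := e ⁻¹' n.support))
  refine summable_of_hasFiniteSupport ((hfin.prod hfin).subset ?_)
  have hzero : ∀ (i : ι) (f : MvPowerSeries σ ℝ), e i ∉ n.support → coeff n (X (e i) * f) = 0 := by
    intro i f hi
    rw [coeff_X_mul_eq, if_neg]
    intro h
    have := h (e i)
    rw [Finsupp.notMem_support_iff.mp hi] at this
    simp at this
  intro p hp
  rw [Set.mem_prod]
  constructor
  · by_contra hn
    refine hp ?_
    change coeff n (X (e p.1) * X (e p.2) * a p) = 0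
    rw [mul_assoc]
    exact hzero _ _ hn
  · by_contra hn
    refine hp ?_
    change coeff n (X (e p.1) * X (e p.2) * a p) = 0
    rw [mul_comm (X (e p.1)), mul_assoc]
    exact hzero _ _ hn

end MvPowerSeries

/-! ### The explicit formula for a solution of the string equation -/

namespace GUE

open MvPowerSeries

/-- The weight `∑ (j - 1) n_j` with real values. -/
def excessWeight : (ℕ+ →₀ ℕ) →+ ℝ := (Nat.castAddMonoidHom ℝ).comp excess

theorem excessWeight_apply (n : ℕ+ →₀ ℕ) : excessWeight n = (excess n : ℝ) := rfl

theorem summable_sBar_mul (a : ℕ+ → CouplingSeries) : Summable fun k => sBar k * a k := by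
  refine (summable_X_mul (e := id) Function.injective_id
    fun k : ℕ+ => C ((2 * (k : ℕ)).choose k : ℝ) * a k).congr fun k => ?_
  rw [sBar, id]
  ring

theorem summable_sBar_mul_sBar_mul (a : ℕ+ × ℕ+ → CouplingSeries) :
    Summable fun p : ℕ+ × ℕ+ => sBar p.1 * sBar p.2 * a p := by
  refine (summable_X_mul_X_mul (e := id) Function.injective_id
    fun p : ℕ+ × ℕ+ => C ((2 * (p.1 : ℕ)).choose p.1 : ℝ) *
      C ((2 * (p.2 : ℕ)).choose p.2 : ℝ) * a p).congr fun p => ?_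
  rw [sBar, sBar, id, id]
  ring

theorem excessDerivation_sBar (k : ℕ+) :
    weightDerivation excessWeight (sBar k) = ((k : ℕ) - 1 : CouplingSeries) * sBar k := by
  have h : ((excessWeight (Finsupp.single k 1) : ℝ)) = (k : ℕ) - 1 := by
    rw [excessWeight_apply, excess_single, one_mul, Nat.cast_sub k.pos, Nat.cast_one]
  rw [sBar, Derivation.leibniz, weightDerivation_C, weightDerivation_X, h, smul_zero, add_zero,
    map_sub, map_one, smul_eq_mul]
  simp only [map_natCast]
  ring

/-- The terms of the single sum in the formula for the free energy, with `V` in place of `w`. -/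
def linearTerm (x : ℝ) (V : CouplingSeries) (k : ℕ+) : CouplingSeries :=
  sBar k * (C x * V ^ (k : ℕ) - C ((k : ℝ) / ((k : ℝ) + 1)) * V ^ ((k : ℕ) + 1))

/-- The terms of the double sum in the formula for the free energy, with `V` in place of `w`. -/
def quadraticTerm (V : CouplingSeries) (p : ℕ+ × ℕ+) : CouplingSeries :=
  C ((p.1 : ℝ) * (p.2 : ℝ) / ((p.1 : ℝ) + (p.2 : ℝ))) * sBar p.1 * sBar p.2
    * V ^ ((p.1 : ℕ) + (p.2 : ℕ))

theorem summable_linearTerm (x : ℝ) (V : CouplingSeries) : Summable (linearTerm x V) :=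
  summable_sBar_mul _

theorem summable_quadraticTerm (V : CouplingSeries) : Summable (quadraticTerm V) := by
  refine (summable_sBar_mul_sBar_mul fun p : ℕ+ × ℕ+ =>
    C ((p.1 : ℝ) * (p.2 : ℝ) / ((p.1 : ℝ) + (p.2 : ℝ))) *
      V ^ ((p.1 : ℕ) + (p.2 : ℕ))).congr fun p => ?_
  rw [quadraticTerm]
  ring

/-- The right hand side of the formula for the free energy, with `V` in place of `w`. -/
def closedForm (x : ℝ) (V : CouplingSeries) : CouplingSeries :=
  C (1 / 4) * V ^ 2 - C x * V + ∑' k : ℕ+, linearTerm x V k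
    + C (1 / 2) * ∑' p : ℕ+ × ℕ+, quadraticTerm V p + C (x ^ 2 / 2) * logSeries V

/-! ### The Euler identity for the closed form of the free energy -/

section

variable {x : ℝ} {V : CouplingSeries}

theorem hasSum_string (hV : SolvesStringEquation (C x) X V) :
    HasSum (fun k : ℕ+ => ((k : ℕ) : CouplingSeries) * (sBar k * V ^ (k : ℕ))) (V - C x) := by
  refine HasSum.congr_fun hV fun k => ?_
  rw [sBar, map_mul]
  simp only [map_natCast]
  ring

theorem pow_pred_eq (hV : V * V⁻¹ = 1) (k : ℕ+) : V ^ ((k : ℕ) - 1) = V⁻¹ * V ^ (k : ℕ) := by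
  have hk : V ^ (k : ℕ) = V * V ^ ((k : ℕ) - 1) := by
    rw [← pow_succ', Nat.sub_add_cancel k.pos]
  rw [hk]
  linear_combination (-V ^ ((k : ℕ) - 1)) * hV

/-- In this logarithmic form the factor V⁻¹ D V does not depend on k and can be pulled out of sums,
leaving ∑ k s̄_k V^k, which the string equation evaluates. -/
theorem excessDerivation_pow (hV : V * V⁻¹ = 1) (k : ℕ+) :
    weightDerivation excessWeight (V ^ (k : ℕ)) =
      ((k : ℕ) : CouplingSeries) * V ^ (k : ℕ) * (V⁻¹ * weightDerivation excessWeight V) := by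
  rw [Derivation.leibniz_pow, pow_pred_eq hV, nsmul_eq_mul, smul_eq_mul]
  ring

/-- Termwise, D(s̄_k V^k) = (k - 1) s̄_k V^k + k s̄_k V^k · V⁻¹ D V, and ∑ k s̄_k V^k = V - x. -/
theorem excessDerivation_tsum_sBar_mul_pow (hV : V * V⁻¹ = 1)
    (hs : SolvesStringEquation (C x) X V) :
    weightDerivation excessWeight (∑' k : ℕ+, sBar k * V ^ (k : ℕ)) =
      (V - C x) - ∑' k : ℕ+, sBar k * V ^ (k : ℕ)
        + V⁻¹ * weightDerivation excessWeight V * (V - C x) := by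
  have hT := (summable_sBar_mul fun k : ℕ+ => V ^ (k : ℕ)).hasSum
  refine (hasSum_weightDerivation excessWeight hT).unique ?_
  refine HasSum.congr_fun (((hasSum_string hs).sub hT).add
    ((hasSum_string hs).mul_left (V⁻¹ * weightDerivation excessWeight V))) fun k => ?_
  rw [Derivation.leibniz, excessDerivation_pow hV, excessDerivation_sBar, smul_eq_mul, smul_eq_mul]
  ring

theorem excessDerivation_tsum_linearTerm (hV : V * V⁻¹ = 1)
    (hs : SolvesStringEquation (C x) X V) :
    weightDerivation excessWeight (∑' k : ℕ+, linearTerm x V k) =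
      C x * (V - C x) + C x * (∑' k : ℕ+, sBar k * V ^ (k : ℕ)) - V * (V - C x)
        + (C x * V⁻¹ - 1) * weightDerivation excessWeight V * (V - C x)
        - 2 * ∑' k : ℕ+, linearTerm x V k := by
  have hT := (summable_sBar_mul fun k : ℕ+ => V ^ (k : ℕ)).hasSum
  have hS := hasSum_string hs
  have hA := (summable_linearTerm x V).hasSum
  refine (hasSum_weightDerivation excessWeight hA).unique ?_
  refine HasSum.congr_fun (((((hS.mul_left (C x)).add (hT.mul_left (C x))).sub
    (hS.mul_left V)).add (hS.mul_left ((C x * V⁻¹ - 1) * weightDerivation excessWeight V))).sub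
    (hA.mul_left 2)) fun k => ?_
  -- After adding twice the term itself, the weight of s̄_k becomes k + 1, which cancels the
  -- denominator of k/(k+1).
  have hc : (C ((k : ℝ) / ((k : ℝ) + 1)) : CouplingSeries) * (((k : ℕ) : CouplingSeries) + 1) =
      ((k : ℕ) : CouplingSeries) := by
    have h1 : (k : ℝ) / ((k : ℝ) + 1) * ((k : ℝ) + 1) = (k : ℝ) :=
      div_mul_cancel₀ _ (by positivity)
    have h2 := congrArg (C : ℝ →+* CouplingSeries) h1
    rwa [map_mul, map_add, map_natCast, map_one] at h2
  rw [linearTerm, Derivation.leibniz, map_sub, Derivation.leibniz, Derivation.leibniz,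
    weightDerivation_C, weightDerivation_C, pow_succ, Derivation.leibniz, excessDerivation_pow hV,
    excessDerivation_sBar]
  simp only [smul_eq_mul, mul_zero, add_zero]
  set D := weightDerivation excessWeight V
  set c : CouplingSeries := C ((k : ℝ) / ((k : ℝ) + 1))
  linear_combination (-sBar k * V ^ (k : ℕ) * V - sBar k * V ^ (k : ℕ) * D) * hc
    - (sBar k * c * V ^ (k : ℕ) * (k : ℕ) * D) * hV

/-- Adding 2 to the weight (k₁ - 1) + (k₂ - 1) gives k₁ + k₂, the denominator of the coefficient;
differentiating V^(k₁+k₂) produces the same factor. What remains is a product of two string sums. -/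
theorem excessDerivation_tsum_quadraticTerm (hV : V * V⁻¹ = 1)
    (hs : SolvesStringEquation (C x) X V) :
    weightDerivation excessWeight (∑' p : ℕ+ × ℕ+, quadraticTerm V p) =
      (1 + V⁻¹ * weightDerivation excessWeight V) * ((V - C x) * (V - C x))
        - 2 * ∑' p : ℕ+ × ℕ+, quadraticTerm V p := by
  have hS := hasSum_string hs
  have hB := (summable_quadraticTerm V).hasSum
  have hSS := hS.mul hS (by
    refine (summable_sBar_mul_sBar_mul fun p : ℕ+ × ℕ+ =>
      ((p.1 : ℕ) : CouplingSeries) * ((p.2 : ℕ) : CouplingSeries) * V ^ (p.1 : ℕ) *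
        V ^ (p.2 : ℕ)).congr fun p => ?_
    ring)
  refine (hasSum_weightDerivation excessWeight hB).unique ?_
  refine HasSum.congr_fun ((hSS.mul_left (1 + V⁻¹ * weightDerivation excessWeight V)).sub
    (hB.mul_left 2)) fun p => ?_
  have hc : (C ((p.1 : ℝ) * (p.2 : ℝ) / ((p.1 : ℝ) + (p.2 : ℝ))) : CouplingSeries) *
      (((p.1 : ℕ) : CouplingSeries) + ((p.2 : ℕ) : CouplingSeries)) =
      ((p.1 : ℕ) : CouplingSeries) * ((p.2 : ℕ) : CouplingSeries) := by
    have h1 : (p.1 : ℝ) * (p.2 : ℝ) / ((p.1 : ℝ) + (p.2 : ℝ)) * ((p.1 : ℝ) + (p.2 : ℝ)) =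
      (p.1 : ℝ) * (p.2 : ℝ) := div_mul_cancel₀ _ (by positivity)
    have h2 := congrArg (C : ℝ →+* CouplingSeries) h1
    simpa only [map_mul, map_add, map_natCast] using h2
  rw [quadraticTerm, mul_assoc, mul_assoc, Derivation.leibniz, weightDerivation_C,
    Derivation.leibniz, Derivation.leibniz, pow_add, Derivation.leibniz, excessDerivation_pow hV,
    excessDerivation_pow hV, excessDerivation_sBar, excessDerivation_sBar]
  simp only [smul_eq_mul, mul_zero, add_zero]
  set D := weightDerivation excessWeight V
  linear_combination (sBar p.1 * sBar p.2 * V ^ (p.1 : ℕ) * V ^ (p.2 : ℕ) * (1 + V⁻¹ * D)) * hc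

/-- The Euler identity satisfied by the closed form of the free energy. -/
theorem excessDerivation_closedForm (hx : 0 < x) (hs : SolvesStringEquation (C x) X V)
    (h0 : constantCoeff V = x) :
    weightDerivation excessWeight
        (weightDerivation excessWeight (closedForm x V) + 2 * closedForm x V)
      + (weightDerivation excessWeight (closedForm x V) + 2 * closedForm x V)
      = C (x ^ 2) * logSeries V - C (3 / 2 * x ^ 2) := by
  have hV : V * V⁻¹ = 1 := MvPowerSeries.mul_inv_cancel V (by rw [h0]; exact hx.ne')
  set D := weightDerivation excessWeight with hD
  set T : CouplingSeries := ∑' k : ℕ+, sBar k * V ^ (k : ℕ) with hT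
  have hDT : D T = _ := excessDerivation_tsum_sBar_mul_pow hV hs
  have hDA : D _ = _ := excessDerivation_tsum_linearTerm hV hs
  have hDB : D _ = _ := excessDerivation_tsum_quadraticTerm hV hs
  have hDL' : D (logSeries V) * V = D V := weightDerivation_logSeries_mul excessWeight
    (by rw [h0]; exact hx.ne')
  have hDL : D (logSeries V) = V⁻¹ * D V := by
    linear_combination V⁻¹ * hDL' - D (logSeries V) * hV
  rw [← hD] at hDT hDA hDB
  have hDC : ∀ r, D (C r) = 0 := weightDerivation_C excessWeight
  have h2 : (2 : CouplingSeries) * C (1 / 2) = 1 := by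
    rw [← map_ofNat (C : ℝ →+* CouplingSeries) 2, ← map_mul]
    norm_num
  have h4 : (C (1 / 4) : CouplingSeries) = C (1 / 2) * C (1 / 2) := by
    rw [← map_mul]
    norm_num
  have hx2 : (C (x ^ 2 / 2) : CouplingSeries) = C (1 / 2) * C x ^ 2 := by
    rw [← map_pow, ← map_mul]
    congr 1
    ring
  have hx3 : (C (3 / 2 * x ^ 2) : CouplingSeries) = 3 * C (1 / 2) * C x ^ 2 := by
    rw [← map_pow, ← map_ofNat (C : ℝ →+* CouplingSeries) 3, ← map_mul, ← map_mul]
    congr 1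
    ring
  -- At a solution of the string equation the closed form is stationary in V, so all terms with `D
  -- V` cancel and only the explicit dependence on the couplings contributes.
  have hfirst : D (closedForm x V) + 2 * closedForm x V =
      -C (x ^ 2 / 2) - C x * V + C x * T + C (x ^ 2) * logSeries V := by
    rw [closedForm]
    simp only [map_add, map_sub, Derivation.leibniz, Derivation.leibniz_pow, hDC, hDA, hDB, hDL,
      smul_eq_mul, nsmul_eq_mul, mul_zero, add_zero]
    rw [h4, hx2, map_pow]
    push_cast
    set A : CouplingSeries := ∑' k : ℕ+, linearTerm x V k
    set B : CouplingSeries := ∑' p : ℕ+ × ℕ+, quadraticTerm V p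
    set b : CouplingSeries := C (1 / 2)
    set y : CouplingSeries := C x
    set L := logSeries V
    linear_combination (-(V * D V * y * V⁻¹) - V * y + b * V ^ 2 + V ^ 2 + b * V * D V + V * D V
      + D V * y ^ 2 * V⁻¹ + y ^ 2 + y ^ 2 * L) * h2 + b * V * D V * hV
  rw [hfirst]
  simp only [map_add, map_sub, map_neg, Derivation.leibniz, hDC, hDL, hDT, smul_eq_mul, mul_zero,
    add_zero]
  rw [hx2, hx3, map_pow]
  linear_combination C x * D V * hV + C x ^ 2 * h2

/-- On coefficients the operator (D+1)(D+2) is multiplication by a positive number, so the Euler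
identity determines the closed form completely. -/
theorem coeff_closedForm (hx : 0 < x) (hs : SolvesStringEquation (C x) X V)
    (h0 : constantCoeff V = x) (n : ℕ+ →₀ ℕ) :
    ((excess n : ℝ) + 1) * ((excess n : ℝ) + 2) * coeff n (closedForm x V) =
      x ^ 2 * coeff n (logSeries V) - coeff n (C (3 / 2 * x ^ 2)) := by
  have h := congrArg (coeff n) (excessDerivation_closedForm hx hs h0)
  have h2 : coeff n (2 * closedForm x V) = 2 * coeff n (closedForm x V) := by
    rw [← map_ofNat (C : ℝ →+* CouplingSeries) 2, coeff_C_mul]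
  rw [map_add, coeff_weightDerivation, map_add, coeff_weightDerivation, h2, map_sub, coeff_C_mul,
    excessWeight_apply] at h
  linear_combination h

end

end GUE

namespace GUE

/-! ### Growth of sums -/

/-- The Stolz-Cesàro theorem. -/
theorem tendsto_div_of_tendsto_sub_div {a b : ℕ → ℝ} {l : ℝ} (hb : StrictMono b)
    (hb' : Tendsto b atTop atTop)
    (h : Tendsto (fun n => (a (n + 1) - a n) / (b (n + 1) - b n)) atTop (𝓝 l)) :
    Tendsto (fun n => a n / b n) atTop (𝓝 l) := by
  have hpos : ∀ n, 0 < b (n + 1) - b n := fun n => sub_pos.mpr (hb (Nat.lt_succ_self n))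
  have hsmall : (fun n => (a (n + 1) - a n) - l * (b (n + 1) - b n)) =o[atTop]
      fun n => b (n + 1) - b n := by
    rw [Asymptotics.isLittleO_iff_tendsto fun n hn => absurd hn (hpos n).ne']
    have := h.sub_const l
    rw [sub_self] at this
    refine this.congr fun n => ?_
    rw [sub_div _ (l * _), mul_div_cancel_right₀ _ (hpos n).ne']
  have hsum : ∀ n, ∑ i ∈ Finset.range n, (b (i + 1) - b i) = b n - b 0 :=
    fun n => Finset.sum_range_sub b n
  have hlim := hsmall.sum_range (fun n => (hpos n).le) (by
    simp only [hsum]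
    exact tendsto_atTop_add_const_right _ _ hb')
  simp only [Finset.sum_sub_distrib, ← Finset.mul_sum, hsum, Finset.sum_range_sub a] at hlim
  have hbig : (fun n => b n - b 0) =O[atTop] b := by
    have h1 : (fun _ : ℕ => b 0) =o[atTop] b :=
      Asymptotics.isLittleO_const_left.mpr (Or.inr (tendsto_norm_atTop_atTop.comp hb'))
    exact (Asymptotics.isBigO_refl b atTop).sub h1.isBigO
  have h2 := (hlim.trans_isBigO hbig).tendsto_div_nhds_zero
  have h3 : Tendsto (fun n => (a 0 - l * b 0) / b n) atTop (𝓝 0) :=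
    tendsto_const_nhds.div_atTop hb'
  have h4 := (h2.add h3).add_const l
  rw [add_zero, zero_add] at h4
  refine h4.congr' ?_
  filter_upwards [hb'.eventually_gt_atTop 0] with n hn
  field_simp
  ring

theorem tendsto_pow_succ_sub_div (p : ℕ) :
    Tendsto (fun n : ℕ => (((n + 1 : ℕ) : ℝ) ^ (p + 1) - (n : ℝ) ^ (p + 1)) / (n : ℝ) ^ p) atTop
      (𝓝 ((p : ℝ) + 1)) := by
  have hinv : Tendsto (fun n : ℕ => 1 / (n : ℝ)) atTop (𝓝 0) := tendsto_one_div_atTop_nhds_zero_nat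
  induction p with
  | zero => simp
  | succ p ih =>
    -- Uses (n+1)^(p+2) - n^(p+2) = (n+1)((n+1)^(p+1) - n^(p+1)) + n^(p+1), divided by n^(p+1).
    have h := ((hinv.const_add 1).mul ih).add_const 1
    rw [add_zero, one_mul] at h
    push_cast
    refine h.congr' ?_
    filter_upwards [eventually_gt_atTop 0] with n hn
    have : (0 : ℝ) < n := by exact_mod_cast hn
    push_cast
    field_simp
    ring

theorem tendsto_sum_div_pow {u : ℕ → ℝ} {l : ℝ} (p : ℕ)
    (h : Tendsto (fun n : ℕ => u n / (n : ℝ) ^ p) atTop (𝓝 l)) :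
    Tendsto (fun n : ℕ => (∑ i ∈ Finset.range n, u i) / (n : ℝ) ^ (p + 1)) atTop
      (𝓝 (l / ((p : ℝ) + 1))) := by
  have hp : (p : ℝ) + 1 ≠ 0 := by positivity
  refine tendsto_div_of_tendsto_sub_div (b := fun n : ℕ => (n : ℝ) ^ (p + 1)) ?_ ?_ ?_
  · intro m n hmn
    have : (m : ℝ) < n := by exact_mod_cast hmn
    exact pow_lt_pow_left₀ this (Nat.cast_nonneg m) (Nat.succ_ne_zero p)
  · exact (tendsto_pow_atTop (Nat.succ_ne_zero p)).comp tendsto_natCast_atTop_atTop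
  · refine (h.div (tendsto_pow_succ_sub_div p) hp).congr' ?_
    filter_upwards [eventually_gt_atTop 0] with n hn
    have : (n : ℝ) ^ p ≠ 0 := pow_ne_zero _ (by exact_mod_cast hn.ne')
    rw [Finset.sum_range_succ_sub_sum, Pi.div_apply, div_div_div_cancel_right₀ this]

/-- Shifting the index by one does not change polynomial growth. -/
theorem tendsto_sum_log_factorial :
    Tendsto (fun N : ℕ => ((∑ n ∈ Finset.range N, Real.log (n ! : ℝ))
      - (N : ℝ) ^ 2 / 2 * Real.log N) / (N : ℝ) ^ 2) atTop (𝓝 (-3 / 4)) := by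
  refine tendsto_div_of_tendsto_sub_div (b := fun n : ℕ => (n : ℝ) ^ 2) ?_ ?_ ?_
  · intro m n hmn
    have : (m : ℝ) < n := by exact_mod_cast hmn
    exact pow_lt_pow_left₀ this (Nat.cast_nonneg m) two_ne_zero
  · exact (tendsto_pow_atTop two_ne_zero).comp tendsto_natCast_atTop_atTop
  have hcast : Tendsto (fun n : ℕ => (n : ℝ)) atTop atTop := tendsto_natCast_atTop_atTop
  have hlogdiv : Tendsto (fun n : ℕ => Real.log n / (n : ℝ)) atTop (𝓝 0) :=
    (Real.isLittleO_log_id_atTop.tendsto_div_nhds_zero).comp hcast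
  have hinv : Tendsto (fun n : ℕ => 1 / (n : ℝ)) atTop (𝓝 0) := tendsto_one_div_atTop_nhds_zero_nat
  have hst : Tendsto (fun n : ℕ => Real.log (Stirling.stirlingSeq n) * (1 / (n : ℝ))) atTop
      (𝓝 0) := by
    have h1 := (Stirling.tendsto_stirlingSeq_sqrt_pi.log
      (Real.sqrt_pos.mpr Real.pi_pos).ne').mul hinv
    rwa [mul_zero] at h1
  have hmul : Tendsto (fun n : ℕ => (n : ℝ) * Real.log (1 + 1 / (n : ℝ))) atTop (𝓝 1) :=
    (Real.tendsto_mul_log_one_add_div_atTop 1).comp hcast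
  have hlog1 : Tendsto (fun n : ℕ => Real.log (1 + 1 / (n : ℝ))) atTop (𝓝 0) := by
    have := (hinv.const_add 1).log (by norm_num)
    simpa using this
  have hratio : Tendsto (fun n : ℕ => 1 / (2 + 1 / (n : ℝ))) atTop (𝓝 (1 / 2)) := by
    have := (hinv.const_add 2).inv₀ (by norm_num)
    simpa using this
  -- The increment of the numerator over (n+1)² - n² = n(2 + 1/n). By Stirling, log n! contributes
  -- -1 after division by n once n log n has cancelled, and n log(1 + 1/n) / 2 contributes -1/2;
  -- halving gives -3/4.
  have hmain := (((((hst.add ((hinv.const_mul (Real.log 2 / 2)).add (hlogdiv.mul_const (1 / 2)))).sub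
    (tendsto_const_nhds (x := (1 : ℝ)))).sub (hmul.mul_const (1 / 2))).sub hlog1).sub
    (((hlog1.mul hinv).add hlogdiv).mul_const (1 / 2))).mul hratio
  have hval : ((0 + (Real.log 2 / 2 * 0 + 0 * (1 / 2)) - 1 - 1 * (1 / 2) - 0
      - (0 * 0 + 0) * (1 / 2)) * (1 / 2) : ℝ) = -3 / 4 := by
    norm_num
  rw [hval] at hmain
  refine hmain.congr' ?_
  filter_upwards [eventually_gt_atTop 0] with n hn
  have hpos : (0 : ℝ) < n := by exact_mod_cast hn
  have hfac : Real.log (n ! : ℝ) = Real.log (Stirling.stirlingSeq n)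
      + (Real.log 2 + Real.log n) / 2 + n * (Real.log n - 1) := by
    rw [Stirling.log_stirlingSeq_formula, Real.log_mul two_ne_zero hpos.ne',
      Real.log_div hpos.ne' (Real.exp_pos 1).ne', Real.log_exp]
    ring
  have hsucc : Real.log ((n + 1 : ℕ) : ℝ) = Real.log n + Real.log (1 + 1 / (n : ℝ)) := by
    rw [← Real.log_mul hpos.ne' (by positivity)]
    congr 1
    push_cast
    field_simp
  rw [Finset.sum_range_succ, hfac, hsucc]
  have h21 : ((n + 1 : ℕ) : ℝ) ^ 2 - (n : ℝ) ^ 2 = n * (2 + 1 / (n : ℝ)) := by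
    push_cast
    field_simp
    ring
  have hne : (2 + 1 / (n : ℝ)) ≠ 0 := by positivity
  rw [h21]
  push_cast
  generalize Real.log (1 + 1 / (n : ℝ)) = t
  generalize Real.log (Stirling.stirlingSeq n) = st
  field_simp
  ring

/-- The term -(N²/2) log N hidden in log(x/N) cancels the leading growth of ∑ log n!. What survives
is (x²/2) log x and the constant -3/4 of `tendsto_sum_log_factorial`. -/
theorem tendsto_gaussian_freeEnergy {x : ℝ} (hx : 0 < x) :
    Tendsto (fun N : ℕ => (x / N) ^ 2 * (-(N / 2 * Real.log (2 * Real.pi))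
      + (N : ℝ) ^ 2 / 2 * Real.log (x / N) + (∑ n ∈ Finset.range N, Real.log (n ! : ℝ))
      - 1 / 12 * Real.log (x / N))) atTop
      (𝓝 (x ^ 2 / 2 * Real.log x - 3 / 4 * x ^ 2)) := by
  have hcast : Tendsto (fun n : ℕ => (n : ℝ)) atTop atTop := tendsto_natCast_atTop_atTop
  have hlogdiv : Tendsto (fun n : ℕ => Real.log n / (n : ℝ)) atTop (𝓝 0) :=
    (Real.isLittleO_log_id_atTop.tendsto_div_nhds_zero).comp hcast
  have hinv : Tendsto (fun n : ℕ => 1 / (n : ℝ)) atTop (𝓝 0) := tendsto_one_div_atTop_nhds_zero_nat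
  have hmain := (((tendsto_sum_log_factorial.const_mul (x ^ 2)).add_const
    (x ^ 2 / 2 * Real.log x)).sub (hinv.const_mul (x ^ 2 * (Real.log (2 * Real.pi) / 2)))).sub
    ((((hinv.mul hinv).const_mul (Real.log x)).sub (hlogdiv.mul hinv)).const_mul (x ^ 2 / 12))
  have hval : x ^ 2 * (-3 / 4) + x ^ 2 / 2 * Real.log x - x ^ 2 * (Real.log (2 * Real.pi) / 2) * 0
      - x ^ 2 / 12 * (Real.log x * (0 * 0) - 0 * 0) =
      x ^ 2 / 2 * Real.log x - 3 / 4 * x ^ 2 := by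
    ring
  rw [hval] at hmain
  refine hmain.congr' ?_
  filter_upwards [eventually_gt_atTop 0] with n hn
  have hpos : (0 : ℝ) < n := by exact_mod_cast hn
  rw [Real.log_div hx.ne' hpos.ne']
  field_simp
  ring

end GUE

namespace GUE

/-! ### Loop equations -/

/-- The loop (Schwinger-Dyson) equations for the expectations of products of traces of powers of
a Gaussian random Hermitian matrix of size `N`; `F s` stands for the expectation of
`∏ b ∈ s, tr (M ^ b)`. -/
structure SatisfiesLoopEquations {K : Type*} [CommRing K] (N : K) (F : Multiset ℕ → K) : Prop where
  zero : F 0 = 1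
  cons_zero : ∀ s, F (0 ::ₘ s) = N * F s
  cons_succ : ∀ a s, F ((a + 1) ::ₘ s) =
    ∑ k ∈ Finset.range a, F (k ::ₘ (a - 1 - k) ::ₘ s)
      + (s.map fun b : ℕ => (b : K) * F ((a + b - 1) ::ₘ s.erase b)).sum

/-- Lexicographic induction on the sum and the cardinality of the multiset: `cons_succ` lowers the
sum in every term with nonzero coefficient, while `cons_zero` keeps it and lowers the cardinality.
-/
theorem SatisfiesLoopEquations.unique {K : Type*} [CommRing K] {N : K} {F G : Multiset ℕ → K}
    (hF : SatisfiesLoopEquations N F) (hG : SatisfiesLoopEquations N G) : F = G := by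
  have key : ∀ m c : ℕ, ∀ s : Multiset ℕ, s.sum = m → Multiset.card s = c → F s = G s := by
    intro m
    induction m using Nat.strong_induction_on with
    | _ m ihm =>
    intro c
    induction c with
    | zero =>
      intro s _ hc
      rw [Multiset.card_eq_zero.mp hc, hF.zero, hG.zero]
    | succ c ihc =>
      intro s hs hc
      obtain ⟨b, hb⟩ := Multiset.card_pos_iff_exists_mem.mp (by lia : 0 < Multiset.card s)
      obtain ⟨t, rfl⟩ := Multiset.exists_cons_of_mem hb
      rw [Multiset.sum_cons] at hs
      rw [Multiset.card_cons] at hc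
      rcases b with _ | a
      · rw [hF.cons_zero, hG.cons_zero, ihc t (by lia) (by lia)]
      · rw [hF.cons_succ, hG.cons_succ]
        congr 1
        · refine Finset.sum_congr rfl fun k hk => ?_
          rw [Finset.mem_range] at hk
          refine ihm _ ?_ _ _ rfl rfl
          simp only [Multiset.sum_cons]
          lia
        · congr 1
          refine Multiset.map_congr rfl fun b hb => ?_
          -- For b = 0 the truncated exponent need not decrease the sum, but the coefficient b
          -- vanishes.
          rcases b with _ | b
          · simp
          · congr 1
            refine ihm _ ?_ _ _ rfl rfl
            have := Multiset.sum_erase hb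
            rw [Multiset.sum_cons]
            lia
  funext s
  exact key _ _ s rfl rfl

/-! ### Derivations of products -/

theorem derivation_multiset_prod {R A : Type*} [CommRing R] [CommRing A] [Algebra R A]
    (D : Derivation R A A) (p : ℕ → A) (s : Multiset ℕ) :
    D (s.map p).prod = (s.map fun b => ((s.erase b).map p).prod * D (p b)).sum := by
  induction s using Multiset.induction_on with
  | empty => simp
  | cons a t ih =>
    rw [Multiset.map_cons, Multiset.prod_cons, Derivation.leibniz, ih, Multiset.map_cons,
      Multiset.sum_cons, Multiset.erase_cons_head, smul_eq_mul, smul_eq_mul, add_comm]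
    congr 1
    rw [← Multiset.sum_map_mul_left]
    congr 1
    refine Multiset.map_congr rfl fun b hb => ?_
    rw [Multiset.erase_cons_tail_of_mem hb, Multiset.map_cons, Multiset.prod_cons, mul_assoc]

theorem derivation_finset_prod_eq_mul_sum {R A ι : Type*} [CommRing R] [CommRing A] [Algebra R A]
    (D : Derivation R A A) (s : Finset ι) (f H : ι → A) (h : ∀ i ∈ s, D (f i) = f i * H i) :
    D (∏ i ∈ s, f i) = (∏ i ∈ s, f i) * ∑ i ∈ s, H i := by
  classical
  induction s using Finset.induction_on with
  | empty => simp
  | insert a s ha ih =>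
    rw [Finset.prod_insert ha, Finset.sum_insert ha, Derivation.leibniz,
      ih fun i hi => h i (Finset.mem_insert_of_mem hi), h a (Finset.mem_insert_self a s),
      smul_eq_mul, smul_eq_mul]
    ring

/-! ### Product functionals on polynomials -/

section ProductFunctional

variable {ι K : Type*} [CommRing K]

/-- The linear functional with `X ^ k ↦ μ k`. -/
def momentFunctional (μ : ℕ → K) : Polynomial K →ₗ[K] K :=
  (Polynomial.basisMonomials K).constr K μ

theorem momentFunctional_monomial (μ : ℕ → K) (k : ℕ) (r : K) :
    momentFunctional μ (Polynomial.monomial k r) = r * μ k := by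
  have h : Polynomial.monomial k r = r • Polynomial.basisMonomials K k := by
    rw [Polynomial.coe_basisMonomials, Polynomial.smul_monomial, smul_eq_mul, mul_one]
  rw [h, map_smul, momentFunctional, Module.Basis.constr_basis, smul_eq_mul]

theorem momentFunctional_apply (μ : ℕ → K) (f : Polynomial K) :
    momentFunctional μ f = ∑ k ∈ f.support, f.coeff k * μ k := by
  conv_lhs => rw [f.as_sum_support, map_sum]
  exact Finset.sum_congr rfl fun k _ => momentFunctional_monomial μ k _

variable [Fintype ι]

/-- The linear functional with `∏ X_i ^ m_i ↦ ∏ μ_i (m_i)`. -/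
def productFunctional (μ : ι → ℕ → K) : MvPolynomial ι K →ₗ[K] K :=
  (MvPolynomial.basisMonomials ι K).constr K fun m => ∏ i, μ i (m i)

theorem productFunctional_monomial (μ : ι → ℕ → K) (m : ι →₀ ℕ) (r : K) :
    productFunctional μ (MvPolynomial.monomial m r) = r * ∏ i, μ i (m i) := by
  have h : MvPolynomial.monomial m r = r • MvPolynomial.basisMonomials ι K m := by
    rw [MvPolynomial.coe_basisMonomials, MvPolynomial.smul_monomial, smul_eq_mul, mul_one]
  rw [h, map_smul, productFunctional, Module.Basis.constr_basis, smul_eq_mul]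

/-- Integration by parts for a product functional. -/
theorem productFunctional_pderiv (μ : ι → ℕ → K) (i : ι) (a : K)
    (h : ∀ k : ℕ, (k : K) * μ i (k - 1) = a * μ i (k + 1)) (p : MvPolynomial ι K) :
    productFunctional μ (MvPolynomial.pderiv i p) =
      a * productFunctional μ (MvPolynomial.X i * p) := by
  classical
  induction p using MvPolynomial.induction_on' with
  | add p q hp hq => rw [map_add, map_add, hp, hq, mul_add, map_add, mul_add]
  | monomial m r =>
    have hX : (MvPolynomial.X i * MvPolynomial.monomial m r : MvPolynomial ι K) =
        MvPolynomial.monomial (Finsupp.single i 1 + m) r := by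
      rw [MvPolynomial.X, MvPolynomial.monomial_mul, one_mul]
    rw [hX, MvPolynomial.pderiv_monomial, productFunctional_monomial, productFunctional_monomial,
      ← Finset.mul_prod_erase _ _ (Finset.mem_univ i), ← Finset.mul_prod_erase _ _
      (Finset.mem_univ i)]
    have h1 : ∏ j ∈ Finset.univ.erase i, μ j ((m - Finsupp.single i 1 : ι →₀ ℕ) j) =
        ∏ j ∈ Finset.univ.erase i, μ j (m j) :=
      Finset.prod_congr rfl fun j hj => by
        rw [Finsupp.tsub_apply, Finsupp.single_eq_of_ne (Finset.ne_of_mem_erase hj), tsub_zero]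
    have h2 : ∏ j ∈ Finset.univ.erase i, μ j ((Finsupp.single i 1 + m : ι →₀ ℕ) j) =
        ∏ j ∈ Finset.univ.erase i, μ j (m j) :=
      Finset.prod_congr rfl fun j hj => by
        rw [Finsupp.add_apply, Finsupp.single_eq_of_ne (Finset.ne_of_mem_erase hj), zero_add]
    rw [h1, h2, Finsupp.tsub_apply, Finsupp.add_apply, Finsupp.single_eq_same, add_comm 1 (m i)]
    linear_combination (r * ∏ j ∈ Finset.univ.erase i, μ j (m j)) * h (m i)

theorem productFunctional_prod (μ : ι → ℕ → K) (f : ι → Polynomial K) :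
    productFunctional μ (∏ i, Polynomial.aeval (MvPolynomial.X i) (f i)) =
      ∏ i, momentFunctional (μ i) (f i) := by
  classical
  simp only [momentFunctional_apply]
  have h : ∀ i, Polynomial.aeval (MvPolynomial.X i) (f i) =
      ∑ k ∈ (f i).support, MvPolynomial.monomial (Finsupp.single i k) ((f i).coeff k) := by
    intro i
    rw [Polynomial.aeval_def, Polynomial.eval₂_eq_sum, Polynomial.sum]
    refine Finset.sum_congr rfl fun k _ => ?_
    rw [MvPolynomial.X_pow_eq_monomial, MvPolynomial.algebraMap_eq, MvPolynomial.C_mul_monomial,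
      mul_one]
  simp only [h, Finset.prod_univ_sum, map_sum]
  refine Finset.sum_congr rfl fun x _ => ?_
  rw [← MvPolynomial.monomial_sum_prod, productFunctional_monomial, ← Finset.prod_mul_distrib]
  refine Finset.prod_congr rfl fun i _ => ?_
  rw [Finsupp.finsetSum_apply, Finset.sum_eq_single i, Finsupp.single_eq_same]
  · exact fun j _ hj => Finsupp.single_eq_of_ne hj.symm
  · exact fun hi => absurd (Finset.mem_univ i) hi

end ProductFunctional

end GUE

namespace GUE

/-! ### Loop equations for the eigenvalues -/

section Eigenvalues

open MvPolynomial

variable {N : ℕ} {K : Type*} [CommRing K]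

/-- The power sums of the eigenvalues. -/
def powerSum (N : ℕ) (K : Type*) [CommRing K] (b : ℕ) : MvPolynomial (Fin N) K := ∑ i, X i ^ b

/-- The Vandermonde determinant of the eigenvalues. -/
def vandermondeProduct (N : ℕ) (K : Type*) [CommRing K] : MvPolynomial (Fin N) K :=
  ∏ i, ∏ j ∈ Finset.Ioi i, (X j - X i)

/-- The vector field `∑ X_i ^ a ∂_i`. -/
def powerField (N : ℕ) (K : Type*) [CommRing K] (a : ℕ) :
    Derivation K (MvPolynomial (Fin N) K) (MvPolynomial (Fin N) K) :=
  ∑ i, (X i ^ a : MvPolynomial (Fin N) K) • pderiv i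

theorem powerField_apply (a : ℕ) (f : MvPolynomial (Fin N) K) :
    powerField N K a f = ∑ i, X i ^ a * pderiv i f := by
  have : ∀ s : Finset (Fin N), (∑ i ∈ s, (X i ^ a : MvPolynomial (Fin N) K) • pderiv i :
      Derivation K (MvPolynomial (Fin N) K) (MvPolynomial (Fin N) K)) f =
      ∑ i ∈ s, X i ^ a * pderiv i f := by
    intro s
    rw [← Derivation.coeFnAddMonoidHom_apply, map_sum, Finset.sum_apply]
    rfl
  exact this _

theorem powerField_X (a : ℕ) (j : Fin N) : powerField N K a (X j) = X j ^ a := by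
  rw [powerField_apply, Finset.sum_eq_single j]
  · rw [pderiv_X_self, mul_one]
  · intro i _ hi
    rw [pderiv_X_of_ne hi.symm, mul_zero]
  · exact fun h => absurd (Finset.mem_univ j) h

theorem powerField_powerSum (a b : ℕ) :
    powerField N K a (powerSum N K b) = (b : MvPolynomial (Fin N) K) * powerSum N K (a + b - 1) := by
  rw [powerSum, map_sum, powerSum, Finset.mul_sum]
  refine Finset.sum_congr rfl fun i _ => ?_
  rw [Derivation.leibniz_pow, powerField_X, nsmul_eq_mul, smul_eq_mul]
  rcases b with _ | b
  · simp
  · rw [← pow_add]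
    congr 2
    lia

/-- The field sends X_j - X_i to X_j^a - X_i^a, a multiple of X_j - X_i, so the logarithmic
derivative of the Vandermonde product is a polynomial. -/
theorem powerField_vandermondeProduct (a : ℕ) :
    powerField N K a (vandermondeProduct N K) = vandermondeProduct N K *
      ∑ i, ∑ j ∈ Finset.Ioi i, ∑ k ∈ Finset.range a, X j ^ k * X i ^ (a - 1 - k) := by
  refine derivation_finset_prod_eq_mul_sum _ _ _ _ fun i _ => ?_
  refine derivation_finset_prod_eq_mul_sum _ _ _ _ fun j _ => ?_
  rw [map_sub, powerField_X, powerField_X, mul_comm, geom_sum₂_mul]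

/-- Splitting the sum over pairs of eigenvalues: the diagonal is the divergence of the field ∑ X_i^a
∂_i, and the off-diagonal part is twice the logarithmic derivative of the Vandermonde product, hence
that of its square. -/
theorem sum_powerSum_mul_powerSum (a : ℕ) :
    ∑ k ∈ Finset.range a, powerSum N K k * powerSum N K (a - 1 - k) =
      (a : MvPolynomial (Fin N) K) * powerSum N K (a - 1)
        + 2 * ∑ i, ∑ j ∈ Finset.Ioi i, ∑ k ∈ Finset.range a, X j ^ k * X i ^ (a - 1 - k) := by
  set H : Fin N → Fin N → MvPolynomial (Fin N) K :=
    fun j i => ∑ k ∈ Finset.range a, X j ^ k * X i ^ (a - 1 - k) with hH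
  have hsymm : ∀ i j, H i j = H j i := by
    intro i j
    simp only [hH]
    rw [← Finset.sum_range_reflect]
    refine Finset.sum_congr rfl fun k hk => ?_
    rw [Finset.mem_range] at hk
    rw [mul_comm]
    congr 2
    lia
  have hdiag : ∀ i, H i i = (a : MvPolynomial (Fin N) K) * X i ^ (a - 1) := by
    intro i
    simp only [hH]
    rw [Finset.sum_congr rfl fun k hk => ?_, Finset.sum_const, Finset.card_range, nsmul_eq_mul]
    rw [Finset.mem_range] at hk
    rw [← pow_add]
    congr 1
    lia
  have hoff := Finset.sum_sum_Ioi_add_eq_sum_sum_off_diag H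
  have hall : ∑ k ∈ Finset.range a, powerSum N K k * powerSum N K (a - 1 - k) =
      ∑ i, ∑ j, H j i := by
    simp only [powerSum, Finset.sum_mul_sum, hH]
    rw [Finset.sum_comm' (s := Finset.range a) (t := fun _ => Finset.univ)
      (t' := Finset.univ) (s' := fun _ => Finset.range a) (by simp), Finset.sum_comm]
    simp only [Finset.sum_comm (s := Finset.range a)]
    rw [Finset.sum_comm]
  have hsplit : ∀ i, ∑ j, H j i = H i i + ∑ j ∈ {i}ᶜ, H j i := by
    intro i
    rw [Fintype.sum_eq_add_sum_compl i]
  rw [hall, Finset.sum_congr rfl fun i _ => hsplit i, Finset.sum_add_distrib, ← hoff]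
  simp only [hdiag, powerSum, Finset.mul_sum]
  congr 1
  refine Finset.sum_congr rfl fun i _ => Finset.sum_congr rfl fun j _ => ?_
  rw [hsymm i j, ← two_mul, hH, Finset.mul_sum]

theorem sum_pderiv_vandermondeProduct_sq (a : ℕ) (g : MvPolynomial (Fin N) K) :
    ∑ i, pderiv i (X i ^ a * (vandermondeProduct N K ^ 2 * g)) =
      vandermondeProduct N K ^ 2 *
        ((∑ k ∈ Finset.range a, powerSum N K k * powerSum N K (a - 1 - k)) * g
          + powerField N K a g) := by
  have h1 : ∀ i : Fin N, pderiv i (X i ^ a * (vandermondeProduct N K ^ 2 * g)) =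
      X i ^ a * pderiv i (vandermondeProduct N K ^ 2 * g)
        + (a : MvPolynomial (Fin N) K) * X i ^ (a - 1) * (vandermondeProduct N K ^ 2 * g) := by
    intro i
    rw [Derivation.leibniz, Derivation.leibniz_pow, pderiv_X_self, smul_eq_mul, smul_eq_mul,
      smul_eq_mul, nsmul_eq_mul]
    ring
  simp only [h1]
  rw [Finset.sum_add_distrib, ← powerField_apply, ← Finset.sum_mul, ← Finset.mul_sum,
    Derivation.leibniz, Derivation.leibniz_pow, powerField_vandermondeProduct,
    sum_powerSum_mul_powerSum, nsmul_eq_mul, smul_eq_mul, smul_eq_mul, smul_eq_mul]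
  rw [← powerSum]
  push_cast
  ring

/-- The expectation of a polynomial in the eigenvalues, before normalisation. -/
def eigenvalueFunctional (N : ℕ) (μ : ℕ → K) : MvPolynomial (Fin N) K →ₗ[K] K :=
  (productFunctional fun _ : Fin N => μ) ∘ₗ LinearMap.mulLeft K (vandermondeProduct N K ^ 2)

theorem eigenvalueFunctional_apply (μ : ℕ → K) (f : MvPolynomial (Fin N) K) :
    eigenvalueFunctional N μ f =
      productFunctional (fun _ : Fin N => μ) (vandermondeProduct N K ^ 2 * f) := rfl

/-- Gaussian integration by parts along ∑ X_i^a ∂_i: the weight yields the power sum of exponent a +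
1, and the divergence of the squared Vandermonde product yields the splitting terms. -/
theorem eigenvalueFunctional_powerSum_succ_mul {μ : ℕ → K}
    (hμ : ∀ k : ℕ, (k : K) * μ (k - 1) = μ (k + 1)) (a : ℕ) (g : MvPolynomial (Fin N) K) :
    eigenvalueFunctional N μ (powerSum N K (a + 1) * g) =
      eigenvalueFunctional N μ
        ((∑ k ∈ Finset.range a, powerSum N K k * powerSum N K (a - 1 - k)) * g
          + powerField N K a g) := by
  rw [eigenvalueFunctional_apply, eigenvalueFunctional_apply, ← sum_pderiv_vandermondeProduct_sq,
    map_sum]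
  have h : ∀ i : Fin N, productFunctional (fun _ : Fin N => μ)
      (pderiv i (X i ^ a * (vandermondeProduct N K ^ 2 * g))) =
      productFunctional (fun _ : Fin N => μ)
        (X i * (X i ^ a * (vandermondeProduct N K ^ 2 * g))) := by
    intro i
    rw [productFunctional_pderiv (fun _ => μ) i 1 (fun k => by rw [one_mul]; exact hμ k), one_mul]
  simp only [h]
  rw [← map_sum, powerSum, Finset.sum_mul, Finset.mul_sum]
  congr 1
  refine Finset.sum_congr rfl fun i _ => ?_
  ring

theorem satisfiesLoopEquations_eigenvalueFunctional {K : Type*} [Field K] {μ : ℕ → K}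
    (hμ : ∀ k : ℕ, (k : K) * μ (k - 1) = μ (k + 1)) (h1 : eigenvalueFunctional N μ 1 ≠ 0) :
    SatisfiesLoopEquations (N : K) fun s =>
      eigenvalueFunctional N μ (s.map (powerSum N K)).prod / eigenvalueFunctional N μ 1 where
  zero := by simp [h1]
  cons_zero s := by
    have : powerSum N K 0 = C (N : K) := by simp [powerSum]
    rw [Multiset.map_cons, Multiset.prod_cons, this, C_mul', map_smul, smul_eq_mul, mul_div_assoc]
  cons_succ a s := by
    rw [Multiset.map_cons, Multiset.prod_cons, eigenvalueFunctional_powerSum_succ_mul hμ, map_add,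
      add_div, Finset.sum_mul, map_sum, Finset.sum_div, derivation_multiset_prod, map_multiset_sum,
      Multiset.map_map]
    congr 1
    · refine Finset.sum_congr rfl fun k _ => ?_
      rw [Multiset.map_cons, Multiset.map_cons, Multiset.prod_cons, Multiset.prod_cons, mul_assoc]
    · rw [div_eq_mul_inv, ← Multiset.sum_map_mul_right]
      congr 1
      refine Multiset.map_congr rfl fun b _ => ?_
      have hb : ((b : ℕ) : MvPolynomial (Fin N) K) = C (b : K) := (map_natCast C b).symm
      rw [Function.comp_apply, powerField_powerSum, hb, mul_left_comm, C_mul', map_smul,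
        smul_eq_mul, Multiset.map_cons, Multiset.prod_cons, mul_comm (Multiset.prod _)]
      ring

end Eigenvalues

end GUE

namespace GUE

/-! ### Loop equations for the matrix entries -/

section MatrixEntries

open MvPolynomial

variable {N : ℕ}

/-- Polynomials in the real coordinates of a Hermitian matrix. -/
abbrev EntryPolynomial (N : ℕ) : Type := MvPolynomial (Fin N × Fin N) ℂ

/-- The generic Hermitian matrix. -/
def genericHermitian (N : ℕ) : Matrix (Fin N) (Fin N) (EntryPolynomial N) :=
  Matrix.of fun i j =>
    if i = j then X (i, i)
    else if i < j then X (i, j) + C Complex.I * X (j, i)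
    else X (j, i) - C Complex.I * X (i, j)

/-- The complex vector field `∂ / ∂ M_ji` in the real coordinates. -/
def entryDerivation (i j : Fin N) :
    Derivation ℂ (EntryPolynomial N) (EntryPolynomial N) :=
  if i = j then pderiv (i, i)
  else if i < j then (1 / 2 : ℂ) • (pderiv (i, j) + Complex.I • pderiv (j, i))
  else (1 / 2 : ℂ) • (pderiv (j, i) - Complex.I • pderiv (i, j))

/-- The factors 1/2 and ±i are those of Wirtinger derivatives, so M_ij and M_ji behave as
independent variables although both are built from the same two real coordinates. -/
theorem entryDerivation_genericHermitian (i j k l : Fin N) :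
    entryDerivation i j (genericHermitian N k l) = if k = j ∧ l = i then 1 else 0 := by
  have hI : (C Complex.I * C Complex.I : EntryPolynomial N) = -1 := by
    rw [← C_mul, Complex.I_mul_I, C_neg, C_1]
  have h2 : (C (1 / 2) * 2 : EntryPolynomial N) = 1 := by
    rw [← map_ofNat (C : ℂ →+* EntryPolynomial N) 2, ← C_mul]
    norm_num
  have hC : ∀ p q, pderiv p (C Complex.I * X q : EntryPolynomial N) =
      C Complex.I * pderiv p (X q) := fun p q => pderiv_C_mul
  simp only [genericHermitian, Matrix.of_apply, entryDerivation]
  split_ifs <;>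
    simp only [Derivation.smul_apply, Derivation.add_apply, Derivation.sub_apply, map_add,
      map_sub, hC, pderiv_X, Pi.single_apply, Prod.mk.injEq, smul_eq_C_mul]
  all_goals
    split_ifs <;> first
      | (exfalso; lia)
      | ring1
      | linear_combination h2 - C (1 / 2) * hI
      | linear_combination C (1 / 2) * hI

theorem entryDerivation_pow (i j a b : Fin N) (n : ℕ) :
    entryDerivation i j ((genericHermitian N ^ n) a b) =
      ∑ k ∈ Finset.range n,
        (genericHermitian N ^ k) a j * (genericHermitian N ^ (n - 1 - k)) i b := by
  induction n generalizing b with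
  | zero =>
    rw [pow_zero, Matrix.one_apply, Finset.range_zero, Finset.sum_empty]
    split_ifs
    · exact Derivation.map_one_eq_zero _
    · exact map_zero _
  | succ n ih =>
    rw [pow_succ, Matrix.mul_apply, map_sum, Finset.sum_range_succ, Nat.add_sub_cancel,
      Nat.sub_self, pow_zero]
    simp only [Derivation.leibniz, ih, entryDerivation_genericHermitian, smul_eq_mul]
    rw [Finset.sum_add_distrib, add_comm]
    congr 1
    · simp only [Finset.mul_sum]
      rw [Finset.sum_comm]
      refine Finset.sum_congr rfl fun k hk => ?_
      rw [Finset.mem_range] at hk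
      have : n - k = (n - 1 - k) + 1 := by lia
      rw [this, pow_succ, Matrix.mul_apply, Finset.mul_sum]
      refine Finset.sum_congr rfl fun c _ => ?_
      ring
    · rw [Finset.sum_eq_single j]
      · rw [Matrix.one_apply]
        simp [eq_comm]
      · intro c _ hc
        simp [hc]
      · exact fun h => absurd (Finset.mem_univ j) h

/-- The traces of the powers of the generic Hermitian matrix. -/
def genericTrace (N : ℕ) (b : ℕ) : EntryPolynomial N := (genericHermitian N ^ b).trace

theorem entryDerivation_genericTrace (i j : Fin N) (b : ℕ) :
    entryDerivation i j (genericTrace N b) =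
      (b : EntryPolynomial N) * (genericHermitian N ^ (b - 1)) i j := by
  rw [genericTrace, Matrix.trace, map_sum]
  simp only [Matrix.diag_apply, entryDerivation_pow]
  rw [Finset.sum_comm, Finset.sum_congr rfl fun k hk => ?_, Finset.sum_const, Finset.card_range,
    nsmul_eq_mul]
  rw [Finset.mem_range] at hk
  have : b - 1 = (b - 1 - k) + k := by lia
  conv_rhs => rw [this, pow_add, Matrix.mul_apply]
  refine Finset.sum_congr rfl fun c _ => ?_
  ring

/-- Differentiating inside M^a cuts the trace into two; differentiating another trace tr M^b merges
it with M^a into b tr M^(a+b-1). These are the two kinds of terms of the loop equation. -/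
theorem sum_entryDerivation (a : ℕ) (s : Multiset ℕ) :
    ∑ i, ∑ j, entryDerivation i j
        ((genericHermitian N ^ a) j i * (s.map (genericTrace N)).prod) =
      (∑ k ∈ Finset.range a, genericTrace N k * genericTrace N (a - 1 - k)) *
          (s.map (genericTrace N)).prod
        + (s.map fun b : ℕ => (b : EntryPolynomial N) *
            (genericTrace N (a + b - 1) * ((s.erase b).map (genericTrace N)).prod)).sum := by
  simp only [Derivation.leibniz, entryDerivation_pow, smul_eq_mul]
  simp only [Finset.sum_add_distrib]
  rw [add_comm]
  congr 1
  · simp only [← Finset.mul_sum]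
    rw [mul_comm]
    congr 1
    simp only [genericTrace, Matrix.trace, Matrix.diag_apply, Finset.sum_mul_sum]
    rw [Finset.sum_congr rfl fun i _ => Finset.sum_comm, Finset.sum_comm]
    refine Finset.sum_congr rfl fun k _ => ?_
    rw [Finset.sum_comm]
  · simp only [derivation_multiset_prod, entryDerivation_genericTrace, ← Multiset.sum_map_mul_left]
    have hswap : ∀ f : Fin N → Fin N → ℕ → EntryPolynomial N,
        ∑ i, ∑ j, (s.map (f i j)).sum = (s.map fun b => ∑ i, ∑ j, f i j b).sum := by
      intro f
      induction s using Multiset.induction_on with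
      | empty => simp
      | cons b t ih => simp only [Multiset.map_cons, Multiset.sum_cons, Finset.sum_add_distrib, ih]
    rw [hswap]
    congr 1
    refine Multiset.map_congr rfl fun b _ => ?_
    rcases b with _ | b
    · simp
    · have : a + (b + 1) - 1 = b + a := by lia
      rw [this, genericTrace, Matrix.trace, pow_add]
      simp only [Matrix.diag_apply, Matrix.mul_apply, Nat.add_sub_cancel, Finset.sum_mul,
        Finset.mul_sum]
      refine Finset.sum_congr rfl fun i _ => Finset.sum_congr rfl fun j _ => ?_
      ring

/-- The inverse variances of the coordinates of a Gaussian Hermitian matrix. -/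
def entryWeight (p : Fin N × Fin N) : ℝ := if p.1 = p.2 then 1 else 2

variable {μ : Fin N × Fin N → ℕ → ℂ}

/-- Off the diagonal the inverse variance 2 cancels the 1/2 in the Wirtinger derivative, so all
entries obey one integration by parts rule: M_ij acts as ∂/∂M_ji. -/
theorem productFunctional_genericHermitian_mul
    (hμ : ∀ p, ∀ k : ℕ, (k : ℂ) * μ p (k - 1) = (entryWeight p : ℂ) * μ p (k + 1))
    (i j : Fin N) (f : EntryPolynomial N) :
    productFunctional μ (genericHermitian N i j * f) =
      productFunctional μ (entryDerivation i j f) := by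
  have h := fun p => productFunctional_pderiv μ p _ (hμ p) f
  rcases lt_trichotomy i j with hij | rfl | hij
  · simp only [entryDerivation, genericHermitian, Matrix.of_apply, hij.ne, hij, if_true, if_false,
      Derivation.smul_apply, Derivation.add_apply, map_smul, map_add, h, add_mul, smul_mul_assoc,
      C_mul', smul_eq_mul, entryWeight, hij.ne']
    push_cast
    ring
  · simp [entryDerivation, genericHermitian, h, entryWeight]
  · simp only [entryDerivation, genericHermitian, Matrix.of_apply, hij.ne, not_lt_of_gt hij,
      if_false, Derivation.smul_apply, Derivation.sub_apply, map_smul, map_sub, h, sub_mul,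
      smul_mul_assoc, C_mul', smul_eq_mul, entryWeight, hij.ne']
    push_cast
    ring

theorem satisfiesLoopEquations_genericTrace
    (hμ : ∀ p, ∀ k : ℕ, (k : ℂ) * μ p (k - 1) = (entryWeight p : ℂ) * μ p (k + 1))
    (h1 : productFunctional μ 1 ≠ 0) :
    SatisfiesLoopEquations (N : ℂ) fun s =>
      productFunctional μ (s.map (genericTrace N)).prod / productFunctional μ 1 where
  zero := by simp [h1]
  cons_zero s := by
    have : genericTrace N 0 = C (N : ℂ) := by simp [genericTrace]
    rw [Multiset.map_cons, Multiset.prod_cons, this, C_mul', map_smul, smul_eq_mul, mul_div_assoc]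
  cons_succ a s := by
    have hsum : productFunctional μ (genericTrace N (a + 1) * (s.map (genericTrace N)).prod) =
        productFunctional μ (∑ i, ∑ j, entryDerivation i j
          ((genericHermitian N ^ a) j i * (s.map (genericTrace N)).prod)) := by
      simp only [map_sum, ← productFunctional_genericHermitian_mul hμ]
      simp only [← map_sum]
      rw [genericTrace, Matrix.trace, pow_succ']
      simp only [Matrix.diag_apply, Matrix.mul_apply, Finset.sum_mul, mul_assoc]
    rw [Multiset.map_cons, Multiset.prod_cons, hsum, sum_entryDerivation, map_add,
      add_div, Finset.sum_mul, map_sum, Finset.sum_div, map_multiset_sum, Multiset.map_map]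
    congr 1
    · refine Finset.sum_congr rfl fun k _ => ?_
      rw [Multiset.map_cons, Multiset.map_cons, Multiset.prod_cons, Multiset.prod_cons, mul_assoc]
    · rw [div_eq_mul_inv, ← Multiset.sum_map_mul_right]
      congr 1
      refine Multiset.map_congr rfl fun b _ => ?_
      have hb : ((b : ℕ) : EntryPolynomial N) = C (b : ℂ) := (map_natCast C b).symm
      rw [Function.comp_apply, hb, C_mul', map_smul, smul_eq_mul, Multiset.map_cons,
        Multiset.prod_cons, mul_assoc, div_eq_mul_inv]

end MatrixEntries

end GUE

namespace GUE

/-! ### Gaussian moments -/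

/-- The moments of the Gaussian weight `exp (-a y ^ 2 / 2)`. -/
def gaussianMoment (a : ℝ) (k : ℕ) : ℝ := ∫ y : ℝ, y ^ k * Real.exp (-(a * y ^ 2 / 2))

theorem integrable_pow_mul_gaussian {a : ℝ} (ha : 0 < a) (k : ℕ) :
    Integrable fun y : ℝ => y ^ k * Real.exp (-(a * y ^ 2 / 2)) := by
  have h := integrable_rpow_mul_exp_neg_mul_sq (half_pos ha) (s := (k : ℝ))
    (by linarith [(Nat.cast_nonneg k : (0 : ℝ) ≤ k)])
  refine h.congr (Eventually.of_forall fun y => ?_)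
  change y ^ (k : ℝ) * _ = _
  rw [Real.rpow_natCast]
  congr 2
  ring

theorem gaussianMoment_zero (a : ℝ) : gaussianMoment a 0 = √(2 * Real.pi / a) := by
  have h := integral_gaussian (a / 2)
  rw [gaussianMoment]
  convert h using 2
  · funext y
    rw [pow_zero, one_mul]
    congr 1
    ring
  · rw [div_div_eq_mul_div, mul_comm]

/-- Integration by parts of the derivative of y^k exp(-a y²/2). At k = 0 the left side vanishes and
the identity says that the first moment is zero. -/
theorem gaussianMoment_succ {a : ℝ} (ha : 0 < a) (k : ℕ) :
    (k : ℝ) * gaussianMoment a (k - 1) = a * gaussianMoment a (k + 1) := by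
  have hu : ∀ y : ℝ, HasDerivAt (fun y : ℝ => y ^ k) ((k : ℝ) * y ^ (k - 1)) y :=
    fun y => hasDerivAt_pow k y
  have hv : ∀ y : ℝ, HasDerivAt (fun y : ℝ => Real.exp (-(a * y ^ 2 / 2)))
      (-(a * y) * Real.exp (-(a * y ^ 2 / 2))) y := by
    intro y
    have h1 : HasDerivAt (fun y : ℝ => -(a * y ^ 2 / 2)) (-(a * y)) y := by
      have := (((hasDerivAt_pow 2 y).const_mul a).div_const 2).neg
      refine this.congr_deriv ?_
      push_cast
      ring
    have := h1.exp
    rwa [mul_comm] at this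
  have h1 : (fun y : ℝ => y ^ k * (-(a * y) * Real.exp (-(a * y ^ 2 / 2)))) =
      fun y => -a * (y ^ (k + 1) * Real.exp (-(a * y ^ 2 / 2))) := by
    funext y
    ring
  have h2 : (fun y : ℝ => (k : ℝ) * y ^ (k - 1) * Real.exp (-(a * y ^ 2 / 2))) =
      fun y => (k : ℝ) * (y ^ (k - 1) * Real.exp (-(a * y ^ 2 / 2))) := by
    funext y
    ring
  have h := integral_mul_deriv_eq_deriv_mul_of_integrable (fun y _ => hu y) (fun y _ => hv y)
    (by
      change Integrable fun y : ℝ => y ^ k * (-(a * y) * Real.exp (-(a * y ^ 2 / 2)))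
      rw [h1]
      exact (integrable_pow_mul_gaussian ha (k + 1)).const_mul _)
    (by
      change Integrable fun y : ℝ => (k : ℝ) * y ^ (k - 1) * Real.exp (-(a * y ^ 2 / 2))
      rw [h2]
      exact (integrable_pow_mul_gaussian ha (k - 1)).const_mul _)
    (integrable_pow_mul_gaussian ha k)
  rw [h1, h2, integral_const_mul, integral_const_mul] at h
  rw [gaussianMoment, gaussianMoment]
  linarith

/-! ### Gaussian integrals over Hermitian matrices -/

section HermitianIntegral

variable {N : ℕ}

theorem entryWeight_pos (p : Fin N × Fin N) : 0 < entryWeight p := by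
  rw [entryWeight]
  split_ifs <;> norm_num

/-- The unnormalised Gaussian density on Hermitian matrices. -/
def gaussianDensity (y : Fin N → Fin N → ℝ) : ℝ := Real.exp (-(tracePow y 2 / 2))

theorem tracePow_two (y : Fin N → Fin N → ℝ) :
    tracePow y 2 = ∑ i, ∑ j, entryWeight (i, j) * y i j ^ 2 := by
  have h1 : tracePow y 2 = ∑ i, ∑ j, if i = j then y i j ^ 2 else y i j ^ 2 + y j i ^ 2 := by
    rw [tracePow, pow_two, Matrix.trace, Complex.re_sum]
    refine Finset.sum_congr rfl fun i _ => ?_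
    rw [Matrix.diag_apply, Matrix.mul_apply, Complex.re_sum]
    refine Finset.sum_congr rfl fun j _ => ?_
    simp only [hermitianOf, Matrix.of_apply]
    rcases lt_trichotomy i j with h | rfl | h
    · simp [h.ne, h.ne', h, not_lt_of_gt h]
      ring
    · simp [pow_two]
    · simp [h.ne, h.ne', h, not_lt_of_gt h]
      ring
  have h2 : ∑ i, ∑ j, (if i = j then 0 else y j i ^ 2) =
      ∑ i, ∑ j, (if i = j then 0 else y i j ^ 2) := by
    rw [Finset.sum_comm]
    simp only [eq_comm]
  have h3 : ∀ i j, (if i = j then y i j ^ 2 else y i j ^ 2 + y j i ^ 2) =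
      y i j ^ 2 + if i = j then 0 else y j i ^ 2 := by
    intro i j
    split_ifs <;> ring
  have h4 : ∀ i j, entryWeight (i, j) * y i j ^ 2 =
      y i j ^ 2 + if i = j then 0 else y i j ^ 2 := by
    intro i j
    rw [entryWeight]
    split_ifs <;> ring
  rw [h1]
  simp only [h3, h4, Finset.sum_add_distrib]
  rw [h2]

theorem gaussianDensity_eq (y : Fin N → Fin N → ℝ) :
    gaussianDensity y = ∏ i, ∏ j, Real.exp (-(entryWeight (i, j) * y i j ^ 2 / 2)) := by
  rw [gaussianDensity, tracePow_two]
  simp only [← Real.exp_sum, Finset.sum_neg_distrib, Finset.sum_div]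

/-- The complex moments of the coordinates. -/
def entryMoment (p : Fin N × Fin N) (k : ℕ) : ℂ := (gaussianMoment (entryWeight p) k : ℂ)

theorem entryMoment_succ (p : Fin N × Fin N) (k : ℕ) :
    (k : ℂ) * entryMoment p (k - 1) = (entryWeight p : ℂ) * entryMoment p (k + 1) := by
  rw [entryMoment, entryMoment]
  exact_mod_cast gaussianMoment_succ (entryWeight_pos p) k

theorem integral_eval_mul_gaussianDensity (p : EntryPolynomial N) :
    Integrable (fun y : Fin N → Fin N → ℝ =>
        MvPolynomial.eval (fun q => (y q.1 q.2 : ℂ)) p * (gaussianDensity y : ℂ)) ∧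
      ∫ y : Fin N → Fin N → ℝ,
        MvPolynomial.eval (fun q => (y q.1 q.2 : ℂ)) p * (gaussianDensity y : ℂ) =
      productFunctional entryMoment p := by
  induction p using MvPolynomial.induction_on' with
  | monomial m r =>
    set F : Fin N → Fin N → ℝ → ℂ := fun i j t =>
      ((t ^ m (i, j) * Real.exp (-(entryWeight (i, j) * t ^ 2 / 2)) : ℝ) : ℂ) with hF
    have hint : ∀ i j, Integrable (F i j) := fun i j =>
      (integrable_pow_mul_gaussian (entryWeight_pos (i, j)) (m (i, j))).ofReal
    have hfun : (fun y : Fin N → Fin N → ℝ =>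
        MvPolynomial.eval (fun q => (y q.1 q.2 : ℂ)) (MvPolynomial.monomial m r) *
          (gaussianDensity y : ℂ)) = fun y => r * ∏ i, ∏ j, F i j (y i j) := by
      funext y
      rw [MvPolynomial.eval_monomial, Finsupp.prod_fintype _ _ (fun _ => pow_zero _),
        Fintype.prod_prod_type, gaussianDensity_eq, mul_assoc]
      push_cast
      simp only [hF, ← Finset.prod_mul_distrib]
      push_cast
      rfl
    rw [hfun]
    refine ⟨(Integrable.fintype_prod_dep (f := fun i (z : Fin N → ℝ) => ∏ j, F i j (z j))
      fun i => Integrable.fintype_prod_dep (f := fun j t => F i j t) fun j => hint i j).const_mul r,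
      ?_⟩
    rw [integral_const_mul, productFunctional_monomial, Fintype.prod_prod_type,
      integral_fintype_prod_volume_eq_prod (fun i (z : Fin N → ℝ) => ∏ j, F i j (z j))]
    congr 1
    refine Finset.prod_congr rfl fun i _ => ?_
    rw [integral_fintype_prod_volume_eq_prod (fun j t => F i j t)]
    refine Finset.prod_congr rfl fun j _ => ?_
    exact integral_ofReal
  | add p q hp hq =>
    simp only [map_add, add_mul]
    exact ⟨hp.1.add hq.1, by rw [integral_add hp.1 hq.1, hp.2, hq.2]⟩

/-- Powers of a Hermitian matrix have real trace, so taking the real part in `tracePow` loses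
nothing. -/
theorem eval_genericTrace (y : Fin N → Fin N → ℝ) (b : ℕ) :
    MvPolynomial.eval (fun q => (y q.1 q.2 : ℂ)) (genericTrace N b) = (tracePow y b : ℂ) := by
  have hmap : (MvPolynomial.eval fun q : Fin N × Fin N => (y q.1 q.2 : ℂ)).mapMatrix
      (genericHermitian N) = hermitianOf y := by
    ext i j
    rw [RingHom.mapMatrix_apply, Matrix.map_apply, genericHermitian, hermitianOf, Matrix.of_apply,
      Matrix.of_apply]
    split_ifs with h1 h2
    · simp
    · simp [mul_comm]
    · simp [mul_comm]
  have hherm : (hermitianOf y).IsHermitian := by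
    ext i j
    rw [Matrix.conjTranspose_apply, hermitianOf, Matrix.of_apply, Matrix.of_apply]
    rcases lt_trichotomy i j with h | rfl | h
    · simp [h.ne, h.ne', h, not_lt_of_gt h]
    · simp
    · simp [h.ne, h.ne', h, not_lt_of_gt h, sub_eq_add_neg]
  have hreal : (starRingEnd ℂ) (hermitianOf y ^ b).trace = (hermitianOf y ^ b).trace := by
    have := Matrix.trace_conjTranspose (hermitianOf y ^ b)
    rw [(hherm.pow b).eq] at this
    exact this.symm
  rw [genericTrace, AddMonoidHom.map_trace, tracePow, Complex.conj_eq_iff_re.mp hreal, ← hmap,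
    ← map_pow]
  rfl

theorem integral_prod_tracePow (s : Multiset ℕ) :
    ((∫ y : Fin N → Fin N → ℝ, (s.map (tracePow y)).prod * gaussianDensity y : ℝ) : ℂ) =
      productFunctional entryMoment (s.map (genericTrace N)).prod := by
  rw [← (integral_eval_mul_gaussianDensity _).2]
  refine (integral_ofReal (𝕜 := ℂ)).symm.trans ?_
  congr 1
  funext y
  rw [map_multiset_prod, Multiset.map_map]
  simp only [Function.comp_def, eval_genericTrace]
  push_cast
  congr 1
  exact (map_multiset_prod Complex.ofRealHom _).trans (by rw [Multiset.map_map]; rfl)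

theorem integral_gaussianDensity :
    ∫ y : Fin N → Fin N → ℝ, gaussianDensity y =
      √(2 * Real.pi) ^ N * √Real.pi ^ (N * (N - 1)) := by
  simp only [gaussianDensity_eq]
  rw [integral_fintype_prod_volume_eq_prod (fun i (z : Fin N → ℝ) =>
    ∏ j, Real.exp (-(entryWeight (i, j) * z j ^ 2 / 2)))]
  have h : ∀ i : Fin N, ∫ z : Fin N → ℝ, ∏ j, Real.exp (-(entryWeight (i, j) * z j ^ 2 / 2)) =
      √(2 * Real.pi) * √Real.pi ^ (N - 1) := by
    intro i
    rw [integral_fintype_prod_volume_eq_prod (fun j t =>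
      Real.exp (-(entryWeight (i, j) * t ^ 2 / 2)))]
    have h0 : ∀ j, ∫ t : ℝ, Real.exp (-(entryWeight (i, j) * t ^ 2 / 2)) =
        √(2 * Real.pi / entryWeight (i, j)) := by
      intro j
      rw [← gaussianMoment_zero, gaussianMoment]
      simp
    simp only [h0]
    rw [← Finset.mul_prod_erase _ _ (Finset.mem_univ i), entryWeight, if_pos rfl, div_one]
    congr 1
    rw [Finset.prod_congr rfl fun j hj => ?_, Finset.prod_const, Finset.card_erase_of_mem
      (Finset.mem_univ i), Finset.card_univ, Fintype.card_fin]
    rw [entryWeight, if_neg (Finset.ne_of_mem_erase hj).symm, mul_div_cancel_left₀ _ two_ne_zero]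
  simp only [h]
  rw [Finset.prod_const, Finset.card_univ, Fintype.card_fin, mul_pow, ← pow_mul, mul_comm N]

theorem integral_gaussianDensity_pos : 0 < ∫ y : Fin N → Fin N → ℝ, gaussianDensity y := by
  rw [integral_gaussianDensity]
  have := Real.pi_pos
  positivity

/-- The expectations of products of traces satisfy the loop equations. -/
theorem satisfiesLoopEquations_tracePow (N : ℕ) :
    SatisfiesLoopEquations (N : ℝ) fun s =>
      (∫ y : Fin N → Fin N → ℝ, (s.map (tracePow y)).prod * gaussianDensity y) /
        ∫ y : Fin N → Fin N → ℝ, gaussianDensity y := by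
  have h1 : productFunctional entryMoment (1 : EntryPolynomial N) =
      ((∫ y : Fin N → Fin N → ℝ, gaussianDensity y : ℝ) : ℂ) := by
    have := integral_prod_tracePow (N := N) 0
    simp only [Multiset.map_zero, Multiset.prod_zero, one_mul] at this
    exact this.symm
  have hne : productFunctional entryMoment (1 : EntryPolynomial N) ≠ 0 := by
    rw [h1]
    exact_mod_cast integral_gaussianDensity_pos.ne'
  have h := satisfiesLoopEquations_genericTrace (N := N) entryMoment_succ hne
  simp only [← integral_prod_tracePow, h1] at h
  constructor
  · exact_mod_cast h.zero
  · intro s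
    exact_mod_cast h.cons_zero s
  · intro a s
    have := h.cons_succ a s
    have hmap : ∀ f : ℕ → ℝ, (s.map fun b => ((f b : ℝ) : ℂ)).sum = ((s.map f).sum : ℝ) := by
      intro f
      exact ((map_multiset_sum Complex.ofRealHom (s.map f)).trans
        (by rw [Multiset.map_map]; rfl)).symm
    simp only [← Complex.ofReal_div, ← Complex.ofReal_natCast, ← Complex.ofReal_mul, hmap,
      ← Complex.ofReal_sum, ← Complex.ofReal_add] at this
    exact Complex.ofReal_injective this

end HermitianIntegral

end GUE

namespace GUE

open MvPowerSeries

/-! ### Moments with couplings -/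

/-- The normalised moments of the standard Gaussian weight. -/
def standardMoment (k : ℕ) : ℝ := gaussianMoment 1 k / gaussianMoment 1 0

theorem standardMoment_zero : standardMoment 0 = 1 := by
  refine div_self ?_
  rw [gaussianMoment_zero, div_one]
  have := Real.pi_pos
  positivity

theorem standardMoment_succ (k : ℕ) :
    (k : ℝ) * standardMoment (k - 1) = standardMoment (k + 1) := by
  rw [standardMoment, standardMoment, ← mul_div_assoc, gaussianMoment_succ one_pos, one_mul]

theorem standardMoment_odd (k : ℕ) : standardMoment (2 * k + 1) = 0 := by
  induction k with
  | zero =>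
    rw [← standardMoment_succ]
    simp
  | succ k ih =>
    rw [← standardMoment_succ, mul_add, Nat.mul_one, Nat.add_succ_sub_one, ih, mul_zero]

/-- The additive weight `∑ j n_j` of a multi-index. -/
def totalWeight : (ℕ+ →₀ ℕ) →+ ℕ := Finsupp.weight fun j : ℕ+ => (j : ℕ)

/-- The product of the factorials of a multi-index, as a real number. -/
def factorialProd (n : ℕ+ →₀ ℕ) : ℝ := n.prod fun _ m => (m ! : ℝ)

theorem factorialProd_ne_zero (n : ℕ+ →₀ ℕ) : factorialProd n ≠ 0 :=
  Finset.prod_ne_zero_iff.mpr fun _ _ => by positivity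

theorem factorialProd_add_single (n : ℕ+ →₀ ℕ) (j : ℕ+) :
    factorialProd (n + Finsupp.single j 1) = factorialProd n * ((n j : ℝ) + 1) := by
  classical
  have h0 : ∀ i : ℕ+, ((0 ! : ℕ) : ℝ) = 1 := fun _ => by simp
  have h1 : (n + Finsupp.single j 1).support ⊆ insert j n.support := by
    intro i hi
    rw [Finset.mem_insert, Finsupp.mem_support_iff]
    by_contra hn
    push Not at hn
    rw [Finsupp.mem_support_iff, Finsupp.add_apply, hn.2, Finsupp.single_eq_of_ne hn.1] at hi
    exact hi rfl
  rw [factorialProd, factorialProd, Finsupp.prod_of_support_subset _ h1 _ fun i _ => h0 i,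
    Finsupp.prod_of_support_subset _ (Finset.subset_insert j n.support) _ fun i _ => h0 i,
    ← Finset.mul_prod_erase _ _ (Finset.mem_insert_self j _),
    ← Finset.mul_prod_erase (insert j n.support) (fun i => ((n i)! : ℝ))
      (Finset.mem_insert_self j _), Finsupp.add_apply, Finsupp.single_eq_same, Nat.factorial_succ]
  rw [Finset.prod_congr rfl fun i hi => by
    rw [Finsupp.add_apply, Finsupp.single_eq_of_ne (Finset.ne_of_mem_erase hi), add_zero]]
  push_cast
  ring

/-- The moments of the weight `exp (-y ^ 2 / 2 + ∑ s_j y ^ (2 j))`, as series in the couplings. -/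
def coupledMoment (k : ℕ) : CouplingSeries := fun n =>
  standardMoment (k + 2 * totalWeight n) / factorialProd n

theorem coeff_coupledMoment (k : ℕ) (n : ℕ+ →₀ ℕ) :
    coeff n (coupledMoment k) = standardMoment (k + 2 * totalWeight n) / factorialProd n := rfl

theorem constantCoeff_coupledMoment (k : ℕ) :
    constantCoeff (coupledMoment k) = standardMoment k := by
  rw [← coeff_zero_eq_constantCoeff, coeff_coupledMoment, map_zero, factorialProd,
    Finsupp.prod_zero_index, div_one, mul_zero, add_zero]

theorem coupledMoment_odd (k : ℕ) : coupledMoment (2 * k + 1) = 0 := by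
  ext n
  rw [coeff_coupledMoment, show 2 * k + 1 + 2 * totalWeight n = 2 * (k + totalWeight n) + 1 by ring,
    standardMoment_odd, zero_div, map_zero]

/-- Differentiating the formal weight in s_j inserts a factor y^(2j). -/
theorem pderiv_coupledMoment (j : ℕ+) (k : ℕ) :
    pderiv ℝ j (coupledMoment k) = coupledMoment (k + 2 * (j : ℕ)) := by
  ext n
  rw [coeff_pderiv, coeff_coupledMoment, coeff_coupledMoment, factorialProd_add_single, map_add,
    totalWeight, Finsupp.weight_single, smul_eq_mul, one_mul]
  have h1 := factorialProd_ne_zero n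
  have h2 : (n j : ℝ) + 1 ≠ 0 := by positivity
  rw [show k + 2 * ((Finsupp.weight fun j : ℕ+ => (j : ℕ)) n + (j : ℕ)) =
    k + 2 * (j : ℕ) + 2 * (Finsupp.weight fun j : ℕ+ => (j : ℕ)) n by ring]
  field_simp

theorem coeff_X_mul_coupledMoment (j : ℕ+) (k : ℕ) (n : ℕ+ →₀ ℕ) :
    coeff n (X j * coupledMoment (k + 2 * (j : ℕ) - 1)) =
      (n j : ℝ) * standardMoment (k + 2 * totalWeight n - 1) / factorialProd n := by
  rw [coeff_X_mul_eq]
  split_ifs with h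
  · obtain ⟨m, rfl⟩ := exists_add_of_le h
    have hj := j.pos
    rw [add_tsub_cancel_left, coeff_coupledMoment, add_comm (Finsupp.single j 1),
      factorialProd_add_single, map_add, totalWeight, Finsupp.weight_single, smul_eq_mul, one_mul,
      Finsupp.add_apply, Finsupp.single_eq_same]
    have h1 := factorialProd_ne_zero m
    have h2 : (m j : ℝ) + 1 ≠ 0 := by positivity
    rw [show k + 2 * ((Finsupp.weight fun j : ℕ+ => (j : ℕ)) m + (j : ℕ)) - 1 =
      k + 2 * (j : ℕ) - 1 + 2 * (Finsupp.weight fun j : ℕ+ => (j : ℕ)) m by lia]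
    push_cast
    field_simp
  · have : n j = 0 := by
      by_contra hn
      exact h (Finsupp.single_le_iff.mpr (Nat.one_le_iff_ne_zero.mpr hn))
    rw [this, Nat.cast_zero, zero_mul, zero_div]

/-- Integration by parts against exp(-y²/2 + ∑ s_j y^(2j)). On coefficients it is the Gaussian
recursion at exponent k + 2 ∑ j n_j, where the part 2j n_j of the prefactor belongs to the coupling
s_j. -/
theorem hasSum_coupledMoment (k : ℕ) :
    HasSum (fun j : ℕ+ => C (2 * (j : ℕ) : ℝ) * (X j * coupledMoment (k + 2 * (j : ℕ) - 1)))
      (coupledMoment (k + 1) - C (k : ℝ) * coupledMoment (k - 1)) := by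
  rw [WithPiTopology.hasSum_iff_hasSum_coeff]
  intro n
  simp only [coeff_C_mul, coeff_X_mul_coupledMoment]
  have h1 : coeff n (coupledMoment (k + 1) - C (k : ℝ) * coupledMoment (k - 1)) =
      ∑ j ∈ n.support, 2 * (j : ℕ) *
        ((n j : ℝ) * standardMoment (k + 2 * totalWeight n - 1) / factorialProd n) := by
    have hw : ∑ j ∈ n.support, (2 * (j : ℕ) : ℝ) * (n j : ℝ) = 2 * (totalWeight n : ℝ) := by
      rw [totalWeight, Finsupp.weight_apply, Finsupp.sum, Nat.cast_sum, Finset.mul_sum]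
      refine Finset.sum_congr rfl fun j _ => ?_
      rw [smul_eq_mul]
      push_cast
      ring
    have hrec := standardMoment_succ (k + 2 * totalWeight n)
    have hk : (k : ℝ) * standardMoment (k - 1 + 2 * totalWeight n) =
        k * standardMoment (k + 2 * totalWeight n - 1) := by
      rcases k with _ | k
      · simp
      · congr 2
        lia
    have hsum : ∑ j ∈ n.support, 2 * ((j : ℕ) : ℝ) *
        ((n j : ℝ) * standardMoment (k + 2 * totalWeight n - 1) / factorialProd n) =
        (2 * totalWeight n) * (standardMoment (k + 2 * totalWeight n - 1) / factorialProd n) := by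
      rw [← hw, Finset.sum_mul]
      refine Finset.sum_congr rfl fun j _ => ?_
      ring
    rw [hsum, map_sub, coeff_C_mul, coeff_coupledMoment, coeff_coupledMoment,
      show k + 1 + 2 * totalWeight n = k + 2 * totalWeight n + 1 by ring, ← hrec]
    push_cast
    linear_combination (-(factorialProd n)⁻¹) * hk
  rw [h1]
  refine hasSum_sum_of_ne_finset_zero fun j hj => ?_
  rw [Finsupp.notMem_support_iff.mp hj, Nat.cast_zero, zero_mul, zero_div, mul_zero]

/-- Integration of polynomials against the weight with couplings. -/
def coupledFunctional : Polynomial CouplingSeries →ₗ[CouplingSeries] CouplingSeries :=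
  momentFunctional coupledMoment

theorem hasSum_coupledFunctional (f : Polynomial CouplingSeries) :
    HasSum (fun j : ℕ+ => C (2 * (j : ℕ) : ℝ) *
        (X j * coupledFunctional (Polynomial.X ^ (2 * (j : ℕ) - 1) * f)))
      (coupledFunctional (Polynomial.X * f) - coupledFunctional (Polynomial.derivative f)) := by
  induction f using Polynomial.induction_on' with
  | add f g hf hg =>
    have := hf.add hg
    simp only [← mul_add, ← map_add] at this
    rwa [sub_add_sub_comm, ← map_add, ← map_add, ← mul_add, ← map_add] at this
  | monomial k a =>
    have h := (hasSum_coupledMoment k).mul_left a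
    have e1 : (fun j : ℕ+ => C (2 * (j : ℕ) : ℝ) * (X j * coupledFunctional
        (Polynomial.X ^ (2 * (j : ℕ) - 1) * Polynomial.monomial k a))) = fun j : ℕ+ =>
        a * (C (2 * (j : ℕ) : ℝ) * (X j * coupledMoment (k + 2 * (j : ℕ) - 1))) := by
      funext j
      have hj := j.pos
      rw [Polynomial.X_pow_mul_monomial, coupledFunctional, momentFunctional_monomial,
        show k + (2 * (j : ℕ) - 1) = k + 2 * (j : ℕ) - 1 by lia]
      ring
    have e2 : coupledFunctional (Polynomial.X * Polynomial.monomial k a) -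
        coupledFunctional (Polynomial.derivative (Polynomial.monomial k a)) =
        a * (coupledMoment (k + 1) - C (k : ℝ) * coupledMoment (k - 1)) := by
      rw [Polynomial.X_mul_monomial, Polynomial.derivative_monomial, coupledFunctional,
        momentFunctional_monomial, momentFunctional_monomial, map_natCast]
      ring
    rw [e1, e2]
    exact h

theorem coupledFunctional_eq_zero_of_odd {f : Polynomial CouplingSeries}
    (hf : f.comp (-Polynomial.X) = -f) : coupledFunctional f = 0 := by
  have h : ∀ g : Polynomial CouplingSeries,
      coupledFunctional (g.comp (-Polynomial.X)) = coupledFunctional g := by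
    intro g
    induction g using Polynomial.induction_on' with
    | add f g hf hg => rw [Polynomial.add_comp, map_add, map_add, hf, hg]
    | monomial k a =>
      have e : (Polynomial.monomial k a).comp (-Polynomial.X) =
          Polynomial.monomial k ((-1) ^ k * a) := by
        rw [Polynomial.monomial_comp, neg_pow (Polynomial.X : Polynomial CouplingSeries) k, ← Polynomial.C_mul_X_pow_eq_monomial, map_mul,
          map_pow, map_neg, map_one]
        ring
      rw [e, coupledFunctional, momentFunctional_monomial, momentFunctional_monomial]
      rcases Nat.even_or_odd' k with ⟨m, rfl | rfl⟩
      · rw [pow_mul, neg_one_sq, one_pow, one_mul]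
      · rw [coupledMoment_odd, mul_zero, mul_zero]
  have h1 := h f
  rw [hf, map_neg] at h1
  ext n
  have h2 := congrArg (coeff n) h1
  rw [map_neg] at h2
  rw [map_zero]
  linarith

/-! ### Orthogonal polynomials -/

/-- The monic orthogonal polynomials of the weight with couplings. -/
def orthoPoly : ℕ → Polynomial CouplingSeries
  | 0 => 1
  | 1 => Polynomial.X
  | n + 2 => Polynomial.X * orthoPoly (n + 1) -
      Polynomial.C (coupledFunctional (orthoPoly (n + 1) ^ 2) *
        (coupledFunctional (orthoPoly n ^ 2))⁻¹) * orthoPoly n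

/-- The squared norms of the orthogonal polynomials. -/
def orthoNorm (n : ℕ) : CouplingSeries := coupledFunctional (orthoPoly n ^ 2)

/-- The coefficient `R_(n + 1)` of the three term recurrence. -/
def recurrenceCoeff (n : ℕ) : CouplingSeries := orthoNorm (n + 1) * (orthoNorm n)⁻¹

theorem orthoPoly_zero : orthoPoly 0 = 1 := by rw [orthoPoly]

theorem orthoPoly_one : orthoPoly 1 = Polynomial.X := by rw [orthoPoly]

theorem X_mul_orthoPoly (n : ℕ) : Polynomial.X * orthoPoly (n + 1) =
    orthoPoly (n + 2) + Polynomial.C (recurrenceCoeff n) * orthoPoly n := by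
  rw [orthoPoly, recurrenceCoeff, orthoNorm, orthoNorm, sub_add_cancel]

theorem orthoPoly_comp_neg (n : ℕ) :
    (orthoPoly n).comp (-Polynomial.X) = (-1) ^ n * orthoPoly n := by
  induction n using Nat.twoStepInduction with
  | zero => simp [orthoPoly_zero]
  | one =>
    rw [orthoPoly_one, Polynomial.X_comp]
    ring
  | more n h1 h2 =>
    rw [orthoPoly, Polynomial.sub_comp, Polynomial.mul_comp, Polynomial.mul_comp, h1, h2,
      Polynomial.X_comp, Polynomial.C_comp]
    ring

theorem coeff_orthoPoly (n : ℕ) :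
    (orthoPoly n).coeff n = 1 ∧ ∀ m, n < m → (orthoPoly n).coeff m = 0 := by
  induction n using Nat.twoStepInduction with
  | zero =>
    rw [orthoPoly_zero]
    exact ⟨by simp, fun m hm => by rw [Polynomial.coeff_one, if_neg hm.ne']⟩
  | one =>
    rw [orthoPoly_one]
    exact ⟨by simp, fun m hm => by rw [Polynomial.coeff_X, if_neg hm.ne]⟩
  | more n h1 h2 =>
    rw [orthoPoly]
    constructor
    · rw [Polynomial.coeff_sub, Polynomial.coeff_X_mul, Polynomial.coeff_C_mul, h2.1,
        h1.2 _ (by lia), mul_zero, sub_zero]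
    · intro m hm
      obtain ⟨m, rfl⟩ : ∃ k, m = k + 1 := ⟨m - 1, by lia⟩
      rw [Polynomial.coeff_sub, Polynomial.coeff_X_mul, Polynomial.coeff_C_mul,
        h2.2 _ (by lia), h1.2 _ (by lia), mul_zero, sub_zero]

theorem natDegree_orthoPoly (n : ℕ) : (orthoPoly n).natDegree = n := by
  refine le_antisymm ?_ ?_
  · rw [Polynomial.natDegree_le_iff_coeff_eq_zero]
    exact (coeff_orthoPoly n).2
  · refine Polynomial.le_natDegree_of_ne_zero ?_
    rw [(coeff_orthoPoly n).1]
    exact one_ne_zero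

theorem monic_orthoPoly (n : ℕ) : (orthoPoly n).Monic := by
  rw [Polynomial.Monic, Polynomial.leadingCoeff, natDegree_orthoPoly, (coeff_orthoPoly n).1]

/-- The monic p_m with m < n span the polynomials of degree below n; leading terms are subtracted
one at a time. -/
theorem coupledFunctional_mul_eq_zero_of_degree_lt {g : Polynomial CouplingSeries} {n : ℕ}
    (hg : ∀ m < n, coupledFunctional (g * orthoPoly m) = 0) {f : Polynomial CouplingSeries}
    (hf : ∀ k, n ≤ k → f.coeff k = 0) : coupledFunctional (g * f) = 0 := by
  induction n generalizing f with
  | zero =>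
    have : f = 0 := Polynomial.ext fun k => hf k (Nat.zero_le k)
    rw [this, mul_zero, map_zero]
  | succ d ih =>
    have hd := coeff_orthoPoly d
    have h1 : coupledFunctional (g * (f - Polynomial.C (f.coeff d) * orthoPoly d)) = 0 := by
      refine ih (fun m hm => hg m (by lia)) fun k hk => ?_
      rw [Polynomial.coeff_sub, Polynomial.coeff_C_mul]
      rcases hk.eq_or_lt with rfl | hlt
      · rw [hd.1, mul_one, sub_self]
      · rw [hd.2 k hlt, hf k hlt, mul_zero, sub_zero]
    have h2 : g * f = g * (f - Polynomial.C (f.coeff d) * orthoPoly d) +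
        f.coeff d • (g * orthoPoly d) := by
      rw [Polynomial.smul_eq_C_mul]
      ring
    rw [h2, map_add, h1, map_smul, hg d (Nat.lt_succ_self d), smul_zero, zero_add]

theorem coupledFunctional_orthoPoly_succ_mul (n : ℕ) :
    coupledFunctional (orthoPoly (n + 1) * orthoPoly n) = 0 := by
  refine coupledFunctional_eq_zero_of_odd ?_
  rw [Polynomial.mul_comp, orthoPoly_comp_neg, orthoPoly_comp_neg, pow_succ]
  have hpow : ∀ a : Polynomial CouplingSeries, a * a = 1 → a ^ n * a ^ n = 1 := fun a ha => by
    rw [← mul_pow, ha, one_pow]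
  linear_combination (-(orthoPoly (n + 1) * orthoPoly n)) * hpow (-1) (by ring)

theorem coupledFunctional_X_mul_orthoPoly_succ_mul {n : ℕ}
    (h : ∀ m < n + 1, coupledFunctional (orthoPoly (n + 1) * orthoPoly m) = 0) :
    coupledFunctional (Polynomial.X * (orthoPoly (n + 1) * orthoPoly n)) = orthoNorm (n + 1) := by
  rcases n with _ | n
  · rw [orthoPoly_zero, mul_one, orthoNorm, orthoPoly_one, pow_two]
  · have e : Polynomial.X * (orthoPoly (n + 1 + 1) * orthoPoly (n + 1)) =
        orthoPoly (n + 1 + 1) ^ 2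
          + recurrenceCoeff n • (orthoPoly (n + 1 + 1) * orthoPoly n) := by
      rw [Polynomial.smul_eq_C_mul]
      linear_combination orthoPoly (n + 1 + 1) * X_mul_orthoPoly n
    rw [e, map_add, map_smul, h n (by lia), smul_zero, add_zero, orthoNorm]

/-- The derivative of p_(n+1) is (n+1) p_n plus lower degree, and that of p_n has degree below n +
1, so orthogonality leaves only the norm. -/
theorem coupledFunctional_derivative {n : ℕ}
    (h : ∀ m < n, coupledFunctional (orthoPoly n * orthoPoly m) = 0)
    (h' : ∀ m < n + 1, coupledFunctional (orthoPoly (n + 1) * orthoPoly m) = 0) :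
    coupledFunctional (Polynomial.derivative (orthoPoly (n + 1) * orthoPoly n)) =
      C ((n : ℝ) + 1) * orthoNorm n := by
  have hn := coeff_orthoPoly n
  have hn1 := coeff_orthoPoly (n + 1)
  have h1 : coupledFunctional (orthoPoly (n + 1) * Polynomial.derivative (orthoPoly n)) = 0 := by
    refine coupledFunctional_mul_eq_zero_of_degree_lt h' fun k hk => ?_
    rw [Polynomial.coeff_derivative, hn.2 _ (by lia), zero_mul]
  have h2 : coupledFunctional (orthoPoly n * (Polynomial.derivative (orthoPoly (n + 1)) -
      Polynomial.C ((n : CouplingSeries) + 1) * orthoPoly n)) = 0 := by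
    refine coupledFunctional_mul_eq_zero_of_degree_lt h fun k hk => ?_
    rw [Polynomial.coeff_sub, Polynomial.coeff_C_mul, Polynomial.coeff_derivative]
    rcases hk.eq_or_lt with rfl | hlt
    · rw [hn.1, hn1.1]
      ring
    · rw [hn.2 _ hlt, hn1.2 _ (by lia)]
      ring
  have e : Polynomial.derivative (orthoPoly (n + 1) * orthoPoly n) =
      orthoPoly (n + 1) * Polynomial.derivative (orthoPoly n) +
      (orthoPoly n * (Polynomial.derivative (orthoPoly (n + 1)) -
        Polynomial.C ((n : CouplingSeries) + 1) * orthoPoly n) +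
      ((n : CouplingSeries) + 1) • orthoPoly n ^ 2) := by
    rw [Polynomial.derivative_mul, Polynomial.smul_eq_C_mul]
    ring
  rw [e, map_add, map_add, h1, h2, zero_add, zero_add, map_smul, smul_eq_mul, orthoNorm, map_add,
    map_natCast, map_one]

theorem constantCoeff_eq_zero_of_hasSum_X_mul {f : ℕ+ → CouplingSeries} {a : CouplingSeries}
    (c : ℕ+ → ℝ) (h : HasSum (fun j => C (c j) * (X j * f j)) a) : constantCoeff a = 0 := by
  have h0 := WithPiTopology.hasSum_iff_hasSum_coeff.mp h 0
  simp only [coeff_C_mul, coeff_zero_X_mul, mul_zero] at h0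
  exact h0.unique hasSum_zero

/-- The two statements need a joint induction: orthogonality requires the inverted norms to have
nonzero constant term, and the constant term of the next norm is found from orthogonality. -/
theorem orthoPoly_aux (n : ℕ) :
    (∀ m < n, coupledFunctional (orthoPoly n * orthoPoly m) = 0) ∧
      constantCoeff (orthoNorm n) = (n ! : ℝ) := by
  induction n using Nat.strong_induction_on with
  | _ n ih =>
  have horth : ∀ m < n, coupledFunctional (orthoPoly n * orthoPoly m) = 0 := by
    match n, ih with
    | 0, _ => exact fun m hm => absurd hm (Nat.not_lt_zero m)
    | 1, _ =>
      intro m hm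
      obtain rfl : m = 0 := by lia
      exact coupledFunctional_orthoPoly_succ_mul 0
    | n + 2, ih =>
      intro m hm
      have hinv : orthoNorm n * (orthoNorm n)⁻¹ = 1 := by
        refine MvPowerSeries.mul_inv_cancel _ ?_
        rw [(ih n (by lia)).2]
        positivity
      have e : orthoPoly (n + 2) * orthoPoly m = orthoPoly (n + 1) * (Polynomial.X * orthoPoly m)
          - recurrenceCoeff n • (orthoPoly n * orthoPoly m) := by
        rw [Polynomial.smul_eq_C_mul]
        linear_combination (-orthoPoly m) * X_mul_orthoPoly n
      rw [e, map_sub, map_smul, smul_eq_mul]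
      have h1 := (ih (n + 1) (by lia)).1
      -- Below n both terms vanish by degree; at m = n the recurrence coefficient is chosen to
      -- cancel; at m = n + 1 parity applies.
      rcases Nat.lt_trichotomy m n with hlt | rfl | hgt
      · rw [(ih n (by lia)).1 m hlt, mul_zero, sub_zero]
        refine coupledFunctional_mul_eq_zero_of_degree_lt h1 fun k hk => ?_
        obtain ⟨k, rfl⟩ : ∃ l, k = l + 1 := ⟨k - 1, by lia⟩
        rw [Polynomial.coeff_X_mul, (coeff_orthoPoly m).2 k (by lia)]
      · rw [show orthoPoly (m + 1) * (Polynomial.X * orthoPoly m) =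
          Polynomial.X * (orthoPoly (m + 1) * orthoPoly m) by ring,
          coupledFunctional_X_mul_orthoPoly_succ_mul h1, ← pow_two, ← orthoNorm, recurrenceCoeff]
        linear_combination (-orthoNorm (m + 1)) * hinv
      · obtain rfl : m = n + 1 := by lia
        rw [show orthoPoly (n + 1) * (Polynomial.X * orthoPoly (n + 1)) =
          Polynomial.X * orthoPoly (n + 1) * orthoPoly (n + 1) by ring, X_mul_orthoPoly, add_mul,
          mul_assoc, ← Polynomial.smul_eq_C_mul, map_add, map_smul,
          coupledFunctional_orthoPoly_succ_mul, mul_comm (orthoPoly n),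
          coupledFunctional_orthoPoly_succ_mul]
        simp
  refine ⟨horth, ?_⟩
  rcases n with _ | n
  · rw [orthoNorm, orthoPoly_zero, one_pow, ← Polynomial.monomial_zero_one, coupledFunctional,
      momentFunctional_monomial, one_mul, constantCoeff_coupledMoment, standardMoment_zero]
    simp
  -- At s = 0 the coupling sum disappears, leaving h_(n+1) = (n+1) h_n.
  · have hF := hasSum_coupledFunctional (orthoPoly (n + 1) * orthoPoly n)
    have h0 := constantCoeff_eq_zero_of_hasSum_X_mul _ hF
    rw [coupledFunctional_X_mul_orthoPoly_succ_mul horth,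
      coupledFunctional_derivative (ih n (by lia)).1 horth, map_sub, map_mul, constantCoeff_C,
      (ih n (by lia)).2] at h0
    rw [Nat.factorial_succ]
    push_cast
    linarith

theorem coupledFunctional_orthoPoly_mul (n m : ℕ) :
    coupledFunctional (orthoPoly n * orthoPoly m) = if n = m then orthoNorm n else 0 := by
  split_ifs with h
  · rw [h, orthoNorm, pow_two]
  · rcases Nat.lt_or_gt_of_ne h with hlt | hgt
    · rw [mul_comm]
      exact (orthoPoly_aux m).1 n hlt
    · exact (orthoPoly_aux n).1 m hgt

theorem constantCoeff_orthoNorm (n : ℕ) : constantCoeff (orthoNorm n) = (n ! : ℝ) :=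
  (orthoPoly_aux n).2

theorem constantCoeff_orthoNorm_ne_zero (n : ℕ) : constantCoeff (orthoNorm n) ≠ 0 := by
  rw [constantCoeff_orthoNorm]
  positivity

theorem orthoNorm_mul_inv (n : ℕ) : orthoNorm n * (orthoNorm n)⁻¹ = 1 :=
  MvPowerSeries.mul_inv_cancel _ (constantCoeff_orthoNorm_ne_zero n)

theorem recurrenceCoeff_mul_orthoNorm (n : ℕ) :
    recurrenceCoeff n * orthoNorm n = orthoNorm (n + 1) := by
  rw [recurrenceCoeff]
  linear_combination orthoNorm (n + 1) * orthoNorm_mul_inv n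

/-- The matrix entries of multiplication by `X ^ l` in the basis of orthogonal polynomials. -/
def jacobiEntry (l n q : ℕ) : CouplingSeries :=
  coupledFunctional (Polynomial.X ^ l * (orthoPoly n * orthoPoly q)) * (orthoNorm q)⁻¹

theorem jacobiEntry_zero (n q : ℕ) : jacobiEntry 0 n q = if n = q then 1 else 0 := by
  rw [jacobiEntry, pow_zero, one_mul, coupledFunctional_orthoPoly_mul]
  split_ifs with h
  · rw [h, orthoNorm_mul_inv]
  · rw [zero_mul]

theorem jacobiEntry_succ (l n q : ℕ) : jacobiEntry (l + 1) n (q + 1) =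
    recurrenceCoeff (q + 1) * jacobiEntry l n (q + 2) + jacobiEntry l n q := by
  have e : Polynomial.X ^ (l + 1) * (orthoPoly n * orthoPoly (q + 1)) =
      Polynomial.X ^ l * (orthoPoly n * orthoPoly (q + 2)) +
        recurrenceCoeff q • (Polynomial.X ^ l * (orthoPoly n * orthoPoly q)) := by
    rw [Polynomial.smul_eq_C_mul]
    linear_combination (Polynomial.X ^ l * orthoPoly n) * X_mul_orthoPoly q
  have h0 := orthoNorm_mul_inv q
  have h1 := orthoNorm_mul_inv (q + 1)
  have h2 := orthoNorm_mul_inv (q + 2)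
  rw [jacobiEntry, jacobiEntry, jacobiEntry, e, map_add, map_smul, smul_eq_mul, recurrenceCoeff,
    recurrenceCoeff]
  set A := coupledFunctional (Polynomial.X ^ l * (orthoPoly n * orthoPoly (q + 2)))
  set B := coupledFunctional (Polynomial.X ^ l * (orthoPoly n * orthoPoly q))
  linear_combination B * (orthoNorm q)⁻¹ * h1 - A * (orthoNorm (q + 1))⁻¹ * h2

/-- The discrete string equation. -/
theorem hasSum_jacobiEntry (n : ℕ) :
    HasSum (fun j : ℕ+ => C (2 * (j : ℕ) : ℝ) * (X j * jacobiEntry (2 * (j : ℕ) - 1) (n + 1) n))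
      (recurrenceCoeff n - C ((n : ℝ) + 1)) := by
  have h := (hasSum_coupledFunctional (orthoPoly (n + 1) * orthoPoly n)).mul_right (orthoNorm n)⁻¹
  rw [coupledFunctional_X_mul_orthoPoly_succ_mul (orthoPoly_aux (n + 1)).1,
    coupledFunctional_derivative (orthoPoly_aux n).1 (orthoPoly_aux (n + 1)).1, sub_mul, mul_assoc,
    orthoNorm_mul_inv, mul_one, ← recurrenceCoeff] at h
  refine h.congr_fun fun j => ?_
  rw [jacobiEntry]
  ring

theorem constantCoeff_recurrenceCoeff (n : ℕ) :
    constantCoeff (recurrenceCoeff n) = (n : ℝ) + 1 := by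
  have h := constantCoeff_eq_zero_of_hasSum_X_mul _ (hasSum_jacobiEntry n)
  rw [map_sub, constantCoeff_C] at h
  linarith

/-! ### The partition function as a product of norms of orthogonal polynomials -/

theorem derivation_finset_prod {R A ι : Type*} [CommRing R] [CommRing A] [Algebra R A]
    [DecidableEq ι] (D : Derivation R A A) (s : Finset ι) (f : ι → A) :
    D (∏ i ∈ s, f i) = ∑ i ∈ s, D (f i) * ∏ j ∈ s.erase i, f j := by
  induction s using Finset.induction_on with
  | empty => simp
  | insert a s ha ih =>
    rw [Finset.prod_insert ha, Finset.sum_insert ha, Derivation.leibniz, ih,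
      Finset.erase_insert ha, smul_eq_mul, smul_eq_mul, add_comm, mul_comm, Finset.mul_sum]
    congr 1
    refine Finset.sum_congr rfl fun i hi => ?_
    have hne : a ≠ i := fun h => ha (h ▸ hi)
    rw [Finset.erase_insert_of_ne hne, Finset.prod_insert fun h => ha (Finset.mem_of_mem_erase h)]
    ring

section

variable {N : ℕ}

theorem pderiv_productFunctional_coupledMoment (j : ℕ+) (f : MvPolynomial (Fin N) ℝ) :
    pderiv ℝ j (productFunctional (fun _ : Fin N => coupledMoment) (f.map C)) =
      productFunctional (fun _ : Fin N => coupledMoment)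
        ((powerSum N ℝ (2 * (j : ℕ)) * f).map C) := by
  classical
  induction f using MvPolynomial.induction_on' with
  | add f g hf hg => rw [map_add, map_add, map_add, hf, hg, mul_add, map_add, map_add]
  | monomial m r =>
    rw [MvPolynomial.map_monomial, productFunctional_monomial, Derivation.leibniz, pderiv_C,
      smul_zero, add_zero, smul_eq_mul, derivation_finset_prod, powerSum, Finset.sum_mul, map_sum,
      map_sum, Finset.mul_sum]
    refine Finset.sum_congr rfl fun i hi => ?_
    rw [MvPolynomial.X_pow_eq_monomial, MvPolynomial.monomial_mul, one_mul,
      MvPolynomial.map_monomial, productFunctional_monomial, pderiv_coupledMoment,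
      ← Finset.mul_prod_erase _ _ hi, Finsupp.add_apply, Finsupp.single_eq_same,
      add_comm (2 * (j : ℕ))]
    congr 2
    refine Finset.prod_congr rfl fun l hl => ?_
    rw [Finsupp.add_apply, Finsupp.single_eq_of_ne (Finset.ne_of_mem_erase hl), zero_add]

/-- Taylor's formula in the couplings: each derivative in s_j inserts the power sum of exponent 2j.
-/
theorem coeff_productFunctional_coupledMoment (n : ℕ+ →₀ ℕ) (f : MvPolynomial (Fin N) ℝ) :
    coeff n (productFunctional (fun _ : Fin N => coupledMoment) (f.map C)) =
      productFunctional (fun _ : Fin N => standardMoment)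
        (f * n.prod fun j m => powerSum N ℝ (2 * (j : ℕ)) ^ m) / factorialProd n := by
  have key : ∀ d : ℕ, ∀ n : ℕ+ →₀ ℕ, n.degree = d → ∀ f : MvPolynomial (Fin N) ℝ,
      coeff n (productFunctional (fun _ : Fin N => coupledMoment) (f.map C)) =
        productFunctional (fun _ : Fin N => standardMoment)
          (f * n.prod fun j m => powerSum N ℝ (2 * (j : ℕ)) ^ m) / factorialProd n := by
    intro d
    induction d with
    | zero =>
      intro n hn f
      rw [(Finsupp.degree_eq_zero_iff n).mp hn, Finsupp.prod_zero_index, mul_one, factorialProd,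
        Finsupp.prod_zero_index, div_one, coeff_zero_eq_constantCoeff]
      induction f using MvPolynomial.induction_on' with
      | add f g hf hg => rw [map_add, map_add, map_add, hf, hg, map_add]
      | monomial m r =>
        rw [MvPolynomial.map_monomial, productFunctional_monomial, productFunctional_monomial,
          map_mul, constantCoeff_C, map_prod]
        simp only [constantCoeff_coupledMoment]
    | succ d ih =>
      intro n hn f
      obtain ⟨j, hj⟩ : ∃ j, n j ≠ 0 := by
        by_contra hall
        push Not at hall
        have : n = 0 := Finsupp.ext hall
        rw [this, map_zero] at hn
        lia
      obtain ⟨m, rfl⟩ := exists_add_of_le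
        (Finsupp.single_le_iff.mpr (Nat.one_le_iff_ne_zero.mpr hj))
      rw [map_add, Finsupp.degree_single] at hn
      have h1 := coeff_pderiv (i := j)
        (productFunctional (fun _ : Fin N => coupledMoment) (f.map C)) m
      rw [pderiv_productFunctional_coupledMoment, ih m (by lia)] at h1
      have h2 : (m j : ℝ) + 1 ≠ 0 := by positivity
      have h3 := factorialProd_ne_zero m
      rw [add_comm (Finsupp.single j 1), factorialProd_add_single,
        Finsupp.prod_add_index' (fun _ => pow_zero _) (fun _ _ _ => pow_add _ _ _),
        Finsupp.prod_single_index (h := fun (j : ℕ+) m => powerSum N ℝ (2 * (j : ℕ)) ^ m)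
          (pow_zero _), pow_one, eq_div_iff (mul_ne_zero h3 h2)]
      rw [div_eq_iff h3] at h1
      rw [show f * ((m.prod fun (j : ℕ+) m => powerSum N ℝ (2 * (j : ℕ)) ^ m) *
        powerSum N ℝ (2 * (j : ℕ))) = powerSum N ℝ (2 * (j : ℕ)) * f *
        (m.prod fun (j : ℕ+) m => powerSum N ℝ (2 * (j : ℕ)) ^ m) by ring, h1]
      ring
  exact key _ n rfl f

theorem vandermondeProduct_eq_sum {K : Type*} [CommRing K] (P : ℕ → Polynomial K)
    (hdeg : ∀ n, (P n).natDegree = n) (hmonic : ∀ n, (P n).Monic) :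
    vandermondeProduct N K = ∑ σ : Equiv.Perm (Fin N), ((Equiv.Perm.sign σ : ℤ) :
      MvPolynomial (Fin N) K) * ∏ i, Polynomial.aeval (MvPolynomial.X i) (P (σ i)) := by
  rcases subsingleton_or_nontrivial K with hK | hK
  · exact Subsingleton.elim _ _
  have h := Matrix.det_eval_matrixOfPolynomials_eq_det_vandermonde
    (fun i : Fin N => (MvPolynomial.X i : MvPolynomial (Fin N) K))
    (fun i => (P i).map MvPolynomial.C)
    (fun i => by rw [(hmonic i).natDegree_map, hdeg])
    (fun i => (hmonic i).map _)
  rw [Matrix.det_vandermonde, ← Matrix.det_transpose, Matrix.det_apply'] at h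
  rw [vandermondeProduct, h]
  refine Finset.sum_congr rfl fun σ _ => ?_
  congr 1
  refine Finset.prod_congr rfl fun i _ => ?_
  rw [Matrix.transpose_apply, Matrix.of_apply, Polynomial.eval_map, Polynomial.aeval_def,
    MvPolynomial.algebraMap_eq]

/-- Heine's formula: expanding both Vandermonde determinants in the orthogonal polynomials, only
equal permutations survive, and each of the N! contributes the product of the norms. -/
theorem eigenvalueFunctional_one_eq {K : Type*} [CommRing K] (μ : ℕ → K) (P : ℕ → Polynomial K)
    (h : ℕ → K) (hdeg : ∀ n, (P n).natDegree = n) (hmonic : ∀ n, (P n).Monic)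
    (horth : ∀ n m, momentFunctional μ (P n * P m) = if n = m then h n else 0) :
    eigenvalueFunctional N μ 1 = (N ! : K) * ∏ n ∈ Finset.range N, h n := by
  classical
  have hint : ∀ z : ℤ, (z : MvPolynomial (Fin N) K) = MvPolynomial.C (z : K) := fun z =>
    (map_intCast (MvPolynomial.C : K →+* MvPolynomial (Fin N) K) z).symm
  have hprod : ∀ σ τ : Equiv.Perm (Fin N),
      ∏ i, momentFunctional μ (P (σ i) * P (τ i)) =
        if σ = τ then ∏ n ∈ Finset.range N, h n else 0 := by
    intro σ τ
    simp only [horth]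
    split_ifs with hστ
    · subst hστ
      simp only [if_true]
      rw [Equiv.prod_comp σ (fun i : Fin N => h i), Finset.prod_range]
    · obtain ⟨i, hi⟩ : ∃ i, σ i ≠ τ i := by
        by_contra hall
        push Not at hall
        exact hστ (Equiv.ext hall)
      refine Finset.prod_eq_zero (Finset.mem_univ i) (if_neg fun heq => hi (Fin.ext heq))
  rw [eigenvalueFunctional_apply, mul_one, pow_two, vandermondeProduct_eq_sum P hdeg hmonic,
    Finset.sum_mul_sum, map_sum]
  have hterm : ∀ σ τ : Equiv.Perm (Fin N), productFunctional (fun _ : Fin N => μ)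
      ((((Equiv.Perm.sign σ : ℤ) : MvPolynomial (Fin N) K) *
        ∏ i, Polynomial.aeval (MvPolynomial.X i) (P (σ i))) *
        (((Equiv.Perm.sign τ : ℤ) : MvPolynomial (Fin N) K) *
        ∏ i, Polynomial.aeval (MvPolynomial.X i) (P (τ i)))) =
      if σ = τ then ∏ n ∈ Finset.range N, h n else 0 := by
    intro σ τ
    rw [mul_mul_mul_comm, ← Finset.prod_mul_distrib]
    simp only [← map_mul]
    rw [hint, hint, ← map_mul, MvPolynomial.C_mul', map_smul, productFunctional_prod, hprod]
    split_ifs with hστ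
    · subst hστ
      rw [← Int.cast_mul, Int.units_coe_mul_self, Int.cast_one, one_smul]
    · rw [smul_zero]
  simp only [map_sum, hterm]
  simp [Fintype.card_perm]

theorem coeff_prod_orthoNorm (N : ℕ) (n : ℕ+ →₀ ℕ) :
    (N ! : ℝ) * coeff n (∏ i ∈ Finset.range N, orthoNorm i) =
      eigenvalueFunctional N standardMoment
        (n.prod fun j m => powerSum N ℝ (2 * (j : ℕ)) ^ m) / factorialProd n := by
  have h1 := eigenvalueFunctional_one_eq (N := N) coupledMoment orthoPoly orthoNorm
    natDegree_orthoPoly monic_orthoPoly coupledFunctional_orthoPoly_mul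
  -- The squared Vandermonde product does not involve the couplings, so they enter only through the
  -- moments.
  have h2 : (vandermondeProduct N CouplingSeries) ^ 2 =
      ((vandermondeProduct N ℝ) ^ 2).map C := by
    simp [vandermondeProduct]
  have h3 := congrArg (coeff n) h1
  rw [eigenvalueFunctional_apply, mul_one, h2, coeff_productFunctional_coupledMoment,
    ← map_natCast (C : ℝ →+* CouplingSeries), coeff_C_mul] at h3
  rw [← h3, eigenvalueFunctional_apply]

theorem eigenvalueFunctional_standardMoment_one (N : ℕ) :
    eigenvalueFunctional N standardMoment 1 =
      (N ! : ℝ) * ∏ i ∈ Finset.range N, (i ! : ℝ) := by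
  have h := coeff_prod_orthoNorm N 0
  rw [Finsupp.prod_zero_index, factorialProd, Finsupp.prod_zero_index, div_one,
    coeff_zero_eq_constantCoeff, map_prod] at h
  simp only [constantCoeff_orthoNorm] at h
  exact h.symm

theorem prod_map_toMultiset {M : Type*} [CommMonoid M] (n : ℕ+ →₀ ℕ) (f : ℕ → M) :
    ((n.toMultiset.map fun j : ℕ+ => 2 * (j : ℕ)).map f).prod =
      n.prod fun j m => f (2 * (j : ℕ)) ^ m := by
  induction n using Finsupp.induction_linear with
  | zero => simp
  | add g h hg hh =>
    rw [map_add, Multiset.map_add, Multiset.map_add, Multiset.prod_add, hg, hh,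
      Finsupp.prod_add_index' (fun _ => pow_zero _) (fun _ _ _ => pow_add _ _ _)]
  | single j m =>
    rw [Finsupp.prod_single_index (h := fun (j : ℕ+) m => f (2 * (j : ℕ)) ^ m) (pow_zero _),
      Finsupp.toMultiset_single, Multiset.map_nsmul, Multiset.map_nsmul, Multiset.prod_nsmul,
      Multiset.map_singleton, Multiset.map_singleton, Multiset.prod_singleton]

/-- The passage from matrices to eigenvalues: both normalised expectations solve the loop equations
with the same N, hence agree. -/
theorem integral_prod_tracePow_eq (N : ℕ) (n : ℕ+ →₀ ℕ) :
    ∫ y : Fin N → Fin N → ℝ, (n.prod fun j m => tracePow y (2 * (j : ℕ)) ^ m) *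
        gaussianDensity y =
      (∫ y : Fin N → Fin N → ℝ, gaussianDensity y) *
        (factorialProd n * coeff n (∏ i ∈ Finset.range N, orthoNorm i) /
          ∏ i ∈ Finset.range N, (i ! : ℝ)) := by
  have hpos : (∏ i ∈ Finset.range N, (i ! : ℝ)) ≠ 0 :=
    Finset.prod_ne_zero_iff.mpr fun _ _ => by positivity
  have hN : (N ! : ℝ) ≠ 0 := by positivity
  have h1 : eigenvalueFunctional N standardMoment 1 ≠ 0 := by
    rw [eigenvalueFunctional_standardMoment_one]
    exact mul_ne_zero hN hpos
  have h := congrFun ((satisfiesLoopEquations_tracePow N).unique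
    (satisfiesLoopEquations_eigenvalueFunctional standardMoment_succ h1))
    (n.toMultiset.map fun j : ℕ+ => 2 * (j : ℕ))
  simp only [prod_map_toMultiset] at h
  have h2 := coeff_prod_orthoNorm N n
  rw [eq_div_iff (factorialProd_ne_zero n)] at h2
  rw [← h2, eigenvalueFunctional_standardMoment_one, div_eq_iff integral_gaussianDensity_pos.ne']
    at h
  rw [h]
  field_simp

end

/-! ### Scaling of the partition function -/

theorem tracePow_smul {N : ℕ} (r : ℝ) (y : Fin N → Fin N → ℝ) (m : ℕ) :
    tracePow (r • y) m = r ^ m * tracePow y m := by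
  have h : hermitianOf (r • y) = (r : ℂ) • hermitianOf y := by
    ext i j
    simp only [hermitianOf, Matrix.of_apply, Matrix.smul_apply, Pi.smul_apply, smul_eq_mul]
    split_ifs <;> push_cast <;> ring
  rw [tracePow, h, smul_pow, Matrix.trace_smul, tracePow, smul_eq_mul, ← Complex.ofReal_pow,
    Complex.re_ofReal_mul]

theorem partitionFunction_normalisation (N : ℕ) :
    (2 * Real.pi) ^ (-(N : ℤ)) / flagVolume N *
      (∫ y : Fin N → Fin N → ℝ, gaussianDensity y) / ∏ i ∈ Finset.range N, (i ! : ℝ) =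
      (√(2 * Real.pi) ^ N)⁻¹ := by
  have hpi := Real.pi_pos
  have hprod : ((∏ n ∈ Finset.Icc 1 (N - 1), n ! : ℕ) : ℝ) = ∏ i ∈ Finset.range N, (i ! : ℝ) := by
    push_cast
    rcases N with _ | N
    · simp
    · rw [Finset.prod_range_succ', Nat.factorial_zero, Nat.cast_one, mul_one, Nat.add_sub_cancel,
        Finset.range_eq_Ico, Finset.prod_Ico_add' (fun i => (i ! : ℝ)) 0 N 1]
      rfl
  have hne : (∏ i ∈ Finset.range N, (i ! : ℝ)) ≠ 0 :=
    Finset.prod_ne_zero_iff.mpr fun _ _ => by positivity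
  have hsq : √Real.pi ^ (N * (N - 1)) = Real.pi ^ (N * (N - 1) / 2) := by
    obtain ⟨k, hk⟩ := Nat.even_mul_pred_self N
    rw [hk, ← two_mul, Nat.mul_div_cancel_left _ two_pos, pow_mul, Real.sq_sqrt hpi.le]
  have h2 : (2 * Real.pi) ^ N = √(2 * Real.pi) ^ N * √(2 * Real.pi) ^ N := by
    rw [← mul_pow, Real.mul_self_sqrt (by positivity)]
  rw [integral_gaussianDensity, flagVolume, hprod, hsq, zpow_neg, zpow_natCast, h2]
  have h3 : √(2 * Real.pi) ^ N ≠ 0 := by positivity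
  have h4 : Real.pi ^ (N * (N - 1) / 2) ≠ 0 := by positivity
  field_simp

/-- The substitution M ↦ √ε M has Jacobian √ε^(N²) on the N² real coordinates, and turns tr M^(2j) /
ε into ε^(j-1) tr M^(2j). -/
theorem partitionFunction_eq (N : ℕ) {ε : ℝ} (hε : 0 < ε) :
    partitionFunction N ε = C (√ε ^ (N * N) * (√(2 * Real.pi) ^ N)⁻¹) *
      scaleCouplings ε (∏ i ∈ Finset.range N, orthoNorm i) := by
  ext n
  have hs : 0 < √ε := Real.sqrt_pos.mpr hε
  rw [coeff_C_mul, coeff_scaleCouplings]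
  have h1 : coeff n (partitionFunction N ε) = (2 * Real.pi) ^ (-(N : ℤ)) / flagVolume N *
      ∫ y : Fin N → Fin N → ℝ,
        (n.prod fun j m => (tracePow y (2 * (j : ℕ)) / ε) ^ m / (m ! : ℝ)) *
          Real.exp (-(tracePow y 2 / (2 * ε))) := rfl
  have h2 := Measure.integral_comp_smul (volume : Measure (Fin N → Fin N → ℝ))
    (fun y => (n.prod fun j m => (tracePow y (2 * (j : ℕ)) / ε) ^ m / (m ! : ℝ)) *
          Real.exp (-(tracePow y 2 / (2 * ε)))) √ε
  have hrank : Module.finrank ℝ (Fin N → Fin N → ℝ) = N * N := by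
    rw [Module.finrank_pi_fintype]
    simp
  have h3 : (fun y : Fin N → Fin N → ℝ =>
      (n.prod fun j m => (tracePow (√ε • y) (2 * (j : ℕ)) / ε) ^ m / (m ! : ℝ)) *
          Real.exp (-(tracePow (√ε • y) 2 / (2 * ε)))) = fun y =>
      (ε ^ excess n / factorialProd n) *
        ((n.prod fun j m => tracePow y (2 * (j : ℕ)) ^ m) * gaussianDensity y) := by
    funext y
    have hexp : tracePow (√ε • y) 2 / (2 * ε) = tracePow y 2 / 2 := by
      rw [tracePow_smul, Real.sq_sqrt hε.le]
      field_simp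
    have hterm : (n.prod fun j m => (tracePow (√ε • y) (2 * (j : ℕ)) / ε) ^ m / (m ! : ℝ)) =
        (ε ^ excess n / factorialProd n) * n.prod fun j m => tracePow y (2 * (j : ℕ)) ^ m := by
      rw [← prod_pow_excess, factorialProd]
      simp only [Finsupp.prod]
      rw [← Finset.prod_div_distrib, ← Finset.prod_mul_distrib]
      refine Finset.prod_congr rfl fun j _ => ?_
      have hj : √ε ^ (2 * (j : ℕ)) = ε ^ ((j : ℕ) - 1) * ε := by
        rw [pow_mul, Real.sq_sqrt hε.le, ← pow_succ, Nat.sub_add_cancel j.pos]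
      rw [tracePow_smul, hj]
      rw [show ε ^ ((j : ℕ) - 1) * ε * tracePow y (2 * (j : ℕ)) / ε =
        ε ^ ((j : ℕ) - 1) * tracePow y (2 * (j : ℕ)) by field_simp, mul_pow]
      ring
    rw [hterm, hexp, gaussianDensity, mul_assoc]
  rw [h3, integral_const_mul, integral_prod_tracePow_eq, hrank, smul_eq_mul,
    abs_of_pos (by positivity)] at h2
  have hc : √ε ^ (N * N) ≠ 0 := by positivity
  rw [eq_comm, inv_mul_eq_iff_eq_mul₀ hc] at h2
  rw [h1, h2, ← partitionFunction_normalisation]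
  have h5 := factorialProd_ne_zero n
  field_simp

/-! ### Asymptotics of the recurrence coefficients -/

/-- The coefficients of `F n` of degree less than `d`, divided by `n ^ (p + excess k)`, tend to
those of `G`. -/
def ScaledTendsto (d p : ℕ) (F : ℕ → CouplingSeries) (G : CouplingSeries) : Prop :=
  ∀ k : ℕ+ →₀ ℕ, k.degree < d →
    Tendsto (fun n : ℕ => coeff k (F n) / (n : ℝ) ^ (p + excess k)) atTop (𝓝 (coeff k G))

namespace ScaledTendsto

variable {d p q : ℕ} {F F' : ℕ → CouplingSeries} {G G' : CouplingSeries}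

theorem const (G : CouplingSeries) (hG : ∀ k : ℕ+ →₀ ℕ, k ≠ 0 → coeff k G = 0) :
    ScaledTendsto d 0 (fun _ => G) G := by
  intro k _
  by_cases hk : k = 0
  · subst hk
    simp
  · simp [hG k hk]

theorem add (h : ScaledTendsto d p F G) (h' : ScaledTendsto d p F' G') :
    ScaledTendsto d p (fun n => F n + F' n) (G + G') := by
  intro k hk
  simpa only [map_add, add_div] using (h k hk).add (h' k hk)

theorem mul (h : ScaledTendsto d p F G) (h' : ScaledTendsto d q F' G') :
    ScaledTendsto d (p + q) (fun n => F n * F' n) (G * G') := by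
  classical
  intro k hk
  rw [coeff_mul]
  simp only [coeff_mul, Finset.sum_div]
  refine tendsto_finsetSum _ fun a ha => ?_
  have hsum := Finset.HasAntidiagonal.mem_antidiagonal.mp ha
  have hdeg : a.1.degree + a.2.degree = k.degree := by rw [← map_add, hsum]
  refine ((h a.1 (by lia)).mul (h' a.2 (by lia))).congr fun n => ?_
  rw [div_mul_div_comm, ← pow_add, ← hsum, map_add]
  ring_nf

theorem comp_add_iff (c : ℕ) :
    ScaledTendsto d p (fun n => F (n + c)) G ↔ ScaledTendsto d p F G := by
  have hratio : Tendsto (fun n : ℕ => ((n + c : ℕ) : ℝ) / n) atTop (𝓝 1) := by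
    have h0 : Tendsto (fun n : ℕ => 1 + (c : ℝ) / n) atTop (𝓝 (1 + 0)) :=
      tendsto_const_nhds.add (tendsto_const_div_atTop_nhds_zero_nat _)
    rw [add_zero] at h0
    refine h0.congr' ?_
    filter_upwards [eventually_gt_atTop 0] with n hn
    have : (n : ℝ) ≠ 0 := by positivity
    push_cast
    field_simp
  refine forall₂_congr fun k _ => ?_
  rw [← tendsto_add_atTop_iff_nat (f := fun n : ℕ => coeff k (F n) / (n : ℝ) ^ (p + excess k)) c]
  have hpow := hratio.pow (p + excess k)
  rw [one_pow] at hpow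
  constructor
  · intro h
    have h1 := h.div hpow one_ne_zero
    rw [div_one] at h1
    refine h1.congr' ?_
    filter_upwards [eventually_gt_atTop 0] with n hn
    have : (n : ℝ) ≠ 0 := by positivity
    have : ((n + c : ℕ) : ℝ) ≠ 0 := by positivity
    rw [Pi.div_apply, div_pow]
    field_simp
  · intro h
    have h1 := h.mul hpow
    rw [mul_one] at h1
    refine h1.congr' ?_
    filter_upwards [eventually_gt_atTop 0] with n hn
    have : (n : ℝ) ≠ 0 := by positivity
    have : ((n + c : ℕ) : ℝ) ≠ 0 := by positivity
    rw [div_pow]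
    field_simp

/-- Division of asymptotic expansions. -/
theorem of_mul (hF' : ∀ d, ScaledTendsto d q F' G') (h0 : constantCoeff G' = 1)
    (h : ∀ d, ScaledTendsto d (p + q) (fun n => F n * F' n) (G * G')) :
    ScaledTendsto d p F G := by
  classical
  induction d with
  | zero => exact fun k hk => absurd hk (Nat.not_lt_zero _)
  | succ d ih =>
    intro k hk
    have hlead : Tendsto (fun n : ℕ => coeff 0 (F' n) / (n : ℝ) ^ q) atTop (𝓝 1) := by
      have := hF' 1 0 (by simp)
      rwa [coeff_zero_eq_constantCoeff, h0, map_zero, add_zero] at this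
    have hmem : (k, (0 : ℕ+ →₀ ℕ)) ∈ Finset.HasAntidiagonal.antidiagonal k := by simp
    -- All other terms of the Cauchy product involve coefficients of `F` of strictly lower degree,
    -- whose limits are known by induction.
    have hrest : Tendsto (fun n : ℕ => ∑ a ∈ (Finset.HasAntidiagonal.antidiagonal k).erase (k, 0),
        coeff a.1 (F n) * coeff a.2 (F' n) / (n : ℝ) ^ (p + q + excess k)) atTop
        (𝓝 (∑ a ∈ (Finset.HasAntidiagonal.antidiagonal k).erase (k, 0), coeff a.1 G * coeff a.2 G')) := by
      refine tendsto_finsetSum _ fun a ha => ?_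
      have hsum := Finset.HasAntidiagonal.mem_antidiagonal.mp (Finset.mem_of_mem_erase ha)
      have hne : a.2 ≠ 0 := fun h2 => (Finset.mem_erase.mp ha).1 (by
        rw [h2, add_zero] at hsum
        exact Prod.ext hsum h2)
      have hdeg : a.1.degree + a.2.degree = k.degree := by rw [← map_add, hsum]
      have hpos : a.2.degree ≠ 0 := (Finsupp.degree_eq_zero_iff _).not.mpr hne
      refine ((ih a.1 (by lia)).mul (hF' (d + 1) a.2 (by lia))).congr fun n => ?_
      rw [div_mul_div_comm, ← pow_add, ← hsum, map_add]
      ring_nf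
    have htot := h (d + 1) k hk
    have h1 := (htot.sub hrest).div hlead one_ne_zero
    have hval : coeff k (G * G') - ∑ a ∈ (Finset.HasAntidiagonal.antidiagonal k).erase (k, 0),
        coeff a.1 G * coeff a.2 G' = coeff k G := by
      rw [coeff_mul, ← Finset.add_sum_erase _ _ hmem, coeff_zero_eq_constantCoeff, h0]
      ring
    rw [hval, div_one] at h1
    refine h1.congr' ?_
    filter_upwards [eventually_gt_atTop 0, hlead.eventually_ne one_ne_zero] with n hn hn0
    have hn' : (n : ℝ) ≠ 0 := by positivity
    have hc : coeff 0 (F' n) ≠ 0 := fun h2 => hn0 (by rw [h2, zero_div])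
    rw [Pi.div_apply, coeff_mul, ← Finset.add_sum_erase _ _ hmem, ← Finset.sum_div, ← sub_div,
      add_sub_cancel_right]
    rw [show p + q + excess k = p + excess k + q by ring, pow_add _ (p + excess k) q]
    field_simp

end ScaledTendsto

/-! ### Jacobi matrix entries as weighted lattice paths -/

theorem jacobiEntry_eq_zero (l n q : ℕ) (h : n + l < q) : jacobiEntry l n q = 0 := by
  induction l generalizing q with
  | zero => rw [jacobiEntry_zero, if_neg (by lia)]
  | succ l ih =>
    obtain ⟨q, rfl⟩ := Nat.exists_eq_succ_of_ne_zero (by lia : q ≠ 0)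
    rw [Nat.succ_eq_add_one, jacobiEntry_succ, ih _ (by lia), ih _ (by lia), mul_zero, add_zero]

/-- Going from m + 2u to m + l in l steps takes u down steps, each weighted by a recurrence
coefficient, and l - u up steps of weight 1. Conditioning on the last step gives Pascal's rule;
index shifts do not affect the limit. This choice of endpoints avoids subtraction. -/
theorem scaledTendsto_jacobiEntry {d : ℕ}
    (h : ScaledTendsto d 1 recurrenceCoeff unitSolution) (l u : ℕ) :
    ScaledTendsto d u (fun m => jacobiEntry l (m + 2 * u) (m + l))
      (C (l.choose u : ℝ) * unitSolution ^ u) := by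
  have hzero : ∀ p, ScaledTendsto d p (fun _ => 0) 0 := fun p k _ => by simp
  induction l generalizing u with
  | zero =>
    rcases u with _ | u
    · simpa [jacobiEntry_zero] using ScaledTendsto.const (d := d) (1 : CouplingSeries)
        fun k hk => by
          classical
          rw [coeff_one, if_neg hk]
    · simpa [jacobiEntry_zero] using hzero (u + 1)
  | succ l ih =>
    rcases u with _ | u
    · have e : (fun m => jacobiEntry (l + 1) (m + 2 * 0) (m + (l + 1))) =
          fun m => jacobiEntry l (m + 2 * 0) (m + l) := by
        funext m
        rw [← add_assoc, jacobiEntry_succ, jacobiEntry_eq_zero _ _ (m + l + 2) (by lia), mul_zero,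
          zero_add]
      rw [e, Nat.choose_zero_right, ← Nat.choose_zero_right l]
      exact ih 0
    · have e : (fun m => jacobiEntry (l + 1) (m + 2 * (u + 1)) (m + (l + 1))) =
          fun m => recurrenceCoeff (m + (l + 1)) * jacobiEntry l (m + 2 + 2 * u) (m + 2 + l) +
            jacobiEntry l (m + 2 * (u + 1)) (m + l) := by
        funext m
        rw [← add_assoc, jacobiEntry_succ, add_right_comm m l 2,
          show m + 2 * (u + 1) = m + 2 + 2 * u by ring]
      have h1 := (ScaledTendsto.comp_add_iff (l + 1)).mpr h
      have h2 := (ScaledTendsto.comp_add_iff 2).mpr (ih u)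
      have h3 := h1.mul h2
      rw [add_comm 1 u] at h3
      have h4 := h3.add (ih (u + 1))
      rw [e]
      convert h4 using 1
      rw [Nat.choose_succ_succ, Nat.cast_add, map_add]
      ring

theorem coeff_hasSum_C_mul_X_mul {a : ℕ+ → ℝ} {f : ℕ+ → CouplingSeries} {g : CouplingSeries}
    (h : HasSum (fun j => C (a j) * (X j * f j)) g) (k : ℕ+ →₀ ℕ) :
    coeff k g = ∑ j ∈ k.support, a j * coeff (k - Finsupp.single j 1) (f j) := by
  refine (WithPiTopology.hasSum_iff_hasSum_coeff.mp h k).unique ?_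
  have hle : ∀ j, Finsupp.single j 1 ≤ k ↔ j ∈ k.support := fun j => by
    rw [Finsupp.single_le_iff, Finsupp.mem_support_iff, Nat.one_le_iff_ne_zero]
  have hzero : ∀ j ∉ k.support, coeff k (C (a j) * (X j * f j)) = 0 := fun j hj => by
    rw [coeff_C_mul, coeff_X_mul_eq, if_neg (mt (hle j).mp hj), mul_zero]
  have hsupp := hasSum_sum_of_ne_finset_zero (L := .unconditional _) hzero
  have hval : ∑ j ∈ k.support, coeff k (C (a j) * (X j * f j)) =
      ∑ j ∈ k.support, a j * coeff (k - Finsupp.single j 1) (f j) :=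
    Finset.sum_congr rfl fun j hj => by
      rw [coeff_C_mul, coeff_X_mul_eq, if_pos ((hle j).mpr hj)]
  rwa [hval] at hsupp

theorem two_mul_choose_pred (j : ℕ+) :
    (2 * (j : ℕ) : ℝ) * ((2 * (j : ℕ) - 1).choose j : ℝ) =
      (j : ℝ) * ((2 * (j : ℕ)).choose j : ℝ) := by
  obtain ⟨i, hi⟩ := Nat.exists_eq_add_of_le' j.pos
  rw [hi, show 2 * (i + 1) - 1 = 2 * i + 1 by lia, show 2 * (i + 1) = 2 * i + 1 + 1 by ring,
    Nat.choose_succ_succ (2 * i + 1) i]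
  rw [Nat.choose_symm_half i]
  push_cast
  ring

/-- Induction on the degree in s: every term of the discrete string equation carries a coupling, so
a coefficient of R_n is governed by coefficients of lower degree, and the path count turns the limit
into the string equation at 1. -/
theorem scaledTendsto_recurrenceCoeff (d : ℕ) :
    ScaledTendsto d 1 recurrenceCoeff unitSolution := by
  induction d with
  | zero => exact fun k hk => absurd hk (Nat.not_lt_zero _)
  | succ d ih =>
    intro k hk
    have hunit : HasSum (fun j : ℕ+ => C ((j : ℝ) * ((2 * (j : ℕ)).choose j : ℝ)) *
        (X j * unitSolution ^ (j : ℕ))) (unitSolution - C 1) := by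
      simpa only [SolvesStringEquation, mul_assoc] using unitSolution_solves
    have h1 := coeff_hasSum_C_mul_X_mul hunit k
    have h2 := fun n => coeff_hasSum_C_mul_X_mul (hasSum_jacobiEntry n) k
    rw [map_sub, sub_eq_iff_eq_add] at h1
    simp only [map_sub, sub_eq_iff_eq_add] at h2
    simp only [h2, add_div, Finset.sum_div]
    rw [h1]
    refine (tendsto_finsetSum _ fun j hj => ?_).add ?_
    · have hj1 : Finsupp.single j 1 ≤ k := by
        rw [Finsupp.single_le_iff]
        exact Nat.one_le_iff_ne_zero.mpr (Finsupp.mem_support_iff.mp hj)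
      have hdeg := degree_sub_single_lt hj1
      -- Removing one s_j lowers the excess by j - 1, while j down steps supply n^j, so the powers
      -- of n match.
      have hex : 1 + excess k = (j : ℕ) + excess (k - Finsupp.single j 1) := by
        have := congrArg excess (tsub_add_cancel_of_le hj1)
        rw [map_add, excess_single] at this
        have := j.pos
        lia
      have h3 := scaledTendsto_jacobiEntry ih (2 * (j : ℕ) - 1) j
      have h4 : (fun m => jacobiEntry (2 * (j : ℕ) - 1) (m + 2 * (j : ℕ)) (m + (2 * (j : ℕ) - 1))) =
          fun m => (fun n => jacobiEntry (2 * (j : ℕ) - 1) (n + 1) n) (m + (2 * (j : ℕ) - 1)) := by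
        funext m
        have := j.pos
        rw [show m + 2 * (j : ℕ) = m + (2 * (j : ℕ) - 1) + 1 by lia]
      rw [h4] at h3
      have h5 := ((ScaledTendsto.comp_add_iff
        (F := fun n => jacobiEntry (2 * (j : ℕ) - 1) (n + 1) n) _).mp h3 _ (by lia : (k - Finsupp.single j 1).degree < d)).const_mul (2 * (j : ℕ) : ℝ)
      rw [coeff_C_mul, ← mul_assoc, two_mul_choose_pred] at h5
      refine h5.congr fun n => ?_
      rw [hex, mul_div_assoc]
    · by_cases hk0 : k = 0
      · subst hk0
        simp only [coeff_zero_eq_constantCoeff, constantCoeff_C, map_zero, add_zero, pow_one]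
        have h0 : Tendsto (fun n : ℕ => 1 + (1 : ℝ) / n) atTop (𝓝 (1 + 0)) :=
          tendsto_const_nhds.add tendsto_one_div_atTop_nhds_zero_nat
        rw [add_zero] at h0
        refine h0.congr' ?_
        filter_upwards [eventually_gt_atTop 0] with n hn
        have : (n : ℝ) ≠ 0 := by positivity
        field_simp
      · classical
        simp only [coeff_C, if_neg hk0, zero_div]
        exact tendsto_const_nhds

/-- The constant term log(n+1) of log R_n has no limit, so the degree derivation removes it: D log R
= D R / R, to which the division lemma `ScaledTendsto.of_mul` applies. -/
theorem tendsto_coeff_logSeries_recurrenceCoeff {k : ℕ+ →₀ ℕ} (hk : k ≠ 0) :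
    Tendsto (fun n : ℕ => coeff k (logSeries (recurrenceCoeff n)) / (n : ℝ) ^ excess k) atTop
      (𝓝 (coeff k (logSeries unitSolution))) := by
  set D := weightDerivation (degreeWeight ℕ+)
  have h : ScaledTendsto (k.degree + 1) 0 (fun n => D (logSeries (recurrenceCoeff n)))
      (D (logSeries unitSolution)) := by
    refine ScaledTendsto.of_mul scaledTendsto_recurrenceCoeff constantCoeff_unitSolution
      fun d => ?_
    have h1 : ∀ n, D (logSeries (recurrenceCoeff n)) * recurrenceCoeff n =
        D (recurrenceCoeff n) := fun n => weightDerivation_logSeries_mul _ (by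
          rw [constantCoeff_recurrenceCoeff]
          positivity)
    have h2 : D (logSeries unitSolution) * unitSolution = D unitSolution :=
      weightDerivation_logSeries_mul _ (by rw [constantCoeff_unitSolution]; exact one_ne_zero)
    simp only [h1, h2]
    intro k hk
    simp only [D, coeff_weightDerivation, mul_div_assoc, zero_add]
    exact (scaledTendsto_recurrenceCoeff d k hk).const_mul _
  have h1 := (h k (Nat.lt_succ_self _)).const_mul (degreeWeight ℕ+ k)⁻¹
  have hw := degreeWeight_ne_zero hk
  simp only [D, coeff_weightDerivation, mul_div_assoc, zero_add, inv_mul_cancel_left₀ hw] at h1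
  exact h1

/-- Off the constant term, log h_n is log h_0 plus the sum of log R_i for i < n. Summing a growth
n^e twice yields the factors e + 1 and e + 2. -/
theorem tendsto_sum_coeff_logSeries_orthoNorm {k : ℕ+ →₀ ℕ} (hk : k ≠ 0) :
    Tendsto (fun N : ℕ => (∑ i ∈ Finset.range N, coeff k (logSeries (orthoNorm i))) /
      (N : ℝ) ^ (excess k + 2)) atTop (𝓝 (coeff k (logSeries unitSolution) /
        (((excess k : ℝ) + 1) * ((excess k : ℝ) + 2)))) := by
  have hstep : ∀ n, coeff k (logSeries (orthoNorm n)) = coeff k (logSeries (orthoNorm 0)) +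
      ∑ i ∈ Finset.range n, coeff k (logSeries (recurrenceCoeff i)) := by
    intro n
    induction n with
    | zero => simp
    | succ n ih =>
      rw [← recurrenceCoeff_mul_orthoNorm, coeff_logSeries_mul _ (constantCoeff_orthoNorm_ne_zero n)
        hk, ih, Finset.sum_range_succ]
      · ring
      · rw [constantCoeff_recurrenceCoeff]
        positivity
  have h1 := tendsto_sum_div_pow (excess k) (tendsto_coeff_logSeries_recurrenceCoeff hk)
  have h0 : Tendsto (fun n : ℕ => coeff k (logSeries (orthoNorm 0)) / (n : ℝ) ^ (excess k + 1))
      atTop (𝓝 0) :=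
    tendsto_const_nhds.div_atTop
      ((tendsto_pow_atTop (Nat.succ_ne_zero _)).comp tendsto_natCast_atTop_atTop)
  have h2 := h0.add h1
  simp only [← add_div, ← hstep, zero_add] at h2
  have h3 := tendsto_sum_div_pow (excess k + 1) h2
  convert h3 using 2
  push_cast
  rw [div_div]
  ring

theorem constantCoeff_scaleCouplings (x : ℝ) (f : CouplingSeries) :
    constantCoeff (scaleCouplings x f) = constantCoeff f := by
  rw [← coeff_zero_eq_constantCoeff_apply, coeff_scaleCouplings, map_zero, pow_zero, one_mul,
    coeff_zero_eq_constantCoeff_apply]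

theorem coeff_logSeries_scaleCouplings (x : ℝ) {f : CouplingSeries} (hf : constantCoeff f ≠ 0)
    {k : ℕ+ →₀ ℕ} (hk : k ≠ 0) :
    coeff k (logSeries (scaleCouplings x f)) = x ^ excess k * coeff k (logSeries f) := by
  set D := weightDerivation (degreeWeight ℕ+)
  have hcomm : ∀ g : CouplingSeries, D (scaleCouplings x g) = scaleCouplings x (D g) := by
    intro g
    ext n
    simp only [D, coeff_weightDerivation, coeff_scaleCouplings]
    ring
  have hc := constantCoeff_scaleCouplings x f
  have h1 : D (logSeries (scaleCouplings x f)) * scaleCouplings x f = D (scaleCouplings x f) :=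
    weightDerivation_logSeries_mul _ (by rwa [hc])
  have h2 : D (scaleCouplings x (logSeries f)) * scaleCouplings x f = D (scaleCouplings x f) := by
    rw [hcomm, hcomm, ← map_mul, ← weightDerivation_logSeries_mul _ hf]
  have hne : scaleCouplings x f ≠ 0 := fun h => hf (by rw [← hc, h, map_zero])
  have h3 := congrArg (coeff k) (mul_right_cancel₀ hne (h1.trans h2.symm))
  simp only [D, coeff_weightDerivation] at h3
  rw [mul_left_cancel₀ (degreeWeight_ne_zero hk) h3, coeff_scaleCouplings]

/-! ### The genus zero free energy -/

theorem constantCoeff_prod_orthoNorm (N : ℕ) :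
    constantCoeff (∏ i ∈ Finset.range N, orthoNorm i) = ∏ i ∈ Finset.range N, (i ! : ℝ) := by
  rw [map_prod]
  exact Finset.prod_congr rfl fun i _ => constantCoeff_orthoNorm i

theorem prod_factorial_ne_zero (N : ℕ) : ∏ i ∈ Finset.range N, (i ! : ℝ) ≠ 0 :=
  Finset.prod_ne_zero_iff.mpr fun _ _ => by positivity

theorem coeff_freeEnergy (N : ℕ) {ε : ℝ} (hε : 0 < ε) {k : ℕ+ →₀ ℕ} (hk : k ≠ 0) :
    coeff k (freeEnergy N ε) =
      ε ^ excess k * ∑ i ∈ Finset.range N, coeff k (logSeries (orthoNorm i)) := by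
  classical
  have hs : 0 < √ε := Real.sqrt_pos.mpr hε
  have hc : √ε ^ (N * N) * (√(2 * Real.pi) ^ N)⁻¹ ≠ 0 := by positivity
  have h0 : constantCoeff (∏ i ∈ Finset.range N, orthoNorm i) ≠ 0 := by
    rw [constantCoeff_prod_orthoNorm]
    exact prod_factorial_ne_zero N
  rw [freeEnergy, map_sub, coeff_C, if_neg hk, sub_zero, partitionFunction_eq N hε,
    coeff_logSeries_mul (by rwa [constantCoeff_C]) (by rwa [constantCoeff_scaleCouplings]) hk,
    coeff_logSeries_C hc hk, zero_add, coeff_logSeries_scaleCouplings ε h0 hk,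
    coeff_logSeries_prod _ _ (fun i _ => constantCoeff_orthoNorm_ne_zero i) hk]

theorem constantCoeff_freeEnergy (N : ℕ) {ε : ℝ} (hε : 0 < ε) :
    constantCoeff (freeEnergy N ε) = -(N / 2 * Real.log (2 * Real.pi))
      + (N : ℝ) ^ 2 / 2 * Real.log ε + (∑ n ∈ Finset.range N, Real.log (n ! : ℝ))
      - 1 / 12 * Real.log ε := by
  have hs : 0 < √ε := Real.sqrt_pos.mpr hε
  have h1 : √ε ^ (N * N) ≠ 0 := by positivity
  have h2 : √(2 * Real.pi) ^ N ≠ 0 := by positivity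
  have h3 : constantCoeff (partitionFunction N ε) =
      √ε ^ (N * N) * (√(2 * Real.pi) ^ N)⁻¹ * ∏ i ∈ Finset.range N, (i ! : ℝ) := by
    rw [partitionFunction_eq N hε, map_mul, constantCoeff_C, constantCoeff_scaleCouplings,
      constantCoeff_prod_orthoNorm]
  have h4 := prod_factorial_ne_zero N
  rw [freeEnergy, map_sub, constantCoeff_C, constantCoeff_logSeries, h3,
    Real.log_mul (mul_ne_zero h1 (inv_ne_zero h2)) h4, Real.log_mul h1 (inv_ne_zero h2),
    Real.log_inv, Real.log_pow, Real.log_pow, Real.log_sqrt hε.le, Real.log_sqrt (by positivity),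
    Real.log_prod fun i _ => by positivity]
  · push_cast
    ring
  · rw [h3]
    exact mul_ne_zero (mul_ne_zero h1 (inv_ne_zero h2)) h4

/-- The coefficients of the genus zero free energy. -/
def genusZeroCoeff (n : ℕ+ →₀ ℕ) (x : ℝ) : ℝ :=
  if n = 0 then x ^ 2 / 2 * Real.log x - 3 / 4 * x ^ 2
  else coeff n (logSeries unitSolution) / (((excess n : ℝ) + 1) * ((excess n : ℝ) + 2)) *
    x ^ (excess n + 2)

theorem tendsto_scaledCoeff {x : ℝ} (hx : 0 < x) (n : ℕ+ →₀ ℕ) :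
    Tendsto (scaledCoeff x n) atTop (𝓝 (genusZeroCoeff n x)) := by
  by_cases hn : n = 0
  · subst hn
    rw [genusZeroCoeff, if_pos rfl]
    refine (tendsto_gaussian_freeEnergy hx).congr' ?_
    filter_upwards [eventually_gt_atTop 0] with N hN
    have hε : 0 < x / N := by positivity
    rw [scaledCoeff, coeff_zero_eq_constantCoeff_apply, constantCoeff_freeEnergy N hε]
  · rw [genusZeroCoeff, if_neg hn]
    refine ((tendsto_sum_coeff_logSeries_orthoNorm hn).mul_const _).congr' ?_
    filter_upwards [eventually_gt_atTop 0] with N hN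
    have hε : 0 < x / N := by positivity
    have hN' : (N : ℝ) ≠ 0 := by positivity
    rw [scaledCoeff, coeff_freeEnergy N hε hn, div_pow, div_pow]
    field_simp
    ring

theorem coeff_genusZero {x : ℝ} (hx : 0 < x) (n : ℕ+ →₀ ℕ) :
    coeff n (genusZero x) = genusZeroCoeff n x :=
  (tendsto_scaledCoeff hx n).limUnder_eq

theorem contDiffOn_genusZeroCoeff (n : ℕ+ →₀ ℕ) :
    ContDiffOn ℝ ∞ (genusZeroCoeff n) (Set.Ioi 0) := by
  unfold genusZeroCoeff
  split_ifs
  · have hlog : ContDiffOn ℝ ∞ Real.log (Set.Ioi 0) :=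
      Real.contDiffOn_log.mono fun x hx => ne_of_gt hx
    fun_prop
  · fun_prop

/-! ### Second derivative in x, identification of w, and the closed formula -/

theorem coeff_logSeries_solution {x : ℝ} (hx : 0 < x) {n : ℕ+ →₀ ℕ} (hn : n ≠ 0) :
    coeff n (logSeries (solution x)) = x ^ excess n * coeff n (logSeries unitSolution) := by
  have h1 : constantCoeff unitSolution ≠ 0 := by
    rw [constantCoeff_unitSolution]
    exact one_ne_zero
  rw [solution, coeff_logSeries_mul (by rw [constantCoeff_C]; exact hx.ne')
    (by rwa [constantCoeff_scaleCouplings]) hn, coeff_logSeries_C hx.ne' hn, zero_add,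
    coeff_logSeries_scaleCouplings x h1 hn]

theorem iteratedDeriv_two_eq {f g h : ℝ → ℝ} {s : Set ℝ} (hs : IsOpen s)
    (hf : ∀ x ∈ s, HasDerivAt f (g x) x) (hg : ∀ x ∈ s, HasDerivAt g (h x) x) {x : ℝ}
    (hx : x ∈ s) : iteratedDeriv 2 f x = h x := by
  have h1 : deriv f =ᶠ[𝓝 x] g := by
    filter_upwards [hs.mem_nhds hx] with y hy
    exact (hf y hy).deriv
  rw [iteratedDeriv_succ, iteratedDeriv_one, h1.deriv_eq]
  exact (hg x hx).deriv

theorem iteratedDeriv_two_genusZeroCoeff {x : ℝ} (hx : 0 < x) (n : ℕ+ →₀ ℕ) :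
    iteratedDeriv 2 (genusZeroCoeff n) x = coeff n (logSeries (solution x)) := by
  by_cases hn : n = 0
  · subst hn
    rw [coeff_zero_eq_constantCoeff_apply, constantCoeff_logSeries (by
      rw [constantCoeff_solution]; exact hx.ne'), constantCoeff_solution]
    refine iteratedDeriv_two_eq (g := fun y => y * Real.log y - y) (h := Real.log) isOpen_Ioi
      (fun y hy => ?_) (fun y hy => ?_) (Set.mem_Ioi.mpr hx)
    · have hy0 : y ≠ 0 := ne_of_gt hy
      have h1 : HasDerivAt (genusZeroCoeff 0) _ y :=
        (((hasDerivAt_pow 2 y).div_const 2).mul (Real.hasDerivAt_log hy0)).sub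
          ((hasDerivAt_pow 2 y).const_mul (3 / 4))
      refine h1.congr_deriv ?_
      field_simp
      ring
    · have hy0 : y ≠ 0 := ne_of_gt hy
      have h1 := ((hasDerivAt_id y).mul (Real.hasDerivAt_log hy0)).sub (hasDerivAt_id y)
      refine h1.congr_deriv ?_
      simp [hy0]
  · rw [coeff_logSeries_solution hx hn]
    have hfun : genusZeroCoeff n = fun x => coeff n (logSeries unitSolution) /
        (((excess n : ℝ) + 1) * ((excess n : ℝ) + 2)) * x ^ (excess n + 2) := by
      funext y
      rw [genusZeroCoeff, if_neg hn]
    rw [hfun]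
    refine iteratedDeriv_two_eq (g := fun y => coeff n (logSeries unitSolution) /
        ((excess n : ℝ) + 1) * y ^ (excess n + 1))
      (h := fun y => y ^ excess n * coeff n (logSeries unitSolution)) isOpen_univ
      (fun y _ => ?_) (fun y _ => ?_) (Set.mem_univ x)
    · refine ((hasDerivAt_pow (excess n + 2) y).const_mul _).congr_deriv ?_
      rw [show excess n + 2 - 1 = excess n + 1 by lia]
      push_cast
      field_simp
    · refine ((hasDerivAt_pow (excess n + 1) y).const_mul _).congr_deriv ?_
      rw [Nat.add_sub_cancel]
      push_cast
      field_simp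

theorem secondDeriv_genusZero {x : ℝ} (hx : 0 < x) :
    secondDeriv genusZero x = logSeries (solution x) := by
  ext n
  rw [← iteratedDeriv_two_genusZeroCoeff hx n]
  -- The formula for F₀ is known only for x > 0, but derivatives are local and the half-line is
  -- open.
  refine Filter.EventuallyEq.iteratedDeriv_eq 2 ?_
  filter_upwards [Ioi_mem_nhds hx] with y hy
  exact coeff_genusZero hy n

theorem w_eq_solution {x : ℝ} (hx : 0 < x) : w x = solution x := by
  rw [w, secondDeriv_genusZero hx, expSeries_logSeries]
  rwa [constantCoeff_solution]

/-- Both sides have the same coefficients after multiplication by (e+1)(e+2). At the constant term e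
= 0, and the limit -(3/4) x² matches half of -(3/2) x². -/
theorem genusZero_eq_closedForm {x : ℝ} (hx : 0 < x) :
    genusZero x = closedForm x (solution x) := by
  classical
  ext n
  have h := coeff_closedForm hx (solution_solves x) (constantCoeff_solution x) n
  have hd : ((excess n : ℝ) + 1) * ((excess n : ℝ) + 2) ≠ 0 := by positivity
  refine mul_left_cancel₀ hd ?_
  rw [h, coeff_genusZero hx, genusZeroCoeff, coeff_C]
  split_ifs with hn
  · subst hn
    rw [coeff_zero_eq_constantCoeff_apply, constantCoeff_logSeries (by
      rw [constantCoeff_solution]; exact hx.ne'), constantCoeff_solution, map_zero]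
    push_cast
    ring
  · rw [coeff_logSeries_solution hx hn]
    field_simp
    ring

end GUE

end

theorem proposition1p1 :
    -- `F₀` is well defined, and smooth in `x > 0`
    (∀ x : ℝ, 0 < x → ∀ n : ℕ+ →₀ ℕ,
      Tendsto (GUE.scaledCoeff x n) atTop (𝓝 (MvPowerSeries.coeff n (GUE.genusZero x)))) ∧
    (∀ n : ℕ+ →₀ ℕ,
      ContDiffOn ℝ ∞ (fun x => MvPowerSeries.coeff n (GUE.genusZero x)) (Set.Ioi 0)) ∧
    -- for each `x > 0`, `w(x, s)` is the unique solution among the formal series in `s`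
    (∀ x : ℝ, 0 < x → ∀ V : GUE.CouplingSeries,
      GUE.SolvesStringEquation (MvPowerSeries.C x) MvPowerSeries.X V ↔ V = GUE.w x) ∧
    -- `w` is the unique solution `W` among the formal power series in `x, s`, and `W = x + …`
    (∃ W : GUE.FullSeries,
      (∀ V : GUE.FullSeries,
        GUE.SolvesStringEquation (MvPowerSeries.X none) (fun k => MvPowerSeries.X (some k)) V ↔
          V = W) ∧
      (∀ m : ℕ, GUE.fullCoeff m 0 W = if m = 1 then 1 else 0) ∧
      (∀ x : ℝ, 0 < x → ∀ n : ℕ+ →₀ ℕ,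
        HasSum (fun m : ℕ => GUE.fullCoeff m n W * x ^ m)
          (MvPowerSeries.coeff n (GUE.w x)))) ∧
    -- the explicit formula for `F₀`
    (∀ x : ℝ, 0 < x →
      Summable (GUE.singleTerm x) ∧ Summable (GUE.doubleTerm x) ∧
      GUE.genusZero x =
        MvPowerSeries.C (1 / 4) * GUE.w x ^ 2 - MvPowerSeries.C x * GUE.w x
          + ∑' k : ℕ+, GUE.singleTerm x k
          + MvPowerSeries.C (1 / 2) * ∑' p : ℕ+ × ℕ+, GUE.doubleTerm x p
          + MvPowerSeries.C (x ^ 2 / 2) * GUE.logSeries (GUE.w x)) := by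
  refine ⟨fun x hx n => ?_, fun n => ?_, fun x hx V => ?_, ⟨GUE.fullSolution,
    GUE.solvesStringEquation_full_iff, GUE.fullCoeff_fullSolution_zero, fun x hx n => ?_⟩,
    fun x hx => ⟨GUE.summable_linearTerm x (GUE.w x), GUE.summable_quadraticTerm (GUE.w x), ?_⟩⟩
  · rw [GUE.coeff_genusZero hx]
    exact GUE.tendsto_scaledCoeff hx n
  · exact (GUE.contDiffOn_genusZeroCoeff n).congr fun x hx => GUE.coeff_genusZero hx n
  · rw [GUE.w_eq_solution hx]
    exact GUE.solvesStringEquation_iff x V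
  · rw [GUE.w_eq_solution hx]
    exact GUE.hasSum_fullCoeff_fullSolution x n
  · have h := GUE.genusZero_eq_closedForm hx
    rw [← GUE.w_eq_solution hx] at h
    exact h
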